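/- Let $\mathscr P$ be the set of all integer partitions $\lambda=(\lambda_1\ge\lambda_2\ge\dots)$. For even $k\ge 2$ let $S_k:\mathscr P\to\mathbb Q$ be the moment function $S_k(\lambda)=-\frac{B_k}{2k}+\sum_i\lambda_i^{k-1}$, the sum being over the (nonzero) parts of $\lambda$ and $B_k$ denoting the $k$th Bernoulli number, and let $\mathcal S\subset\mathbb Q^{\mathscr P}$ be the $\mathbb Q$-algebra generated by the $S_k$ under the pointwise product. The $S_k$ are algebraically independent, so partial derivatives $\partial/\partial S_k$ act on $\mathcal S$. Let $W$ be the weight operator on $\mathcal S$, i.e. the derivation with $WS_k=kS_k$, and put $$\mathfrak s=\frac12\sum_{k,l\ge0}(k+l)\,S_{k+l}\frac{\partial^2}{\partial S_{k+1}\,\partial S_{l+1}}-\frac12\frac{\partial}{\partial S_2},$$ where only the generators $S_{k+1},S_{l+1}$ with even indices occur. The $q$-bracket of $f:\mathscr P\to\mathbb Q$ is $$\langle f\rangle_q=\frac{\sum_{\lambda}f(\lambda)q^{|\lambda|}}{\sum_\lambda q^{|\lambda|}}\in\mathbb Q[[q]].$$ Let $\mathrm{Hol}_0$ be the ring of holomorphic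 functions $\phi$ on the upper half plane such that for every $C>0$ one has $\phi(x+iy)=O(e^{Cy})$ as $y\to\infty$ and $\phi(x+iy)=O(e^{C/y})$ as $y\to0$, uniformly in $x$. A quasimodular form of weight $k$ is a $\phi\in\mathrm{Hol}_0$ for which there are $p\ge 0$ and $\phi_0,\dots,\phi_p\in\mathrm{Hol}_0$ with $$(c\tau+d)^{-k}\phi\Bigl(\frac{a\tau+b}{c\tau+d}\Bigr)=\sum_{r=0}^p\phi_r(\tau)\Bigl(\frac{c}{c\tau+d}\Bigr)^r\qquad\text{for all }\begin{pmatrix}a&b\\c&d\end{pmatrix}\in\mathrm{SL}_2(\mathbb Z)$$ and all $\tau$ in the upper half plane. Let $\widetilde M=\bigoplus_k\widetilde M_k$ be the space of all quasimodular forms, graded by weight. On $\widetilde M$ let $D=\frac1{2\pi i}\frac{d}{d\tau}$, let $W$ be multiplication by the weight, let $\mathfrak d$ be given by $\phi\mapsto 2\pi i\,\phi_1$ in each weight (with $\phi_1=0$ if $p=0$), and let $G_2=-\frac{B_2}{4}+\sum_{m,r\ge1}m\,q^{mr}$ with $q=e^{2\pi i\tau}$. A triple $(X,Y,H)$ of operators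 is called an $\mathfrak{sl}_2$-triple if $[H,X]=2X$, $[H,Y]=-2Y$ and $[Y,X]=H$, where $[A,B]=AB-BA$. **Theorem.** (i) The triple (multiplication by $S_2$, $\mathfrak s$, $W-\frac12$) is an $\mathfrak{sl}_2$-triple of operators on $\mathcal S$. (ii) The triple ($D+$ multiplication by $G_2$, $\mathfrak d$, $W-\frac12$) is an $\mathfrak{sl}_2$-triple of operators on $\widetilde M$. (iii) For every $f\in\mathcal S$ the series $\langle f\rangle_q$ with $q=e^{2\pi i\tau}$ converges for all $\tau$ in the upper half plane to an element of $\widetilde M$, and the resulting $\mathbb Q$-linear map $\langle\,\cdot\,\rangle_q:\mathcal S\to\widetilde M$ satisfies, for all $f\in\mathcal S$, $$(D+G_2)\langle f\rangle_q=\langle S_2f\rangle_q,\qquad (W-\tfrac12)\langle f\rangle_q=\langle (W-\tfrac12)f\rangle_q,\qquad \mathfrak d\langle f\rangle_q=\langle\mathfrak s f\rangle_q.$$ -/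

import Mathlib

namespace PartitionSl2
noncomputable section

/-- A triple `(X, Y, H)` of operators (elements of an endomorphism ring) with
`[H, X] = 2X`, `[H, Y] = -2Y`, `[Y, X] = H`, where `[A, B] = AB - BA`. -/
structure IsSl2OperatorTriple {A : Type*} [Ring A] (X Y H : A) : Prop where
  comm_H_X : H * X - X * H = 2 • X
  comm_H_Y : H * Y - Y * H = -(2 • Y)
  comm_Y_X : Y * X - X * Y = H

/-- The set of all integer partitions. -/
abbrev Ptn : Type := Σ n : ℕ, n.Partition

/-- The `q`-bracket of a function on partitions, as a formal power series. -/
def qBracket (f : Ptn → ℚ) : PowerSeries ℚ :=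
  (PowerSeries.mk fun n => ∑ p : n.Partition, f ⟨n, p⟩) *
    (PowerSeries.mk fun n => ∑ _p : n.Partition, (1 : ℚ))⁻¹

/-- The moment function `S_k(λ) = -B_k / (2k) + ∑ᵢ λᵢ ^ (k - 1)` (used for even `k ≥ 2`). -/
def momentS (k : ℕ) (l : Ptn) : ℚ :=
  -(bernoulli k) / (2 * (k : ℚ)) + (l.2.parts.map fun m : ℕ => (m : ℚ) ^ (k - 1)).sum

/-- Even positive integers, the indices of the moment functions. -/
abbrev EvenPos : Type := {k : ℕ // Even k ∧ 0 < k}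

/-- The algebra generated by the moment functions under the pointwise product. -/
def algS : Subalgebra ℚ (Ptn → ℚ) :=
  Algebra.adjoin ℚ (Set.range fun k : EvenPos => momentS k)

/-- The partition of which `i + 1` is a part with multiplicity `r i`. -/
def ptnOfMult {N : ℕ} (r : Fin N → ℕ) : Ptn :=
  ⟨_, { parts := ∑ i : Fin N, Multiset.replicate (r i) ((i : ℕ) + 1)
        parts_pos := by
          intro j hj
          obtain ⟨i, -, hi⟩ := Multiset.mem_sum.1 hj
          rw [Multiset.eq_of_mem_replicate hi]
          exact Nat.succ_pos _
        parts_sum := rfl }⟩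

theorem momentS_ptnOfMult {N : ℕ} (r : Fin N → ℕ) (k : ℕ) :
    momentS k (ptnOfMult r) = -(bernoulli k) / (2 * (k : ℚ)) +
      ∑ i : Fin N, (((i : ℕ) + 1 : ℕ) : ℚ) ^ (k - 1) * r i := by
  unfold momentS ptnOfMult
  congr 1
  simp only
  rw [← Multiset.coe_mapAddMonoidHom, map_sum, ← Multiset.coe_sumAddMonoidHom, map_sum]
  refine Finset.sum_congr rfl fun i _ => ?_
  simp [mul_comm]

/-- The matrix of odd powers `(i + 1) ^ (2 j + 1)`. -/
def powMat (N : ℕ) : Matrix (Fin N) (Fin N) ℚ :=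
  Matrix.of fun j i => (((i : ℕ) + 1 : ℕ) : ℚ) ^ (2 * (j : ℕ) + 1)

theorem powMat_det_ne_zero (N : ℕ) : (powMat N).det ≠ 0 := by
  have h : powMat N = (Matrix.vandermonde fun i : Fin N => ((((i : ℕ) + 1 : ℕ) : ℚ)) ^ 2).transpose *
      Matrix.diagonal fun i : Fin N => (((i : ℕ) + 1 : ℕ) : ℚ) := by
    ext j i
    simp [powMat, Matrix.mul_diagonal, Matrix.vandermonde_apply, pow_succ, pow_mul]
  rw [h, Matrix.det_mul, Matrix.det_transpose, Matrix.det_diagonal]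
  refine mul_ne_zero ?_ (Finset.prod_ne_zero_iff.2 fun i _ => by positivity)
  rw [Matrix.det_vandermonde_ne_zero_iff]
  intro i j hij
  simp only at hij
  have := (pow_left_inj₀ (by positivity) (by positivity) two_ne_zero).1 hij
  exact Fin.ext (by simpa using this)

theorem algebraicIndependent_fin (N : ℕ) :
    AlgebraicIndependent ℚ fun j : Fin N => momentS (2 * (j : ℕ) + 2) := by
  rw [algebraicIndependent_iff]
  intro p hp
  set a : Fin N → ℚ := fun j =>
    -(bernoulli (2 * (j : ℕ) + 2)) / (2 * ((2 * (j : ℕ) + 2 : ℕ) : ℚ)) with ha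
  have hev : ∀ y : Fin N → ℚ, MvPolynomial.eval (a + (powMat N).mulVec y) p = 0 := by
    intro y
    let q : MvPolynomial (Fin N) ℚ := MvPolynomial.aeval (fun j : Fin N =>
      MvPolynomial.C (a j) + ∑ i : Fin N, MvPolynomial.C (powMat N j i) * MvPolynomial.X i) p
    have hq : ∀ z : Fin N → ℚ, MvPolynomial.eval z q =
        MvPolynomial.eval (a + (powMat N).mulVec z) p := by
      intro z
      have : MvPolynomial.eval z q = MvPolynomial.aeval z q := by
        rw [MvPolynomial.aeval_eq_eval]
      rw [this, ← AlgHom.comp_apply, MvPolynomial.comp_aeval, ← MvPolynomial.aeval_eq_eval]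
      congr 2
      ext j
      simp [Matrix.mulVec, dotProduct]
    have hq0 : q = 0 := by
      refine MvPolynomial.funext_set (fun _ : Fin N => Set.range ((↑) : ℕ → ℚ))
        (fun _ => Set.infinite_range_of_injective Nat.cast_injective) ?_
      intro z hz
      choose r hr using fun i => hz i (Set.mem_univ i)
      rw [hq, map_zero]
      have h1 := congrFun hp (ptnOfMult r)
      rw [show (MvPolynomial.aeval (fun j : Fin N => momentS (2 * (j : ℕ) + 2)) p) (ptnOfMult r) =
        (Pi.evalAlgHom ℚ (fun _ : Ptn => ℚ) (ptnOfMult r))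
          (MvPolynomial.aeval (fun j : Fin N => momentS (2 * (j : ℕ) + 2)) p) from rfl,
        ← AlgHom.comp_apply, MvPolynomial.comp_aeval] at h1
      rw [← MvPolynomial.aeval_eq_eval]
      rw [Pi.zero_apply] at h1
      convert h1 using 3
      ext j
      simp [momentS_ptnOfMult, ha, Matrix.mulVec, dotProduct, powMat, ← hr]
    rw [← hq, hq0, map_zero]
  refine MvPolynomial.funext fun x => ?_
  rw [map_zero]
  have hu : IsUnit (powMat N).det := (powMat_det_ne_zero N).isUnit
  have := hev ((powMat N)⁻¹.mulVec (x - a))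
  rwa [Matrix.mulVec_mulVec, Matrix.mul_nonsing_inv _ hu, Matrix.one_mulVec,
    add_sub_cancel] at this

/-- The moment functions are algebraically independent, so that partial derivatives with respect
to them are well defined. -/
theorem algebraicIndependent_momentS :
    AlgebraicIndependent ℚ fun k : EvenPos => momentS k := by
  have hnat : AlgebraicIndependent ℚ fun j : ℕ => momentS (2 * j + 2) := by
    rw [algebraicIndependent_iff]
    intro p hp
    obtain ⟨N, hN⟩ : ∃ N, ∀ j ∈ p.vars, j < N :=
      ⟨p.vars.sup id + 1, fun j hj => Nat.lt_succ_of_le (Finset.le_sup (f := id) hj)⟩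
    obtain ⟨q, rfl⟩ := MvPolynomial.exists_rename_eq_of_vars_subset_range p
      (Fin.val : Fin N → ℕ) Fin.val_injective (fun j hj => ⟨⟨j, hN j hj⟩, rfl⟩)
    rw [MvPolynomial.aeval_rename] at hp
    rw [(algebraicIndependent_iff.1 (algebraicIndependent_fin N)) q hp, map_zero]
  have hinj : Function.Injective fun k : EvenPos => (k : ℕ) / 2 - 1 := by
    rintro ⟨a, ⟨a', rfl⟩, ha⟩ ⟨b, ⟨b', rfl⟩, hb⟩ h
    simp only [Subtype.mk.injEq] at h ⊢
    omega
  convert hnat.comp _ hinj using 2 with k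
  obtain ⟨a, ⟨a', rfl⟩, ha⟩ := k
  simp only [Function.comp]
  congr 1
  omega

/-- Polynomials in the variables `S_k` (`k ≥ 2` even) are the same as elements of `algS`. -/
def polyEquiv : MvPolynomial EvenPos ℚ ≃ₐ[ℚ] algS :=
  algebraicIndependent_momentS.aevalEquiv

/-- The moment function `S_k`, as an element of `algS`. -/
def genS (k : EvenPos) : algS := ⟨momentS k, Algebra.subset_adjoin ⟨k, rfl⟩⟩

theorem polyEquiv_X (k : EvenPos) : polyEquiv (MvPolynomial.X k) = genS k := by
  ext1
  exact (algebraicIndependent_momentS.algebraMap_aevalEquiv (MvPolynomial.X k)).trans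
    (MvPolynomial.aeval_X _ k)

/-- The derivation with `S_k ↦ k S_k`. -/
def weightPoly : Module.End ℚ (MvPolynomial EvenPos ℚ) :=
  (MvPolynomial.mkDerivation ℚ fun k : EvenPos =>
    ((k : ℕ) : ℚ) • (MvPolynomial.X k : MvPolynomial EvenPos ℚ)).toLinearMap

/-- `weightPoly` multiplies every monomial `S_{k₁} ⋯ S_{kₙ}` by its weight `k₁ + ⋯ + kₙ`. -/
theorem weightPoly_monomial (m : EvenPos →₀ ℕ) (c : ℚ) :
    weightPoly (MvPolynomial.monomial m c) =
      ((m.sum fun k e => e * (k : ℕ) : ℕ) : ℚ) • MvPolynomial.monomial m c := by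
  simp only [weightPoly, Derivation.coeFn_coe,
    MvPolynomial.mkDerivation_monomial, Finsupp.sum, Finset.smul_sum, Nat.cast_sum,
    Finset.sum_smul]
  refine Finset.sum_congr rfl fun k hk => ?_
  have hk' : m - Finsupp.single k 1 + Finsupp.single k 1 = m :=
    tsub_add_cancel_of_le (Finsupp.single_le_iff.2 (Nat.one_le_iff_ne_zero.2 (by simpa using hk)))
  rw [smul_eq_mul, mul_smul_comm, MvPolynomial.X, MvPolynomial.monomial_mul, hk']
  simp only [MvPolynomial.smul_monomial, smul_eq_mul]
  congr 1
  push_cast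
  ring

/-- For even positive `a`, `b` (thought of as `a = k + 1`, `b = l + 1`) the index
`a + b - 2 = k + l`. -/
def EvenPos.merge (a b : EvenPos) : EvenPos :=
  ⟨a + b - 2, by
    obtain ⟨a, ⟨a', rfl⟩, ha⟩ := a
    obtain ⟨b, ⟨b', rfl⟩, hb⟩ := b
    exact ⟨⟨a' + b' - 1, by simp only; omega⟩, by simp only; omega⟩⟩

/-- The index `2`. -/
def EvenPos.two : EvenPos := ⟨2, even_two, two_pos⟩

/-- The second-order operator
`½ ∑_{k,l} (k + l) S_{k+l} ∂²/∂S_{k+1}∂S_{l+1}` (with `a = k + 1`, `b = l + 1`), restricted to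
`a`, `b` in a finite set of indices. -/
def secondOrder (T : Finset EvenPos) (p : MvPolynomial EvenPos ℚ) : MvPolynomial EvenPos ℚ :=
  (1 / 2 : ℚ) • ∑ a ∈ T, ∑ b ∈ T, (((EvenPos.merge a b : EvenPos) : ℕ) : ℚ) •
    (MvPolynomial.X (EvenPos.merge a b) *
      MvPolynomial.pderiv a (MvPolynomial.pderiv b p))

theorem pderiv_comm (a b : EvenPos) (p : MvPolynomial EvenPos ℚ) :
    MvPolynomial.pderiv a (MvPolynomial.pderiv b p) =
      MvPolynomial.pderiv b (MvPolynomial.pderiv a p) := by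
  classical
  have h : ⁅MvPolynomial.pderiv (R := ℚ) a, MvPolynomial.pderiv (R := ℚ) b⁆ = 0 := by
    refine MvPolynomial.derivation_ext fun i => ?_
    rw [Derivation.commutator_apply]
    simp only [MvPolynomial.pderiv_X, Pi.single_apply]
    split_ifs <;> simp
  rw [← sub_eq_zero, ← Derivation.commutator_apply, h, Derivation.zero_apply]

theorem secondOrder_eq {T : Finset EvenPos} {p : MvPolynomial EvenPos ℚ} (h : p.vars ⊆ T) :
    secondOrder p.vars p = secondOrder T p := by
  have h0 : ∀ b, b ∉ p.vars → MvPolynomial.pderiv b p = 0 := fun b hb =>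
    MvPolynomial.pderiv_eq_zero_of_notMem_vars hb
  have h1 : ∀ a b, a ∉ p.vars → MvPolynomial.pderiv a (MvPolynomial.pderiv b p) = 0 := by
    intro a b ha
    rw [pderiv_comm, h0 a ha, map_zero]
  unfold secondOrder
  congr 1
  rw [Finset.sum_subset h fun a _ ha => Finset.sum_eq_zero fun b _ => by rw [h1 a b ha]; simp]
  refine Finset.sum_congr rfl fun a _ => ?_
  exact Finset.sum_subset h fun b _ hb => by rw [h0 b hb]; simp

/-- The operator `½ ∑_{k,l ≥ 0} (k + l) S_{k+l} ∂²/∂S_{k+1}∂S_{l+1} - ½ ∂/∂S_2` on polynomials. The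
only nonzero terms of the sum are those with `S_{k+1}`, `S_{l+1}` occurring in the polynomial. -/
def sPoly : Module.End ℚ (MvPolynomial EvenPos ℚ) where
  toFun p := secondOrder p.vars p - (1 / 2 : ℚ) • MvPolynomial.pderiv EvenPos.two p
  map_add' p q := by
    classical
    rw [secondOrder_eq (T := p.vars ∪ q.vars ∪ (p + q).vars) (p := p + q) (by grind),
      secondOrder_eq (T := p.vars ∪ q.vars ∪ (p + q).vars) (p := p) (by grind),
      secondOrder_eq (T := p.vars ∪ q.vars ∪ (p + q).vars) (p := q) (by grind)]
    simp only [secondOrder, map_add, mul_add, smul_add, Finset.sum_add_distrib]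
    abel
  map_smul' c p := by
    classical
    rw [secondOrder_eq (T := p.vars ∪ (c • p).vars) (p := c • p) (by grind),
      secondOrder_eq (T := p.vars ∪ (c • p).vars) (p := p) (by grind)]
    simp only [secondOrder, Derivation.map_smul, mul_smul_comm, RingHom.id_apply, smul_sub,
      smul_comm _ c, ← Finset.smul_sum]

/-- The weight operator `W` on `algS`. -/
def weightS : Module.End ℚ algS := polyEquiv.toLinearEquiv.conj weightPoly

/-- The operator `𝔰` on `algS`. -/
def frakS : Module.End ℚ algS := polyEquiv.toLinearEquiv.conj sPoly

/-- Multiplication by `S_2` on `algS`. -/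
def mulS2 : Module.End ℚ algS := LinearMap.mulLeft ℚ (genS EvenPos.two)

section Quasimodular

open Filter Topology Asymptotics UpperHalfPlane
open scoped Manifold MatrixGroups ModularForm

/-- Moderate growth: for all `C > 0`, `φ(x + iy) = O(e ^ (C y))` as `y → ∞` and
`φ(x + iy) = O(e ^ (C / y))` as `y → 0` (uniformly in `x`). -/
def ModerateGrowth (φ : ℍ → ℂ) : Prop :=
  ∀ C : ℝ, 0 < C →
    φ =O[comap UpperHalfPlane.im atTop] (fun τ : ℍ => Real.exp (C * τ.im)) ∧
    φ =O[comap UpperHalfPlane.im (𝓝[>] 0)] (fun τ : ℍ => Real.exp (C / τ.im))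

theorem ModerateGrowth.add {φ ψ : ℍ → ℂ} (h : ModerateGrowth φ) (h' : ModerateGrowth ψ) :
    ModerateGrowth (φ + ψ) :=
  fun C hC => ⟨(h C hC).1.add (h' C hC).1, (h C hC).2.add (h' C hC).2⟩

theorem ModerateGrowth.mul {φ ψ : ℍ → ℂ} (h : ModerateGrowth φ) (h' : ModerateGrowth ψ) :
    ModerateGrowth (φ * ψ) := by
  intro C hC
  have h1 := h (C / 2) (by positivity)
  have h2 := h' (C / 2) (by positivity)
  refine ⟨(h1.1.mul h2.1).congr_right fun τ => ?_, (h1.2.mul h2.2).congr_right fun τ => ?_⟩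
  · rw [← Real.exp_add]; congr 1; ring
  · rw [← Real.exp_add]; congr 1; ring

theorem moderateGrowth_const (a : ℂ) : ModerateGrowth fun _ => a := by
  intro C hC
  constructor <;>
  · refine IsBigO.of_bound ‖a‖ (Eventually.of_forall fun τ => ?_)
    rw [Real.norm_of_nonneg (Real.exp_nonneg _)]
    refine le_mul_of_one_le_right (norm_nonneg _) (Real.one_le_exp ?_)
    have := τ.im_pos
    positivity

/-- The ring of holomorphic functions of moderate growth on the upper half plane. -/
def Hol0 : Subalgebra ℂ (ℍ → ℂ) where
  carrier := {φ | MDifferentiable 𝓘(ℂ) 𝓘(ℂ) φ ∧ ModerateGrowth φ}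
  mul_mem' h h' := ⟨h.1.mul h'.1, h.2.mul h'.2⟩
  add_mem' h h' := ⟨h.1.add h'.1, h.2.add h'.2⟩
  algebraMap_mem' a := ⟨mdifferentiable_const, moderateGrowth_const a⟩

/-- The quasimodular transformation property of weight `k` and depth at most `p`:
`(cτ + d) ^ (-k) φ(γτ) = ∑_{r ≤ p} φ_r(τ) (c / (cτ + d)) ^ r`, with coefficient functions
`φ_0, …, φ_p` in `Hol0` (and `φ_r = 0` for `r > p`). Here `denom γ τ = cτ + d`. -/
structure HasQuasimodularExpansion (k : ℤ) (p : ℕ) (φ : ℍ → ℂ) (c : ℕ → ℍ → ℂ) : Prop where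
  mem : ∀ r, c r ∈ Hol0
  eq_zero : ∀ r, p < r → c r = 0
  transform : ∀ (γ : SL(2, ℤ)) (τ : ℍ), denom γ τ ^ (-k) * φ (γ • τ) =
    ∑ r ∈ Finset.range (p + 1), c r τ * ((γ 1 0 : ℂ) / denom γ τ) ^ r

namespace HasQuasimodularExpansion

variable {k : ℤ} {p p' : ℕ} {φ ψ : ℍ → ℂ} {c c' : ℕ → ℍ → ℂ}

theorem mono (h : HasQuasimodularExpansion k p φ c) (hp : p ≤ p') :
    HasQuasimodularExpansion k p' φ c where
  mem := h.mem
  eq_zero r hr := h.eq_zero r (hp.trans_lt hr)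
  transform γ τ := by
    rw [h.transform]
    refine Finset.sum_subset (by simpa using hp) fun r _ hr => ?_
    rw [h.eq_zero r (by rw [Finset.mem_range] at hr; omega)]
    simp

theorem add (h : HasQuasimodularExpansion k p φ c) (h' : HasQuasimodularExpansion k p' ψ c') :
    HasQuasimodularExpansion k (max p p') (φ + ψ) (c + c') where
  mem r := Hol0.add_mem (h.mem r) (h'.mem r)
  eq_zero r hr := by
    rw [Pi.add_apply, h.eq_zero r (by omega), h'.eq_zero r (by omega), add_zero]
  transform γ τ := by
    rw [Pi.add_apply, mul_add, (h.mono (le_max_left p p')).transform,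
      (h'.mono (le_max_right p p')).transform, ← Finset.sum_add_distrib]
    simp [add_mul]

theorem smul (a : ℂ) (h : HasQuasimodularExpansion k p φ c) :
    HasQuasimodularExpansion k p (a • φ) (a • c) where
  mem r := Hol0.smul_mem (h.mem r) a
  eq_zero r hr := by rw [Pi.smul_apply, h.eq_zero r hr, smul_zero]
  transform γ τ := by
    rw [Pi.smul_apply, mul_smul_comm, h.transform, Finset.smul_sum]
    simp [mul_assoc]

theorem zero : HasQuasimodularExpansion k 0 0 0 where
  mem r := Hol0.zero_mem
  eq_zero r hr := rfl
  transform γ τ := by simp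

theorem coeff_zero (h : HasQuasimodularExpansion k p φ c) : c 0 = φ := by
  ext τ
  have := h.transform 1 τ
  rw [Finset.sum_eq_single 0 (fun r _ hr => by simp [hr]) (by simp)] at this
  simpa using this.symm

end HasQuasimodularExpansion

theorem denom_mul_SL (g h : SL(2, ℤ)) (τ : ℍ) :
    denom (g * h : SL(2, ℤ)) τ = denom g ↑(h • τ) * denom h τ := by
  have := denom_cocycle_σ (g : GL (Fin 2) ℝ) (h : GL (Fin 2) ℝ) τ
  have h2 : σ (h : GL (Fin 2) ℝ) = ContinuousAlgEquiv.refl ℝ ℂ := by simp [σ]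
  rw [h2] at this
  simpa using this

theorem lower_left_mul (g h : SL(2, ℤ)) (τ : ℍ) :
    (((g * h) 1 0 : ℤ) : ℂ) / denom (g * h : SL(2, ℤ)) τ =
      ((g 1 0 : ℂ) / denom g ↑(h • τ)) * (denom h τ)⁻¹ ^ 2 + (h 1 0 : ℂ) / denom h τ := by
  have h1 := congrFun (EisensteinSeries.D2_mul g h) τ
  simp only [EisensteinSeries.D2, Pi.add_apply, ModularForm.SL_slash_apply] at h1
  have hpi : (2 * Real.pi * Complex.I : ℂ) ≠ 0 := Complex.two_pi_I_ne_zero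
  apply mul_left_cancel₀ hpi
  rw [← mul_div_assoc, h1, zpow_neg]
  field_simp
  
/-- The element with rows `(0, -1)`, `(1, d)`. -/
def gam (d : ℤ) : SL(2, ℤ) := ⟨!![0, -1; 1, d], by simp [Matrix.det_fin_two]⟩

theorem gam_lower (d : ℤ) : (gam d) 1 0 = 1 := rfl

theorem denom_gam (d : ℤ) (τ : ℍ) : denom (gam d) τ = τ + d := by
  rw [ModularGroup.denom_apply]
  simp [gam]

theorem gam_ne (d : ℤ) (τ : ℍ) : (τ : ℂ) + d ≠ 0 := by
  rw [← denom_gam]; exact denom_ne_zero _ _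

theorem tendsto_shift_inv (τ : ℍ) :
    Tendsto (fun d : ℕ => ((τ : ℂ) + (d : ℤ))⁻¹) atTop (𝓝 0) := by
  refine tendsto_inv₀_cobounded.comp ?_
  rw [← tendsto_norm_atTop_iff_cobounded]
  refine tendsto_atTop_mono (f := fun d : ℕ => -‖(τ : ℂ)‖ + (d : ℝ)) (fun d => ?_)
    (tendsto_atTop_add_const_left _ _ tendsto_natCast_atTop_atTop)
  have h1 := norm_sub_le ((τ : ℂ) + (d : ℤ)) τ
  have h2 : ‖(τ : ℂ) + (d : ℤ) - τ‖ = d := by simp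
  rw [h2] at h1
  linarith

theorem infinite_ratios (τ : ℍ) :
    (Set.range fun d : ℤ => ((τ : ℂ) + d)⁻¹).Infinite := by
  refine Set.infinite_range_of_injective fun a b h => ?_
  have := inv_injective h
  simpa using this

namespace HasQuasimodularExpansion

variable {k : ℤ} {p p' : ℕ} {φ ψ : ℍ → ℂ} {c c' : ℕ → ℍ → ℂ}

open Polynomial in
/-- The polynomial `∑ φ_r(τ) X ^ r`. -/
def poly (p : ℕ) (c : ℕ → ℍ → ℂ) (τ : ℍ) : ℂ[X] :=
  ∑ r ∈ Finset.range (p + 1), Polynomial.C (c r τ) * Polynomial.X ^ r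

theorem coeff_poly (h : HasQuasimodularExpansion k p φ c) (τ : ℍ) (r : ℕ) :
    (poly p c τ).coeff r = c r τ := by
  simp only [poly, Polynomial.finsetSum_coeff, Polynomial.coeff_C_mul_X_pow]
  rw [Finset.sum_ite_eq]
  split_ifs with hr
  · rfl
  · rw [h.eq_zero r (by rw [Finset.mem_range] at hr; omega)]; rfl

theorem transform' (h : HasQuasimodularExpansion k p φ c) (γ : SL(2, ℤ)) (τ : ℍ) :
    denom γ τ ^ (-k) * φ (γ • τ) = (poly p c τ).eval ((γ 1 0 : ℂ) / denom γ τ) := by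
  rw [h.transform, poly, Polynomial.eval_finsetSum]
  simp

/-- The coefficient functions are uniquely determined. -/
theorem unique (h : HasQuasimodularExpansion k p φ c) (h' : HasQuasimodularExpansion k p' φ c') :
    c = c' := by
  ext r τ
  rw [← h.coeff_poly, ← h'.coeff_poly]
  congr 1
  refine Polynomial.eq_of_infinite_eval_eq _ _ ((infinite_ratios τ).mono ?_)
  rintro _ ⟨d, rfl⟩
  have h1 := h.transform' (gam d) τ
  have h2 := h'.transform' (gam d) τ
  rw [h1] at h2
  simpa [gam_lower, denom_gam] using h2

/-- The transformation behaviour of the generating polynomial of the coefficient functions. -/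
theorem poly_smul (h : HasQuasimodularExpansion k p φ c) (γ : SL(2, ℤ)) (τ : ℍ) :
    poly p c (γ • τ) = Polynomial.C (denom γ τ ^ k) * (poly p c τ).comp
      (Polynomial.X * Polynomial.C ((denom γ τ)⁻¹ ^ 2) +
        Polynomial.C ((γ 1 0 : ℂ) / denom γ τ)) := by
  refine Polynomial.eq_of_infinite_eval_eq _ _ ((infinite_ratios (γ • τ)).mono ?_)
  rintro _ ⟨d, rfl⟩
  have h1 := h.transform' (gam d) (γ • τ)
  have h2 := h.transform' (gam d * γ) τ
  rw [lower_left_mul, denom_mul_SL, mul_smul, mul_zpow] at h2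
  simp only [gam_lower, denom_gam, Int.cast_one, one_div] at h1 h2
  simp only [Set.mem_ofPred_eq, Polynomial.eval_mul, Polynomial.eval_C, Polynomial.eval_comp,
    Polynomial.eval_add, Polynomial.eval_X]
  rw [← h1, ← h2, zpow_neg (denom γ τ)]
  have := zpow_ne_zero k (denom_ne_zero γ τ)
  field_simp

/-- The coefficient function `φ_1` is quasimodular of weight `k - 2`. -/
theorem one (h : HasQuasimodularExpansion k p φ c) :
    HasQuasimodularExpansion (k - 2) p (c 1) (fun r => ((r : ℂ) + 1) • c (r + 1)) where
  mem r := Hol0.smul_mem (h.mem _) _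
  eq_zero r hr := by rw [h.eq_zero _ (by omega), smul_zero]
  transform γ τ := by
    have h1 := congrArg (fun P => (Polynomial.derivative P).eval 0) (h.poly_smul γ τ)
    simp only [Polynomial.derivative_mul, Polynomial.derivative_C, Polynomial.derivative_comp,
      Polynomial.derivative_add, Polynomial.derivative_X, Polynomial.eval_add, Polynomial.eval_mul,
      Polynomial.eval_C, Polynomial.eval_X, Polynomial.eval_comp, zero_mul, zero_add, add_zero,
      one_mul, mul_zero] at h1
    rw [← Polynomial.coeff_zero_eq_eval_zero, Polynomial.coeff_derivative, h.coeff_poly] at h1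
    simp only [Nat.cast_zero, zero_add, mul_one] at h1
    have h2 : (Polynomial.derivative (poly p c τ)).eval ((γ 1 0 : ℂ) / denom γ τ) =
        ∑ r ∈ Finset.range (p + 1), (((r : ℂ) + 1) • c (r + 1)) τ *
          ((γ 1 0 : ℂ) / denom γ τ) ^ r := by
      rw [Polynomial.eval_eq_sum_range' (n := p + 1)]
      · refine Finset.sum_congr rfl fun r _ => ?_
        rw [Polynomial.coeff_derivative, h.coeff_poly]
        simp [mul_comm]
      · refine lt_of_le_of_lt (Polynomial.natDegree_derivative_le _) ?_
        have : (poly p c τ).natDegree ≤ p := by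
          refine Polynomial.natDegree_sum_le_of_forall_le _ _ fun r hr => ?_
          exact (Polynomial.natDegree_C_mul_X_pow_le _ _).trans
            (Nat.lt_succ_iff.1 (Finset.mem_range.1 hr))
        omega
    rw [h1, h2]
    have hd := denom_ne_zero γ τ
    have h3 : denom γ τ ^ (-(k - 2)) * (denom γ τ ^ k * (denom γ τ)⁻¹ ^ 2) = 1 := by
      rw [← mul_assoc, ← zpow_add₀ hd, show -(k - 2) + k = ((2 : ℕ) : ℤ) by push_cast; ring,
        zpow_natCast, ← mul_pow, mul_inv_cancel₀ hd, one_pow]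
    rw [← mul_assoc (denom γ τ ^ k), ← mul_assoc, h3, one_mul]

end HasQuasimodularExpansion

/-- Quasimodular forms of weight `k` for `SL(2, ℤ)`, of any depth. -/
def QM (k : ℤ) : Submodule ℂ (ℍ → ℂ) where
  carrier := {φ | φ ∈ Hol0 ∧ ∃ p c, HasQuasimodularExpansion k p φ c}
  add_mem' := by
    rintro φ ψ ⟨h, p, c, hc⟩ ⟨h', p', c', hc'⟩
    exact ⟨Hol0.add_mem h h', _, _, hc.add hc'⟩
  zero_mem' := ⟨Hol0.zero_mem, 0, 0, HasQuasimodularExpansion.zero⟩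
  smul_mem' := by
    rintro a φ ⟨h, p, c, hc⟩
    exact ⟨Hol0.smul_mem h a, _, _, hc.smul a⟩

/-- The space of all quasimodular forms. -/
def QMF : Submodule ℂ (ℍ → ℂ) := ⨆ k : ℤ, QM k

theorem QM_le_QMF (k : ℤ) : QM k ≤ QMF := le_iSup QM k

theorem QMF_le_Hol0 {φ : ℍ → ℂ} (h : φ ∈ QMF) : φ ∈ Hol0 := by
  have : QMF ≤ Subalgebra.toSubmodule Hol0 := iSup_le fun k φ h => h.1
  exact this h

/-- Behaviour of a quasimodular form of weight `k` under `τ ↦ -1 / (τ + d)` as `d → ∞`. -/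
theorem tendsto_of_mem_QM {k : ℤ} {φ : ℍ → ℂ} (h : φ ∈ QM k) (τ : ℍ) :
    Tendsto (fun d : ℕ => ((τ : ℂ) + (d : ℤ)) ^ (-k) * φ (gam d • τ)) atTop (𝓝 (φ τ)) := by
  obtain ⟨-, p, c, hc⟩ := h
  have h1 : ∀ d : ℕ, ((τ : ℂ) + (d : ℤ)) ^ (-k) * φ (gam d • τ) =
      (HasQuasimodularExpansion.poly p c τ).eval (((τ : ℂ) + (d : ℤ))⁻¹) := by
    intro d
    have := hc.transform' (gam d) τ
    simpa [gam_lower, denom_gam] using this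
  simp_rw [h1]
  have h2 : φ τ = (HasQuasimodularExpansion.poly p c τ).eval 0 := by
    rw [← Polynomial.coeff_zero_eq_eval_zero, hc.coeff_poly, hc.coeff_zero]
  rw [h2]
  refine (Polynomial.continuous _).continuousAt.tendsto.comp ?_
  exact tendsto_shift_inv τ

/-- The sum of the spaces of quasimodular forms of the different weights is direct. -/
theorem iSupIndep_QM : iSupIndep QM := by
  rw [iSupIndep_iff_finsetSum_eq_zero_imp_eq_zero]
  intro s
  induction s using Finset.induction_on_max with
  | empty => simp
  | insert K s hs ih =>
    intro v hv hsum
    have hK : K ∉ s := fun h => lt_irrefl _ (hs K h)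
    have hvK : v K = 0 := by
      ext τ
      have h1 : ∀ k ∈ s, Tendsto (fun d : ℕ => ((τ : ℂ) + (d : ℤ)) ^ (-K) * v k (gam d • τ))
          atTop (𝓝 0) := by
        intro k hk
        have h2 := tendsto_of_mem_QM (hv k (Finset.mem_insert_of_mem hk)) τ
        have h3 : Tendsto (fun d : ℕ => ((τ : ℂ) + (d : ℤ))⁻¹ ^ (K - k).toNat) atTop (𝓝 0) := by
          have := (tendsto_shift_inv τ).pow (K - k).toNat
          rwa [zero_pow (by have := hs k hk; omega)] at this
        have h4 := h3.mul h2
        rw [zero_mul] at h4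
        refine h4.congr fun d => ?_
        have hd := gam_ne d τ
        rw [← mul_assoc, ← zpow_natCast, inv_zpow', ← zpow_add₀ hd]
        congr 2
        have := hs k hk
        omega
      have h5 := tendsto_of_mem_QM (hv K (Finset.mem_insert_self _ _)) τ
      have h6 := h5.add (tendsto_finsetSum s h1)
      rw [Finset.sum_const_zero, add_zero] at h6
      refine tendsto_nhds_unique h6 ?_
      refine (tendsto_const_nhds (x := (0 : ℂ))).congr fun d => ?_
      rw [Finset.sum_insert hK] at hsum
      have h7 := congrFun hsum (gam d • τ)
      rw [Pi.add_apply, Finset.sum_apply, Pi.zero_apply] at h7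
      rw [← Finset.mul_sum, ← mul_add, h7, mul_zero]
    rw [Finset.sum_insert hK, hvK, zero_add] at hsum
    have := ih v (fun i hi => hv i (Finset.mem_insert_of_mem hi)) hsum
    intro i hi
    rcases Finset.mem_insert.1 hi with rfl | hi
    · exact hvK
    · exact this i hi

/-- The Eisenstein series `G_k = -B_k / (2k) + ∑_{r, m ≥ 1} m ^ (k - 1) q ^ (m r)`, where
`q = e ^ (2 π i τ)`. -/
def eisG (k : ℕ) (τ : ℍ) : ℂ :=
  -(bernoulli k : ℂ) / (2 * (k : ℂ)) + ∑' r : ℕ+, ∑' m : ℕ+,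
    (m : ℂ) ^ (k - 1) * Complex.exp (2 * Real.pi * Complex.I * τ) ^ (r * m : ℕ)

theorem eisG_two : eisG 2 = (-(1 / 24) : ℂ) • EisensteinSeries.E2 := by
  ext τ
  have h := tsum_prod_pow_eq_tsum_sigma 1 (norm_exp_two_pi_I_lt_one τ)
  rw [Pi.smul_apply, EisensteinSeries.E2_eq_tsum_cexp, ← h, eisG]
  rw [bernoulli_two]
  simp only [smul_eq_mul, Nat.add_one_sub_one]
  push_cast
  ring

theorem norm_exp_eq (τ : ℍ) :
    ‖Complex.exp (2 * Real.pi * Complex.I * τ)‖ = Real.exp (-(2 * Real.pi * τ.im)) := by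
  rw [Complex.norm_exp]
  congr 1
  simp [mul_assoc]

theorem norm_eisG_two_le (τ : ℍ) :
    ‖eisG 2 τ‖ ≤ 1 + 2 * (1 + 1 / τ.im) ^ 3 := by
  set q := Complex.exp (2 * Real.pi * Complex.I * τ) with hq
  have hq1 : ‖q‖ < 1 := norm_exp_two_pi_I_lt_one τ
  have h : eisG 2 τ = -(1 / 24 : ℂ) + ∑' n : ℕ+, (ArithmeticFunction.sigma 1 n : ℂ) * q ^ (n : ℕ) := by
    rw [eisG_two, Pi.smul_apply, EisensteinSeries.E2_eq_tsum_cexp, smul_eq_mul]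
    ring
  have hs := summable_choose_mul_geometric_of_norm_lt_one 2 (r := ‖q‖) (by simpa using hq1)
  have hb : ∀ n : ℕ+, ‖(ArithmeticFunction.sigma 1 n : ℂ) * q ^ (n : ℕ)‖ ≤
      2 * ((((n : ℕ) + 2).choose 2 : ℕ) * ‖q‖ ^ (n : ℕ)) := by
    intro n
    rw [norm_mul, norm_pow, ← mul_assoc]
    refine mul_le_mul_of_nonneg_right ?_ (by positivity)
    rw [Complex.norm_natCast]
    have h1 : ArithmeticFunction.sigma 1 n ≤ (n : ℕ) ^ 2 := ArithmeticFunction.sigma_le_pow_succ 1 n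
    have h2 : (n : ℕ) ^ 2 ≤ 2 * ((n : ℕ) + 2).choose 2 := by
      have := Nat.triangle_succ (n + 1 : ℕ)
      rw [Nat.choose_two_right, Nat.mul_div_cancel' (Nat.even_mul_pred_self _).two_dvd]
      simp only [Nat.add_one_sub_one]
      nlinarith
    exact_mod_cast h1.trans h2
  have hs' : Summable fun n : ℕ => 2 * (((n + 2).choose 2 : ℕ) * ‖q‖ ^ n) := hs.mul_left 2
  have hs'' : Summable fun n : ℕ+ => 2 * ((((n : ℕ) + 2).choose 2 : ℕ) * ‖q‖ ^ (n : ℕ)) :=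
    hs'.comp_injective PNat.coe_injective
  have h3 : ‖∑' n : ℕ+, (ArithmeticFunction.sigma 1 n : ℂ) * q ^ (n : ℕ)‖ ≤
      2 * (1 / (1 - ‖q‖) ^ 3) := by
    refine (tsum_of_norm_bounded hs''.hasSum hb).trans ?_
    rw [← tsum_choose_mul_geometric_of_norm_lt_one 2 (r := ‖q‖) (by simpa using hq1),
      ← tsum_mul_left]
    exact tsum_comp_le_tsum_of_inj hs' (fun n => by positivity) PNat.coe_injective
  have hy := τ.im_pos
  have h4 : 1 / (1 - ‖q‖) ≤ 1 + 1 / τ.im := by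
    have h5 : ‖q‖ * (1 + τ.im) ≤ 1 := by
      rw [hq, norm_exp_eq, Real.exp_neg, inv_mul_le_iff₀ (Real.exp_pos _), mul_one]
      have := Real.add_one_le_exp (2 * Real.pi * τ.im)
      nlinarith [Real.pi_gt_three]
    rw [div_le_iff₀ (by linarith)]
    field_simp
    nlinarith
  have h0 : 0 ≤ 1 / (1 - ‖q‖) := by
    have : 0 < 1 - ‖q‖ := by linarith
    positivity
  have h6 : 1 / (1 - ‖q‖) ^ 3 ≤ (1 + 1 / τ.im) ^ 3 := by
    rw [← one_div_pow]
    exact pow_le_pow_left₀ h0 h4 3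
  rw [h]
  refine (norm_add_le _ _).trans ?_
  have h7 : ‖(-(1 / 24 : ℂ))‖ ≤ 1 := by norm_num
  linarith

theorem le_exp_mul (C x : ℝ) (hC : 0 < C) : x ≤ C⁻¹ * Real.exp (C * x) := by
  rw [inv_mul_eq_div, le_div_iff₀ hC]
  have := Real.add_one_le_exp (C * x)
  linarith

theorem const_smul_mdiff (a : ℂ) {φ : ℍ → ℂ} (h : MDifferentiable 𝓘(ℂ) 𝓘(ℂ) φ) :
    MDifferentiable 𝓘(ℂ) 𝓘(ℂ) (a • φ) :=
  (mdifferentiable_const (c := a)).mul h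

theorem eisG_two_mem_Hol0 : eisG 2 ∈ Hol0 := by
  refine ⟨?_, fun C hC => ⟨?_, ?_⟩⟩
  · rw [eisG_two]
    exact const_smul_mdiff _ E2_mdifferentiable
  · refine IsBigO.of_bound 17 ?_
    have : ∀ᶠ τ : ℍ in comap UpperHalfPlane.im atTop, 1 ≤ τ.im :=
      (eventually_ge_atTop 1).comap _
    filter_upwards [this] with τ hτ
    refine (norm_eisG_two_le τ).trans ?_
    rw [Real.norm_of_nonneg (Real.exp_nonneg _)]
    have h1 : 1 / τ.im ≤ 1 := (div_le_one (by linarith)).2 hτ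
    have h2 : 0 ≤ 1 / τ.im := by positivity
    have h3 : (1 + 1 / τ.im) ^ 3 ≤ 2 ^ 3 := pow_le_pow_left₀ (by linarith) (by linarith) 3
    have h4 : 1 ≤ Real.exp (C * τ.im) := Real.one_le_exp (by positivity)
    linarith
  · refine IsBigO.of_bound (1 + 2 * (1 + (C / 3)⁻¹) ^ 3) (Eventually.of_forall fun τ => ?_)
    refine (norm_eisG_two_le τ).trans ?_
    rw [Real.norm_of_nonneg (Real.exp_nonneg _)]
    have hy := τ.im_pos
    set E := Real.exp (C / 3 * (1 / τ.im)) with hE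
    have h1 : Real.exp (C / τ.im) = E ^ 3 := by
      rw [hE, ← Real.exp_nat_mul]; congr 1; push_cast; ring
    have h2 : 1 ≤ E := Real.one_le_exp (by positivity)
    have h3 := le_exp_mul (C / 3) (1 / τ.im) (by positivity)
    rw [← hE] at h3
    have h4 : 1 + 1 / τ.im ≤ (1 + (C / 3)⁻¹) * E := by linarith
    have h5 : (1 + 1 / τ.im) ^ 3 ≤ ((1 + (C / 3)⁻¹) * E) ^ 3 :=
      pow_le_pow_left₀ (by positivity) h4 3
    have h6 : 1 ≤ E ^ 3 := one_le_pow₀ h2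
    rw [h1, add_mul, one_mul, mul_assoc, ← mul_pow]
    linarith

theorem eisG_two_slash (γ : SL(2, ℤ)) (τ : ℍ) :
    denom γ τ ^ (-2 : ℤ) * eisG 2 (γ • τ) =
      eisG 2 τ + (-(1 / (4 * Real.pi * Complex.I))) * ((γ 1 0 : ℂ) / denom γ τ) := by
  have h := congrFun (EisensteinSeries.E2_slash_action γ) τ
  rw [ModularForm.SL_slash_apply, Pi.sub_apply, Pi.smul_apply, EisensteinSeries.D2,
    riemannZeta_two] at h
  rw [eisG_two, Pi.smul_apply, Pi.smul_apply, smul_eq_mul, smul_eq_mul]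
  have h2 : denom γ τ ^ (-2 : ℤ) * (-(1 / 24) * EisensteinSeries.E2 (γ • τ)) =
      -(1 / 24) * (EisensteinSeries.E2 (γ • τ) * denom γ τ ^ (-2 : ℤ)) := by ring
  rw [h2, h, smul_eq_mul]
  have hd := denom_ne_zero γ τ
  have hpi : (Real.pi : ℂ) ≠ 0 := by exact_mod_cast Real.pi_ne_zero
  field_simp
  ring_nf
  simp [Complex.I_sq]
  try ring

/-- Shift of a sequence of coefficient functions, with `0` in front. -/
def shiftCoeff (c : ℕ → ℍ → ℂ) : ℕ → ℍ → ℂ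
  | 0 => 0
  | r + 1 => c r

theorem sum_shiftCoeff (p : ℕ) (c : ℕ → ℍ → ℂ) (w : ℕ → ℂ) (τ : ℍ) (x : ℂ) :
    ∑ r ∈ Finset.range (p + 1 + 1), w r * shiftCoeff c r τ * x ^ r =
      x * ∑ r ∈ Finset.range (p + 1), w (r + 1) * c r τ * x ^ r := by
  rw [Finset.sum_range_succ']
  simp only [shiftCoeff, Pi.zero_apply, mul_zero, zero_mul, add_zero, Finset.mul_sum]
  exact Finset.sum_congr rfl fun r _ => by ring

theorem eisG_two_mul_mem {k : ℤ} {φ : ℍ → ℂ} (h : φ ∈ QM k) : eisG 2 * φ ∈ QM (k + 2) := by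
  obtain ⟨h0, p, c, hc⟩ := h
  refine ⟨Hol0.mul_mem eisG_two_mem_Hol0 h0, p + 1,
    fun r => eisG 2 * c r + (-(1 / (4 * Real.pi * Complex.I)) : ℂ) • shiftCoeff c r, ?_, ?_, ?_⟩
  · intro r
    refine Hol0.add_mem (Hol0.mul_mem eisG_two_mem_Hol0 (hc.mem r)) (Hol0.smul_mem ?_ _)
    cases r
    · exact Hol0.zero_mem
    · exact hc.mem _
  · intro r hr
    obtain ⟨r, rfl⟩ : ∃ s, r = s + 1 := ⟨r - 1, by omega⟩
    simp only [shiftCoeff]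
    rw [hc.eq_zero _ (by omega), hc.eq_zero _ (by omega)]
    simp
  · intro γ τ
    have hd := denom_ne_zero γ τ
    rw [Pi.mul_apply, neg_add, add_comm, zpow_add₀ hd, mul_mul_mul_comm, eisG_two_slash]
    simp only [Pi.add_apply, Pi.mul_apply, Pi.smul_apply, smul_eq_mul, add_mul,
      Finset.sum_add_distrib]
    have h1 := sum_shiftCoeff p c (fun _ => (-(1 / (4 * Real.pi * Complex.I)) : ℂ)) τ
      ((γ 1 0 : ℂ) / denom γ τ)
    rw [h1, (hc.mono (Nat.le_succ p)).transform γ τ]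
    rw [← (hc.mono (Nat.le_succ p)).transform γ τ]
    nth_rw 2 [hc.transform γ τ]
    rw [(hc.mono (Nat.le_succ p)).transform γ τ, Finset.mul_sum]
    simp only [mul_assoc, ← Finset.mul_sum]
    ring

theorem eisG_two_mul_mem_QMF {φ : ℍ → ℂ} (h : φ ∈ QMF) : eisG 2 * φ ∈ QMF := by
  have : QMF ≤ QMF.comap (LinearMap.mulLeft ℂ (eisG 2)) :=
    iSup_le fun k φ h => QM_le_QMF _ (eisG_two_mul_mem h)
  exact this h

open Derivative in
theorem moderateGrowth_deriv {φ : ℍ → ℂ} (h : φ ∈ Hol0) :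
    ModerateGrowth (normalizedDerivOfComplex φ) := by
  have key : ∀ (τ : ℍ) (B : ℝ), (∀ τ' : ℍ, τ.im / 2 ≤ τ'.im → τ'.im ≤ 3 / 2 * τ.im → ‖φ τ'‖ ≤ B) →
      ‖normalizedDerivOfComplex φ τ‖ ≤ B * (1 / τ.im) := by
    intro τ B hB
    have hy := τ.im_pos
    have himb : ∀ z ∈ Metric.closedBall (τ : ℂ) (τ.im / 2), τ.im / 2 ≤ z.im ∧ z.im ≤ 3 / 2 * τ.im := by
      intro z hz
      have h1 : |(z - τ).im| ≤ τ.im / 2 := by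
        refine (Complex.abs_im_le_norm _).trans ?_
        rwa [Metric.mem_closedBall, dist_eq_norm] at hz
      rw [Complex.sub_im, abs_le] at h1
      have h2 : (τ : ℂ).im = τ.im := rfl
      constructor <;> linarith [h1.1, h1.2]
    have hd : DifferentiableOn ℂ (φ ∘ ofComplex) (Metric.closedBall (τ : ℂ) (τ.im / 2)) :=
      (UpperHalfPlane.mdifferentiable_iff.1 h.1).mono fun z hz => by
        have := (himb z hz).1
        show 0 < z.im
        linarith
    have hder := Complex.norm_deriv_le_of_forall_mem_sphere_norm_le (c := (τ : ℂ)) (R := τ.im / 2)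
      (C := B) (f := φ ∘ ofComplex) (by positivity)
      (hd.diffContOnCl_ball subset_rfl) (by
        intro z hz
        have hz' := himb z (Metric.sphere_subset_closedBall hz)
        have hz0 : 0 < z.im := by linarith [hz'.1]
        rw [Function.comp_apply, ofComplex_apply_of_im_pos hz0]
        exact hB ⟨z, hz0⟩ hz'.1 hz'.2)
    rw [normalizedDerivOfComplex, norm_mul]
    have hB0 : 0 ≤ B := (norm_nonneg _).trans (hB τ (by linarith) (by linarith))
    have h3 : ‖(2 * (Real.pi : ℂ) * Complex.I)⁻¹‖ ≤ 1 / 2 := by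
      rw [norm_inv, norm_mul, norm_mul, Complex.norm_I, Complex.norm_real,
        Real.norm_of_nonneg Real.pi_pos.le, mul_one, Complex.norm_ofNat, one_div]
      exact inv_anti₀ two_pos (by linarith [Real.pi_gt_three])
    calc _ ≤ 1 / 2 * (B / (τ.im / 2)) := mul_le_mul h3 hder (norm_nonneg _) (by norm_num)
      _ = B * (1 / τ.im) := by field_simp
  intro C hC
  constructor
  · obtain ⟨A, hA⟩ := (h.2 (2 * C / 3) (by positivity)).1.bound
    obtain ⟨Y, hY⟩ := eventually_atTop.1 (eventually_comap.1 hA)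
    refine IsBigO.of_bound A ?_
    have h1 : ∀ᶠ τ : ℍ in comap UpperHalfPlane.im atTop, max 1 (2 * Y) ≤ τ.im :=
      (eventually_ge_atTop _).comap _
    filter_upwards [h1] with τ hτ
    have hτ1 : 1 ≤ τ.im := (le_max_left _ _).trans hτ
    have hτ2 : 2 * Y ≤ τ.im := (le_max_right _ _).trans hτ
    have hA0 : 0 ≤ A := by
      have := (norm_nonneg _).trans (hY τ.im (by linarith) τ rfl)
      rw [Real.norm_of_nonneg (Real.exp_nonneg _)] at this
      exact nonneg_of_mul_nonneg_left this (Real.exp_pos _)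
    have := key τ (A * Real.exp (C * τ.im)) (by
      intro τ' h1 h2
      refine (hY τ'.im (by linarith) τ' rfl).trans ?_
      rw [Real.norm_of_nonneg (Real.exp_nonneg _)]
      refine mul_le_mul_of_nonneg_left (Real.exp_le_exp.2 ?_) hA0
      nlinarith)
    refine this.trans ?_
    rw [Real.norm_of_nonneg (Real.exp_nonneg _)]
    refine mul_le_of_le_one_right (by positivity) ?_
    exact (div_le_one (by linarith)).2 hτ1
  · obtain ⟨A, hA⟩ := (h.2 (C / 4) (by positivity)).2.bound
    have hA2 := eventually_comap.1 hA
    rw [eventually_nhdsWithin_iff, Metric.eventually_nhds_iff] at hA2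
    obtain ⟨ε, hε, hA3⟩ := hA2
    have hY : ∀ τ : ℍ, τ.im < ε → ‖φ τ‖ ≤ A * Real.exp (C / 4 / τ.im) := by
      intro τ hτ
      have := hA3 (y := τ.im) (by simpa [abs_of_pos τ.im_pos] using hτ) τ.im_pos τ rfl
      rwa [Real.norm_of_nonneg (Real.exp_nonneg _)] at this
    refine IsBigO.of_bound (A * (C / 2)⁻¹) ?_
    have h1 : ∀ᶠ τ : ℍ in comap UpperHalfPlane.im (𝓝[>] 0), τ.im < ε / 2 :=
      (eventually_nhdsWithin_of_eventually_nhds (eventually_lt_nhds (by positivity))).comap _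
    filter_upwards [h1] with τ hτ
    have hy := τ.im_pos
    have hA0 : 0 ≤ A := nonneg_of_mul_nonneg_left
      ((norm_nonneg _).trans (hY τ (by linarith))) (Real.exp_pos _)
    have := key τ (A * Real.exp (C / 2 * (1 / τ.im))) (by
      intro τ' h1 h2
      refine (hY τ' (by linarith)).trans ?_
      refine mul_le_mul_of_nonneg_left (Real.exp_le_exp.2 ?_) hA0
      have hy' := τ'.im_pos
      rw [div_le_iff₀ hy']
      field_simp
      nlinarith)
    refine this.trans ?_
    rw [Real.norm_of_nonneg (Real.exp_nonneg _)]
    have h2 := le_exp_mul (C / 2) (1 / τ.im) (by positivity)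
    have h3 : Real.exp (C / τ.im) = Real.exp (C / 2 * (1 / τ.im)) * Real.exp (C / 2 * (1 / τ.im)) := by
      rw [← Real.exp_add]; congr 1; ring
    rw [h3]
    calc _ ≤ A * Real.exp (C / 2 * (1 / τ.im)) *
        ((C / 2)⁻¹ * Real.exp (C / 2 * (1 / τ.im))) :=
          mul_le_mul_of_nonneg_left h2 (by positivity)
      _ = _ := by ring

open Derivative in
theorem deriv_mem_Hol0 {φ : ℍ → ℂ} (h : φ ∈ Hol0) : normalizedDerivOfComplex φ ∈ Hol0 :=
  ⟨normalizedDerivOfComplex_mdifferentiable h.1, moderateGrowth_deriv h⟩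

open Derivative in
theorem deriv_mem_QM {k : ℤ} {φ : ℍ → ℂ} (h : φ ∈ QM k) :
    normalizedDerivOfComplex φ ∈ QM (k + 2) := by
  obtain ⟨h0, p, c, hc⟩ := h
  refine ⟨deriv_mem_Hol0 h0, p + 1, fun r => normalizedDerivOfComplex (c r) +
    ((2 * Real.pi * Complex.I)⁻¹ * (k + 1 - r) : ℂ) • shiftCoeff c r, ?_, ?_, ?_⟩
  · intro r
    refine Hol0.add_mem (deriv_mem_Hol0 (hc.mem r)) (Hol0.smul_mem ?_ _)
    cases r
    · exact Hol0.zero_mem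
    · exact hc.mem _
  · intro r hr
    obtain ⟨r, rfl⟩ : ∃ s, r = s + 1 := ⟨r - 1, by omega⟩
    simp only [shiftCoeff]
    rw [hc.eq_zero _ (by omega), hc.eq_zero _ (by omega), smul_zero, add_zero]
    exact normalizedDerivOfComplex_const 0
  · intro γ τ
    have hd := denom_ne_zero γ τ
    have hpi : (2 * Real.pi * Complex.I : ℂ) ≠ 0 := Complex.two_pi_I_ne_zero
    set x : ℂ := (γ 1 0 : ℂ) / denom γ τ with hx
    have hder : HasDerivAt (fun z : ℂ => ∑ r ∈ Finset.range (p + 1),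
        (c r ∘ ofComplex) z * ((γ 1 0 : ℂ) / denom γ z) ^ r)
        (∑ r ∈ Finset.range (p + 1), (deriv (c r ∘ ofComplex) τ * x ^ r +
          (c r ∘ ofComplex) τ * (r * x ^ (r - 1) * (-x ^ 2)))) τ := by
      refine HasDerivAt.fun_sum fun r _ => ?_
      have h1 : HasDerivAt (c r ∘ ofComplex) (deriv (c r ∘ ofComplex) τ) τ :=
        (UpperHalfPlane.mdifferentiableAt_iff.1 ((hc.mem r).1 τ)).hasDerivAt
      have h2 : HasDerivAt (fun z : ℂ => (γ 1 0 : ℂ) / denom γ z) (-x ^ 2) τ := by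
        have h3 : HasDerivAt (fun z : ℂ => denom γ z) (γ 1 0 : ℂ) (τ : ℂ) := by
          have : (fun z : ℂ => denom γ z) = fun z : ℂ => (γ 1 0 : ℂ) * z + (γ 1 1 : ℂ) := by
            ext z
            simp [denom]
          rw [this]
          simpa using ((hasDerivAt_id (τ : ℂ)).const_mul (γ 1 0 : ℂ)).add_const (γ 1 1 : ℂ)
        have h4 := (h3.inv hd).const_mul (γ 1 0 : ℂ)
        have h5 : -x ^ 2 = (γ 1 0 : ℂ) * (-(γ 1 0 : ℂ) / denom γ τ ^ 2) := by
          rw [hx]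
          field_simp
        rw [h5]
        exact h4
      exact h1.mul (h2.pow r)
    have hslash : normalizedDerivOfComplex (φ ∣[k] γ) τ = (2 * Real.pi * Complex.I)⁻¹ *
        ∑ r ∈ Finset.range (p + 1), (deriv (c r ∘ ofComplex) τ * x ^ r +
          (c r ∘ ofComplex) τ * (r * x ^ (r - 1) * (-x ^ 2))) := by
      rw [normalizedDerivOfComplex]
      congr 1
      refine (hder.congr_of_eventuallyEq ?_).deriv
      filter_upwards [isOpen_upperHalfPlaneSet.mem_nhds τ.im_pos] with z hz
      have := hc.transform γ (ofComplex z)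
      rw [Function.comp_apply, ModularForm.SL_slash_apply, mul_comm, this,
        ofComplex_apply_of_im_pos hz]
      simp only [Function.comp_apply, ofComplex_apply_of_im_pos hz]
    have h5 := congrFun (normalizedDerivOfComplex_SL_slash (k := k) h0.1 (γ := γ)) τ
    rw [Pi.sub_apply, hslash, ModularForm.SL_slash_apply, ModularForm.SL_slash_apply,
      mul_comm (φ _), hc.transform γ τ, ← hx] at h5
    rw [mul_comm, eq_add_of_sub_eq h5.symm]
    have h6 := sum_shiftCoeff p c (fun r => (2 * Real.pi * Complex.I)⁻¹ * ((k : ℂ) + 1 - r)) τ x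
    simp only [Pi.add_apply, Pi.smul_apply, smul_eq_mul, add_mul, Finset.sum_add_distrib]
    rw [h6, Finset.sum_range_succ _ (p + 1), hc.eq_zero (p + 1) (Nat.lt_succ_self p)]
    have h7 : normalizedDerivOfComplex (0 : ℍ → ℂ) = 0 := normalizedDerivOfComplex_const 0
    rw [h7]
    simp only [Pi.zero_apply, zero_mul, add_zero, Finset.mul_sum, ← Finset.sum_add_distrib]
    refine Finset.sum_congr rfl fun r _ => ?_
    rw [Function.comp_apply, ofComplex_apply, normalizedDerivOfComplex]
    rcases r with _ | r
    · simp; ring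
    · push_cast
      ring

open Derivative in
/-- The derivation `D = (2πi)⁻¹ d/dτ` on quasimodular forms. -/
def opD : Module.End ℂ QMF where
  toFun φ := ⟨normalizedDerivOfComplex (φ : ℍ → ℂ), by
    have h : ∀ ψ ∈ QMF, ψ ∈ Hol0 ∧ normalizedDerivOfComplex ψ ∈ QMF := by
      intro ψ hψ
      refine ⟨QMF_le_Hol0 hψ, ?_⟩
      induction hψ using Submodule.iSup_induction' with
      | mem k ψ h => exact QM_le_QMF _ (deriv_mem_QM h)
      | zero =>
        rw [show normalizedDerivOfComplex (0 : ℍ → ℂ) = 0 from normalizedDerivOfComplex_const 0]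
        exact QMF.zero_mem
      | add ψ χ h1 h2 h3 h4 =>
        rw [normalizedDerivOfComplex_add _ _ (QMF_le_Hol0 h1).1 (QMF_le_Hol0 h2).1]
        exact QMF.add_mem h3 h4
    exact (h _ φ.2).2⟩
  map_add' φ ψ := Subtype.ext
    (normalizedDerivOfComplex_add _ _ (QMF_le_Hol0 φ.2).1 (QMF_le_Hol0 ψ.2).1)
  map_smul' a φ := Subtype.ext (normalizedDerivOfComplex_smul a _ (QMF_le_Hol0 φ.2).1)

/-- Multiplication by the Eisenstein series `G_2` on quasimodular forms. -/
def mulG2 : Module.End ℂ QMF :=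
  (LinearMap.mulLeft ℂ (eisG 2)).restrict fun _ h => eisG_two_mul_mem_QMF h

/-- The decomposition of quasimodular forms by weight. -/
def decompQMF : (DirectSum ℤ fun k => QM k) ≃ₗ[ℂ] QMF :=
  (LinearEquiv.ofInjective (DirectSum.coeLinearMap QM) iSupIndep_QM.dfinsupp_lsum_injective).trans
    (LinearEquiv.ofEq _ _ (DirectSum.range_coeLinearMap))

/-- The operator on quasimodular forms given by `f k` on the forms of weight `k`. -/
def ofWeights (f : ∀ k : ℤ, QM k →ₗ[ℂ] QMF) : Module.End ℂ QMF :=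
  (DirectSum.toModule ℂ ℤ QMF f).comp decompQMF.symm.toLinearMap

theorem ofWeights_apply (f : ∀ k : ℤ, QM k →ₗ[ℂ] QMF) (k : ℤ) (φ : QM k) :
    ofWeights f ⟨φ, QM_le_QMF k φ.2⟩ = f k φ := by
  have h : decompQMF (DirectSum.lof ℂ ℤ (fun k => QM k) k φ) = ⟨φ, QM_le_QMF k φ.2⟩ :=
    Subtype.ext (DirectSum.coeLinearMap_lof QM k φ)
  rw [← h, ofWeights, LinearMap.comp_apply]
  simp

/-- The weight operator `W`, multiplying a quasimodular form of weight `k` by `k`. -/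
def opW : Module.End ℂ QMF :=
  ofWeights fun k => (k : ℂ) • Submodule.inclusion (QM_le_QMF k)

/-- The coefficient functions `φ_0, φ_1, …` of a quasimodular form `φ` of weight `k`. -/
def coeffFun {k : ℤ} (φ : QM k) : ℕ → ℍ → ℂ := φ.2.2.choose_spec.choose

theorem coeffFun_spec {k : ℤ} (φ : QM k) :
    HasQuasimodularExpansion k φ.2.2.choose φ (coeffFun φ) :=
  φ.2.2.choose_spec.choose_spec

theorem coeffFun_eq {k : ℤ} (φ : QM k) {p : ℕ} {c : ℕ → ℍ → ℂ}
    (h : HasQuasimodularExpansion k p φ c) : coeffFun φ = c :=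
  (coeffFun_spec φ).unique h

theorem coeffFun_one_mem {k : ℤ} (φ : QM k) : coeffFun φ 1 ∈ QM (k - 2) :=
  ⟨(coeffFun_spec φ).mem 1, _, _, (coeffFun_spec φ).one⟩

/-- The operator `φ ↦ 2πi φ_1` from quasimodular forms of weight `k` to quasimodular forms
of weight `k - 2`. -/
def dWeight (k : ℤ) : QM k →ₗ[ℂ] QM (k - 2) where
  toFun φ := ⟨(2 * Real.pi * Complex.I : ℂ) • coeffFun φ 1,
    (QM (k - 2)).smul_mem _ (coeffFun_one_mem φ)⟩
  map_add' φ ψ := by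
    ext1
    have := coeffFun_eq (φ + ψ) ((coeffFun_spec φ).add (coeffFun_spec ψ))
    simp [this]
  map_smul' a φ := by
    ext1
    have := coeffFun_eq (a • φ) ((coeffFun_spec φ).smul a)
    simp [this, smul_comm a]

/-- The operator `𝔡` on quasimodular forms: `φ ↦ 2πi φ_1` in each weight. -/
def frakD : Module.End ℂ QMF :=
  ofWeights fun k => (Submodule.inclusion (QM_le_QMF (k - 2))).comp (dWeight k)

theorem frakD_apply {k : ℤ} {p : ℕ} {φ : ℍ → ℂ} {c : ℕ → ℍ → ℂ} (h : φ ∈ QM k)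
    (hc : HasQuasimodularExpansion k p φ c) :
    (frakD ⟨φ, QM_le_QMF k h⟩ : ℍ → ℂ) = (2 * Real.pi * Complex.I : ℂ) • c 1 := by
  have h1 := ofWeights_apply
    (fun k => (Submodule.inclusion (QM_le_QMF (k - 2))).comp (dWeight k)) k ⟨φ, h⟩
  rw [frakD, h1, ← coeffFun_eq ⟨φ, h⟩ hc]
  rfl

theorem opW_apply {k : ℤ} {φ : ℍ → ℂ} (h : φ ∈ QM k) :
    opW ⟨φ, QM_le_QMF k h⟩ = (k : ℂ) • ⟨φ, QM_le_QMF k h⟩ :=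
  ofWeights_apply (fun k => (k : ℂ) • Submodule.inclusion (QM_le_QMF k)) k ⟨φ, h⟩

end Quasimodular

end
end PartitionSl2

open PartitionSl2

/-! Part (iii) rests on a recursion for the bracket. The sum of the `λ_i ^ (k - 1)` runs over the
pairs `(m, s)` with `1 ≤ s ≤` multiplicity of `m`, each counted with weight `m ^ (k - 1)`. Removing
`s` copies of `m` from `λ` leaves a partition `μ` with `|λ| = |μ| + ms` and `S_j(λ) = S_j(μ) + s m ^
(j - 1) = S_j(μ) + u v ^ (j / 2 - 1)`, where `u = ms` and `v = m ^ 2`. Expand `p` under the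
substitution `S_j ↦ S_j + u v ^ (j / 2 - 1)` (`shiftHom`) as `∑ p_{a,b} u ^ a v ^ b`. Since `∑ m ^
(k - 1) u ^ a v ^ b q ^ (ms)` is `D ^ a G_{k+2b}` up to its constant term, one gets `⟨S_k p⟩ = ∑ D ^
a G_{k+2b} ⟨p_{a,b}⟩` (`bracketPoly_X_mul`). The constant terms match because `p_{0,0} = p` and
`p_{0,b} = 0` for `b > 0`.

The `p_{a,b}` have degree at most that of `p`, so the recursion determines the bracket from `⟨1⟩ =
1` (`eq_top_of_shiftHom`). Quasimodularity follows by induction, because quasimodular forms are an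
algebra closed under `D` that contains all `G_k`. The differences `W⟨p⟩ - ⟨Wp⟩` and `𝔡⟨p⟩ - ⟨𝔰p⟩`
satisfy the same recursion and vanish at `p = 1`, hence are zero (`weight_recursion`,
`lowering_recursion`).

For `𝔡` this needs a comparison. On modular forms, `[𝔡, D] = W` gives `𝔡 D ^ a G_{2b+2} = a (a + 2b
+ 1) D ^ (a - 1) G_{2b+2}`, apart from the value `-1/2` of `𝔡 G_2`; on polynomials in `u`, `v` this
is the operator `(u ∂_u + 2v ∂_v + 2) ∂_u`. On polynomials in the `S_j`, `[𝔰, S_k] = ∑_j (k + j - 2)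
S_{k+j-2} ∂_j`, with a further `-1/2` if `k = 2`, and translating the linear coefficients of `𝔰`
adds a term with a factor `u`. That the two sides agree is `euler_pderiv_shiftHom`.

The relation for `D + G_2` is the quotient rule applied to `S_2(λ) = |λ| - 1/24`. Part (i) is the
case `k = 2` of the commutator above together with a count of weights. Part (ii) is read off from
the transformation law of a derivative, the Leibniz rule for `𝔡`, and `𝔡 G_2 = -1/2`. -/

namespace PartitionSl2
noncomputable section

open MvPolynomial

/-! ### The `sl₂`-triple on polynomials in the `S_k`. -/

theorem EvenPos.coe_merge (a b : EvenPos) :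
    (((EvenPos.merge a b : EvenPos) : ℕ) : ℚ) = (a : ℕ) + (b : ℕ) - 2 := by
  obtain ⟨a, ⟨a', rfl⟩, ha⟩ := a
  obtain ⟨b, ⟨b', rfl⟩, hb⟩ := b
  simp only [EvenPos.merge]
  rw [Nat.cast_sub (by omega)]
  push_cast
  ring

theorem EvenPos.merge_comm (a b : EvenPos) : EvenPos.merge a b = EvenPos.merge b a :=
  Subtype.ext (by simp only [EvenPos.merge, add_comm])

theorem EvenPos.two_merge (a : EvenPos) : EvenPos.merge EvenPos.two a = a :=
  Subtype.ext (by simp only [EvenPos.merge, EvenPos.two]; omega)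

/-- Allows the values of `𝔰` at different polynomials to be compared over one common finite index
set. -/
theorem sPoly_eq {T : Finset EvenPos} {p : MvPolynomial EvenPos ℚ} (h : p.vars ⊆ T) :
    sPoly p = secondOrder T p - (1 / 2 : ℚ) • pderiv EvenPos.two p := by
  rw [← secondOrder_eq h]
  rfl

theorem sPoly_one : sPoly 1 = 0 := by
  rw [sPoly_eq (T := ∅) (by simp)]
  simp [secondOrder]

theorem weightPoly_X (k : EvenPos) : weightPoly (X k) = ((k : ℕ) : ℚ) • X k := by
  simp [weightPoly, mkDerivation_X]

theorem weightPoly_mul (p q : MvPolynomial EvenPos ℚ) :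
    weightPoly (p * q) = p * weightPoly q + weightPoly p * q := by
  simp only [weightPoly, Derivation.coeFn_coe, Derivation.leibniz, smul_eq_mul]
  ring

theorem weightPoly_one : weightPoly 1 = 0 := by
  simp [weightPoly]

theorem weightPoly_X_mul (k : EvenPos) (p : MvPolynomial EvenPos ℚ) :
    weightPoly (X k * p) = X k * weightPoly p + ((k : ℕ) : ℚ) • (X k * p) := by
  rw [weightPoly_mul, weightPoly_X, smul_mul_assoc]

/-- The commutator of two derivations is a derivation, so it suffices to check the formula on the
generators. -/
theorem weightPoly_pderiv (a : EvenPos) (p : MvPolynomial EvenPos ℚ) :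
    weightPoly (pderiv a p) = pderiv a (weightPoly p) - ((a : ℕ) : ℚ) • pderiv a p := by
  classical
  have h : ⁅mkDerivation ℚ fun k : EvenPos => ((k : ℕ) : ℚ) • (X k : MvPolynomial EvenPos ℚ),
      pderiv (R := ℚ) a⁆ = -((a : ℕ) : ℚ) • pderiv (R := ℚ) a := by
    refine derivation_ext fun i => ?_
    rw [Derivation.commutator_apply, mkDerivation_X, Derivation.map_smul, Derivation.smul_apply]
    simp only [pderiv_X, Pi.single_apply]
    split_ifs with hi
    · subst hi; simp
    · simp
  have h1 := congrArg (fun d => d p) h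
  simp only [Derivation.commutator_apply, Derivation.smul_apply, neg_smul] at h1
  rw [sub_eq_iff_eq_add] at h1
  simp only [weightPoly, Derivation.coeFn_coe]
  rw [h1]
  abel

/-- The two derivatives remove weight `a + b` and the coefficient `S_{a+b-2}` restores all of it but
`2`. -/
theorem weightPoly_secondOrder (T : Finset EvenPos) (p : MvPolynomial EvenPos ℚ) :
    weightPoly (secondOrder T p) = secondOrder T (weightPoly p) - (2 : ℚ) • secondOrder T p := by
  simp only [secondOrder, map_smul, map_sum]
  rw [smul_comm (2 : ℚ), ← smul_sub]
  refine congrArg _ ?_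
  rw [Finset.smul_sum, ← Finset.sum_sub_distrib]
  refine Finset.sum_congr rfl fun a _ => ?_
  rw [Finset.smul_sum, ← Finset.sum_sub_distrib]
  refine Finset.sum_congr rfl fun b _ => ?_
  rw [weightPoly_X_mul, weightPoly_pderiv, weightPoly_pderiv, EvenPos.coe_merge, map_sub,
    Derivation.map_smul]
  simp only [mul_sub, mul_smul_comm]
  module

theorem weightPoly_sPoly (p : MvPolynomial EvenPos ℚ) :
    weightPoly (sPoly p) = sPoly (weightPoly p) - (2 : ℚ) • sPoly p := by
  classical
  rw [sPoly_eq (T := p.vars ∪ (weightPoly p).vars) (p := p) (by grind),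
    sPoly_eq (T := p.vars ∪ (weightPoly p).vars) (p := weightPoly p) (by grind),
    map_sub, map_smul, weightPoly_secondOrder, weightPoly_pderiv]
  simp only [EvenPos.two, Nat.cast_ofNat]
  module

/-- The commutator of `𝔰` with multiplication by `S_k`. -/
theorem sPoly_X_mul (k : EvenPos) {T : Finset EvenPos} {p : MvPolynomial EvenPos ℚ}
    (h : p.vars ⊆ T) :
    sPoly (X k * p) = X k * sPoly p +
      ∑ j ∈ T, (((k : ℕ) : ℚ) + (j : ℕ) - 2) • (X (EvenPos.merge k j) * pderiv j p) -
      (1 / 2 : ℚ) • (pderiv EvenPos.two (X k) * p) := by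
  classical
  -- The index `k` need not occur in `p`, but it occurs in `S_k p`; enlarging `T` by `k` only adds
  -- zero terms to the sum over `j`.
  set T' := insert k T with hT'
  have hv : (X k * p).vars ⊆ T' := by
    refine (vars_mul _ _).trans ?_
    rw [vars_X]
    grind
  have hT : ∑ j ∈ T, (((k : ℕ) : ℚ) + (j : ℕ) - 2) • (X (EvenPos.merge k j) * pderiv j p) =
      ∑ j ∈ T', (((k : ℕ) : ℚ) + (j : ℕ) - 2) • (X (EvenPos.merge k j) * pderiv j p) := by
    refine Finset.sum_subset (Finset.subset_insert _ _) fun j _ hj => ?_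
    rw [pderiv_eq_zero_of_notMem_vars fun h' => hj (h h'), mul_zero, smul_zero]
  rw [hT, sPoly_eq hv, sPoly_eq (T := T') (p := p) (by grind)]
  have h2 : ∀ a b, pderiv a (pderiv b (X k * p)) =
      X k * pderiv a (pderiv b p) + pderiv a (X k) * pderiv b p + pderiv b (X k) * pderiv a p := by
    intro a b
    simp only [pderiv_mul, map_add]
    have : pderiv a (pderiv b (X k : MvPolynomial EvenPos ℚ)) = 0 := by
      rw [pderiv_X, Pi.single_apply]; split_ifs <;> simp
    rw [this]; ring
  have h3 : secondOrder T' (X k * p) = X k * secondOrder T' p +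
      ∑ j ∈ T', (((k : ℕ) : ℚ) + (j : ℕ) - 2) • (X (EvenPos.merge k j) * pderiv j p) := by
    simp only [secondOrder, h2, mul_add, smul_add, Finset.sum_add_distrib]
    have hk : k ∈ T' := Finset.mem_insert_self _ _
    have e1 : ∑ a ∈ T', ∑ b ∈ T', (((EvenPos.merge a b : EvenPos) : ℕ) : ℚ) •
        (X (EvenPos.merge a b) * (pderiv a (X k) * pderiv b p)) =
        ∑ j ∈ T', (((k : ℕ) : ℚ) + (j : ℕ) - 2) • (X (EvenPos.merge k j) * pderiv j p) := by
      rw [Finset.sum_eq_single k (fun a _ ha => Finset.sum_eq_zero fun b _ => by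
        rw [pderiv_X_of_ne ha.symm]; simp) (fun h => absurd hk h)]
      simp [EvenPos.coe_merge]
    have e2 : ∑ a ∈ T', ∑ b ∈ T', (((EvenPos.merge a b : EvenPos) : ℕ) : ℚ) •
        (X (EvenPos.merge a b) * (pderiv b (X k) * pderiv a p)) =
        ∑ j ∈ T', (((k : ℕ) : ℚ) + (j : ℕ) - 2) • (X (EvenPos.merge k j) * pderiv j p) := by
      rw [Finset.sum_comm, ← e1]
      simp only [EvenPos.merge_comm]
    -- The two cross terms of the second derivative of a product are equal by symmetry, which
    -- absorbs the factor `1/2` of the second-order operator.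
    rw [e1, e2, mul_smul_comm, Finset.mul_sum, add_assoc, ← two_smul ℚ, smul_smul]
    norm_num
    refine Finset.sum_congr rfl fun a _ => ?_
    rw [Finset.mul_sum]
    exact Finset.sum_congr rfl fun b _ => by rw [mul_smul_comm]; congr 1; ring
  rw [h3, pderiv_mul]
  simp only [mul_sub, smul_add, mul_smul_comm]
  abel

/-- The chain rule for an operator satisfying the Leibniz rule along an algebra homomorphism. -/
theorem leibniz_eq_sum {B : Type*} [CommRing B] [Algebra ℚ B]
    (T : MvPolynomial EvenPos ℚ →ₐ[ℚ] B) (δ : MvPolynomial EvenPos ℚ →ₗ[ℚ] B)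
    (hδ : ∀ p q, δ (p * q) = T p * δ q + δ p * T q)
    {S : Finset EvenPos} {p : MvPolynomial EvenPos ℚ} (h : p.vars ⊆ S) :
    δ p = ∑ j ∈ S, δ (X j) * T (pderiv j p) := by
  classical
  -- The Leibniz rule for `1 * 1` gives `δ 1 = δ 1 + δ 1`.
  have h1 : δ 1 = 0 := by simpa using hδ 1 1
  have hp : p ∈ supported ℚ (S : Set EvenPos) := by
    rw [mem_supported]; exact_mod_cast h
  clear h
  rw [supported_eq_adjoin_X] at hp
  induction hp using Algebra.adjoin_induction with
  | mem x hx =>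
    obtain ⟨i, hi, rfl⟩ := hx
    rw [Finset.sum_eq_single i (fun j _ hj => by rw [pderiv_X_of_ne hj.symm]; simp)
      (fun h => absurd hi h)]
    simp
  | algebraMap r =>
    rw [Algebra.algebraMap_eq_smul_one, map_smul, h1]
    simp
  | add x y _ _ hx hy =>
    simp only [map_add, mul_add, Finset.sum_add_distrib]
    rw [hx, hy]
  | mul x y _ _ hx hy =>
    rw [hδ, hx, hy, Finset.mul_sum, Finset.sum_mul, ← Finset.sum_add_distrib]
    refine Finset.sum_congr rfl fun j _ => ?_
    rw [pderiv_mul, map_add, map_mul, map_mul]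
    ring

/-- The first two relations count weights. For the third, merging an index `j` with `2` gives back
`j`, so `[𝔰, S_2]` is `∑ j S_j ∂_j - 1/2`, and the sum is `W` by the chain rule. -/
theorem sl2_algS : IsSl2OperatorTriple mulS2 frakS (weightS - (1 / 2 : ℚ) • 1) := by
  have hW : ∀ p, weightS (polyEquiv p) = polyEquiv (weightPoly p) := fun p => by
    simp [weightS, LinearEquiv.conj_apply]
  have hs : ∀ p, frakS (polyEquiv p) = polyEquiv (sPoly p) := fun p => by
    simp [frakS, LinearEquiv.conj_apply]
  have hm : ∀ p, mulS2 (polyEquiv p) = polyEquiv (X EvenPos.two * p) := fun p => by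
    simp [mulS2, polyEquiv_X]
  refine ⟨?_, ?_, ?_⟩ <;> refine LinearMap.ext fun f => ?_ <;>
    obtain ⟨p, rfl⟩ := polyEquiv.surjective f <;>
    simp only [LinearMap.sub_apply, Module.End.mul_apply, hW, hs, hm, LinearMap.smul_apply,
      Module.End.one_apply, LinearMap.neg_apply, ← map_smul, ← map_nsmul, ← map_sub, ← map_neg] <;>
    refine congrArg _ ?_
  · rw [weightPoly_X_mul, mul_sub, mul_smul_comm]
    simp only [EvenPos.two, Nat.cast_ofNat]
    module
  · rw [map_sub, map_smul, map_neg, map_nsmul, weightPoly_sPoly]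
    module
  · have := leibniz_eq_sum (AlgHom.id ℚ _) weightPoly weightPoly_mul (subset_refl p.vars)
    rw [sPoly_X_mul EvenPos.two (subset_refl _), this]
    simp only [EvenPos.two_merge, weightPoly_X, pderiv_X_self, AlgHom.id_apply, one_mul]
    simp only [EvenPos.two, Nat.cast_ofNat, add_sub_cancel_left, smul_mul_assoc]
    abel

end
end PartitionSl2

/-! ### The translation `S_k ↦ S_k + u v ^ (k / 2 - 1)` and its effect on `𝔰`. -/

namespace PartitionSl2
noncomputable section

open MvPolynomial

/-- The exponent `k / 2 - 1` attached to an even index `k`. -/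
def EvenPos.exp (k : EvenPos) : ℕ := (k : ℕ) / 2 - 1

theorem EvenPos.coe_eq_exp (k : EvenPos) : (k : ℕ) = 2 * k.exp + 2 := by
  obtain ⟨k, ⟨k', rfl⟩, hk⟩ := k
  simp only [EvenPos.exp]
  omega

/-- This additivity is the reason for indexing by `k / 2 - 1`: the coefficient `S_{a+b-2}` of `𝔰` is
translated by `u` times the product of the powers of `v` that belong to `a` and `b`. -/
theorem EvenPos.exp_merge (a b : EvenPos) : (EvenPos.merge a b).exp = a.exp + b.exp := by
  have h := a.coe_eq_exp
  have h' := b.coe_eq_exp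
  have h2 := (EvenPos.merge a b).coe_eq_exp
  simp only [EvenPos.merge] at h2 ⊢
  omega

theorem EvenPos.exp_eq_zero {k : EvenPos} : k.exp = 0 ↔ k = EvenPos.two := by
  rw [Subtype.ext_iff, k.coe_eq_exp]
  simp [EvenPos.two]

/-- Polynomials in two auxiliary variables over the polynomials in the `S_k`. -/
abbrev ShiftPoly : Type := MvPolynomial (Fin 2) (MvPolynomial EvenPos ℚ)

theorem shiftPoly_monomial (m : Fin 2 →₀ ℕ) (r : MvPolynomial EvenPos ℚ) :
    (monomial m r : ShiftPoly) = C r * X 0 ^ m 0 * X 1 ^ m 1 := by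
  rw [monomial_eq, Finsupp.prod_fintype _ _ (by simp)]
  simp [mul_assoc]

theorem ShiftPoly.induction {motive : ShiftPoly → Prop} (P : ShiftPoly)
    (term : ∀ (r : MvPolynomial EvenPos ℚ) (a b : ℕ), motive (C r * X 0 ^ a * X 1 ^ b))
    (add : ∀ P Q, motive P → motive Q → motive (P + Q)) : motive P :=
  MvPolynomial.induction_on' P (fun m r => shiftPoly_monomial m r ▸ term r _ _) add

/-- The linear map given by `f a b` on the coefficient of `X₀ ^ a X₁ ^ b`. -/
def ofCoeffs {B : Type*} [AddCommGroup B] [Module ℚ B]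
    (f : ℕ → ℕ → MvPolynomial EvenPos ℚ →ₗ[ℚ] B) : ShiftPoly →ₗ[ℚ] B :=
  (Finsupp.lsum ℚ fun m : Fin 2 →₀ ℕ => f (m 0) (m 1)) ∘ₗ
    (AddMonoidAlgebra.coeffLinearEquiv ℚ).toLinearMap

theorem ofCoeffs_eq {B : Type*} [AddCommGroup B] [Module ℚ B]
    (f : ℕ → ℕ → MvPolynomial EvenPos ℚ →ₗ[ℚ] B) (P : ShiftPoly) :
    ofCoeffs f P = ∑ m ∈ P.support, f (m 0) (m 1) (coeff m P) := rfl

theorem ofCoeffs_term {B : Type*} [AddCommGroup B] [Module ℚ B]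
    (f : ℕ → ℕ → MvPolynomial EvenPos ℚ →ₗ[ℚ] B) (r : MvPolynomial EvenPos ℚ) (a b : ℕ) :
    ofCoeffs f (C r * X 0 ^ a * X 1 ^ b) = f a b r := by
  have h : (C r * X 0 ^ a * X 1 ^ b : ShiftPoly) =
      monomial (Finsupp.single 0 a + Finsupp.single 1 b) r := by
    rw [shiftPoly_monomial]
    simp
  rw [h, ofCoeffs, LinearMap.comp_apply]
  have : (AddMonoidAlgebra.coeffLinearEquiv ℚ).toLinearMap
      (monomial (Finsupp.single 0 a + Finsupp.single 1 b) r : ShiftPoly) =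
      Finsupp.single (Finsupp.single 0 a + Finsupp.single 1 b) r := rfl
  rw [this, Finsupp.lsum_single]
  simp

/-- The action of a linear map on the coefficients. -/
def coeffMap (f : Module.End ℚ (MvPolynomial EvenPos ℚ)) : Module.End ℚ ShiftPoly :=
  ofCoeffs fun a b => (LinearMap.mulRight ℚ (X 0 ^ a * X 1 ^ b : ShiftPoly)) ∘ₗ
    (Algebra.linearMap (MvPolynomial EvenPos ℚ) ShiftPoly).restrictScalars ℚ ∘ₗ f

theorem coeffMap_term (f : Module.End ℚ (MvPolynomial EvenPos ℚ)) (r : MvPolynomial EvenPos ℚ)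
    (a b : ℕ) : coeffMap f (C r * X 0 ^ a * X 1 ^ b) = C (f r) * X 0 ^ a * X 1 ^ b := by
  rw [coeffMap, ofCoeffs_term]
  simp [algebraMap_eq, mul_assoc]

/-- Lets `𝔰`, which has infinitely many terms, be replaced by a finite expression that agrees with
it on the coefficients of `P`. -/
theorem coeffMap_congr {f g : Module.End ℚ (MvPolynomial EvenPos ℚ)} {P : ShiftPoly}
    (h : ∀ m, f (coeff m P) = g (coeff m P)) : coeffMap f P = coeffMap g P := by
  rw [coeffMap, coeffMap, ofCoeffs_eq, ofCoeffs_eq]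
  simp [h]

theorem coeffMap_C (f : Module.End ℚ (MvPolynomial EvenPos ℚ)) (r : MvPolynomial EvenPos ℚ) :
    coeffMap f (C r) = C (f r) := by
  simpa using coeffMap_term f r 0 0

theorem coeffMap_X_pow_mul (f : Module.End ℚ (MvPolynomial EvenPos ℚ)) (e : ℕ) (P : ShiftPoly) :
    coeffMap f (X 1 ^ e * P) = X 1 ^ e * coeffMap f P := by
  induction P using ShiftPoly.induction with
  | term r a b =>
    rw [coeffMap_term, show (X 1 ^ e * (C r * X 0 ^ a * X 1 ^ b) : ShiftPoly) =
      C r * X 0 ^ a * X 1 ^ (b + e) by ring, coeffMap_term]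
    ring
  | add P Q hP hQ => rw [mul_add, map_add, map_add, hP, hQ, mul_add]

theorem coeffMap_leibniz (δ : Derivation ℚ (MvPolynomial EvenPos ℚ) (MvPolynomial EvenPos ℚ))
    (P Q : ShiftPoly) :
    coeffMap δ (P * Q) = P * coeffMap δ Q + coeffMap δ P * Q := by
  induction P using ShiftPoly.induction with
  | add P P' hP hP' => rw [add_mul, map_add, map_add, hP, hP']; ring
  | term r a b =>
    induction Q using ShiftPoly.induction with
    | add Q Q' hQ hQ' => rw [mul_add, map_add, map_add, hQ, hQ']; ring
    | term r' a' b' =>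
      rw [show (C r * X 0 ^ a * X 1 ^ b * (C r' * X 0 ^ a' * X 1 ^ b') : ShiftPoly) =
        C (r * r') * X 0 ^ (a + a') * X 1 ^ (b + b') by rw [C_mul]; ring,
        coeffMap_term, coeffMap_term, coeffMap_term]
      simp only [Derivation.coeFn_coe, Derivation.leibniz, smul_eq_mul, C_add, C_mul]
      ring

/-- The substitution `S_k ↦ S_k + u v ^ (k / 2 - 1)`. -/
def shiftHom : MvPolynomial EvenPos ℚ →ₐ[ℚ] ShiftPoly :=
  aeval fun k => C (X k) + X 0 * X 1 ^ k.exp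

theorem shiftHom_X (k : EvenPos) : shiftHom (X k) = C (X k) + X 0 * X 1 ^ k.exp :=
  aeval_X _ k

theorem constantCoeff_shiftHom (p : MvPolynomial EvenPos ℚ) :
    constantCoeff (shiftHom p) = p := by
  have : (constantCoeff (R := MvPolynomial EvenPos ℚ) (σ := Fin 2)).comp
      (shiftHom : MvPolynomial EvenPos ℚ →+* ShiftPoly) = RingHom.id _ := by
    refine ringHom_ext (fun r => ?_) fun k => ?_
    · simp [← algebraMap_eq, IsScalarTower.algebraMap_apply ℚ
        (MvPolynomial EvenPos ℚ) ShiftPoly]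
    · simp [shiftHom_X]
  exact congrArg (fun f => f p) this

/-- Chain rule: `u` enters only through the added terms `u v ^ j.exp`, whose `u`-derivative is `v ^
j.exp`. -/
theorem pderiv_shiftHom {S : Finset EvenPos} {p : MvPolynomial EvenPos ℚ} (h : p.vars ⊆ S) :
    pderiv 0 (shiftHom p) = ∑ j ∈ S, X 1 ^ j.exp * shiftHom (pderiv j p) := by
  have := leibniz_eq_sum shiftHom
    (((pderiv 0 : Derivation _ ShiftPoly _).toLinearMap.restrictScalars ℚ) ∘ₗ shiftHom.toLinearMap)
    (fun p q => by simp [mul_comm]) h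
  simp only [LinearMap.comp_apply, LinearMap.restrictScalars_apply, AlgHom.toLinearMap_apply,
    Derivation.coeFn_coe, shiftHom_X, map_add, pderiv_C, pderiv_mul, pderiv_X_self, pderiv_pow,
    pderiv_X_of_ne (show (1 : Fin 2) ≠ 0 by decide)] at this
  simpa using this

/-- The derivation `u ∂/∂u + 2 v ∂/∂v`. -/
def euler : Derivation (MvPolynomial EvenPos ℚ) ShiftPoly ShiftPoly :=
  mkDerivation _ ![X 0, 2 * X 1]

theorem euler_X_zero : euler (X 0) = X 0 := by simp [euler, mkDerivation_X]

theorem euler_X_one : euler (X 1) = 2 * X 1 := by simp [euler, mkDerivation_X]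

theorem euler_C (r : MvPolynomial EvenPos ℚ) : euler (C r) = 0 := by
  rw [← algebraMap_eq, Derivation.map_algebraMap]

theorem euler_X_one_pow (b : ℕ) : euler (X 1 ^ b) = 2 * (b : ShiftPoly) * X 1 ^ b := by
  rw [Derivation.leibniz_pow, euler_X_one]
  cases b
  · simp
  · simp [pow_succ]; ring

theorem euler_X_zero_pow (b : ℕ) : euler (X 0 ^ b) = (b : ShiftPoly) * X 0 ^ b := by
  rw [Derivation.leibniz_pow, euler_X_zero]
  cases b
  · simp
  · simp [pow_succ]

/-- Chain rule again: the added term `u v ^ j.exp` is an eigenvector of `u ∂_u + 2v ∂_v` with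
eigenvalue `1 + 2 j.exp = j - 1`. -/
theorem euler_shiftHom {S : Finset EvenPos} {p : MvPolynomial EvenPos ℚ} (h : p.vars ⊆ S) :
    euler (shiftHom p) =
      ∑ j ∈ S, (1 + 2 * (j.exp : ShiftPoly)) * X 0 * X 1 ^ j.exp * shiftHom (pderiv j p) := by
  have := leibniz_eq_sum shiftHom
    ((euler.toLinearMap.restrictScalars ℚ) ∘ₗ shiftHom.toLinearMap)
    (fun p q => by simp [mul_comm]) h
  simp only [LinearMap.comp_apply, LinearMap.restrictScalars_apply, AlgHom.toLinearMap_apply,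
    Derivation.coeFn_coe, shiftHom_X, map_add, euler_C, Derivation.leibniz, euler_X_zero,
    euler_X_one_pow, smul_eq_mul] at this
  rw [this]
  exact Finset.sum_congr rfl fun j _ => by ring

/-- Translations commute with partial derivatives. -/
theorem coeffMap_pderiv_shiftHom (a : EvenPos) (p : MvPolynomial EvenPos ℚ) :
    coeffMap (pderiv a).toLinearMap (shiftHom p) = shiftHom (pderiv a p) := by
  classical
  have := leibniz_eq_sum shiftHom (coeffMap (pderiv a).toLinearMap ∘ₗ shiftHom.toLinearMap)
    (fun p q => by simpa using coeffMap_leibniz (pderiv a) _ _) (Finset.subset_insert a p.vars)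
  rw [LinearMap.comp_apply, AlgHom.toLinearMap_apply] at this
  rw [this, Finset.sum_eq_single a (fun j _ hj => ?_) (by simp)]
  all_goals
    simp only [LinearMap.comp_apply, AlgHom.toLinearMap_apply, shiftHom_X, map_add, coeffMap_C,
      Derivation.coeFn_coe]
    rw [show (X 0 * X 1 ^ EvenPos.exp _ : ShiftPoly) = C 1 * X 0 ^ 1 * X 1 ^ EvenPos.exp _ by
      rw [C_1]; ring, coeffMap_term]
  · simp
  · simp [pderiv_X_of_ne hj]

/-- The translation introduces no new variables `S_k`, so one finite expression for `𝔰` serves `p`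
and all coefficients of its translate. -/
theorem coeff_shiftHom_mem_supported {S : Set EvenPos} {p : MvPolynomial EvenPos ℚ}
    (hp : p ∈ supported ℚ S) (m : Fin 2 →₀ ℕ) : coeff m (shiftHom p) ∈ supported ℚ S := by
  classical
  have hC : ∀ r ∈ supported ℚ S, ∀ m : Fin 2 →₀ ℕ, coeff m (C r : ShiftPoly) ∈ supported ℚ S := by
    intro r hr m
    rw [coeff_C]
    split_ifs
    · exact hr
    · exact zero_mem _
  rw [supported_eq_adjoin_X] at hp
  induction hp using Algebra.adjoin_induction generalizing m with
  | mem x hx =>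
    obtain ⟨i, hi, rfl⟩ := hx
    rw [shiftHom_X, coeff_add]
    refine add_mem (hC _ (X_mem_supported.2 hi) _) ?_
    rw [show (X 0 * X 1 ^ EvenPos.exp _ : ShiftPoly) = monomial
      (Finsupp.single 0 1 + Finsupp.single 1 (EvenPos.exp i)) 1 by rw [shiftPoly_monomial]; simp,
      coeff_monomial]
    split_ifs
    · exact one_mem _
    · exact zero_mem _
  | algebraMap r =>
    rw [AlgHom.commutes, IsScalarTower.algebraMap_apply ℚ (MvPolynomial EvenPos ℚ) ShiftPoly]
    exact hC _ (algebraMap_mem _ _) _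
  | add x y _ _ hx hy => rw [map_add, coeff_add]; exact add_mem (hx m) (hy m)
  | mul x y _ _ hx hy =>
    rw [map_mul, coeff_mul]
    exact sum_mem fun i _ => mul_mem (hx _) (hy _)

theorem coeffMap_add (f g : Module.End ℚ (MvPolynomial EvenPos ℚ)) (P : ShiftPoly) :
    coeffMap (f + g) P = coeffMap f P + coeffMap g P := by
  induction P using ShiftPoly.induction with
  | term r a b => simp only [coeffMap_term, LinearMap.add_apply, C_add, add_mul]
  | add P Q hP hQ => simp only [map_add, hP, hQ]; abel

theorem coeffMap_comp (f g : Module.End ℚ (MvPolynomial EvenPos ℚ)) (P : ShiftPoly) :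
    coeffMap (f ∘ₗ g) P = coeffMap f (coeffMap g P) := by
  induction P using ShiftPoly.induction with
  | term r a b => simp only [coeffMap_term, LinearMap.comp_apply]
  | add P Q hP hQ => simp only [map_add, hP, hQ]

theorem coeffMap_mulLeft (c : MvPolynomial EvenPos ℚ) (P : ShiftPoly) :
    coeffMap (LinearMap.mulLeft ℚ c) P = C c * P := by
  induction P using ShiftPoly.induction with
  | term r a b => rw [coeffMap_term, LinearMap.mulLeft_apply, C_mul]; ring
  | add P Q hP hQ => simp only [map_add, hP, hQ, mul_add]

theorem coeffMap_sum {ι : Type*} (s : Finset ι) (f : ι → Module.End ℚ (MvPolynomial EvenPos ℚ))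
    (P : ShiftPoly) : coeffMap (∑ i ∈ s, f i) P = ∑ i ∈ s, coeffMap (f i) P := by
  classical
  induction s using Finset.induction_on with
  | empty =>
    simp only [Finset.sum_empty]
    rw [coeffMap_congr (g := LinearMap.mulLeft ℚ 0) (by simp), coeffMap_mulLeft]
    simp
  | insert i s hi ih => rw [Finset.sum_insert hi, Finset.sum_insert hi, coeffMap_add, ih]

theorem shiftHom_C (c : ℚ) : shiftHom (C c) = C (C c) := by
  rw [← algebraMap_eq, AlgHom.commutes, IsScalarTower.algebraMap_apply ℚ
    (MvPolynomial EvenPos ℚ) ShiftPoly]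
  rfl

/-- The derivatives in `𝔰` commute with the translation, so the defect comes only from the linear
coefficients `½ (a + b - 2) S_{a+b-2}`. Each of these is translated by `(a.exp + b.exp + 1) u v ^
(a.exp + b.exp)`. The term `-½ ∂/∂S_2` has a constant coefficient and contributes nothing. -/
theorem shiftHom_sPoly {S : Finset EvenPos} {p : MvPolynomial EvenPos ℚ} (h : p.vars ⊆ S) :
    shiftHom (sPoly p) = coeffMap sPoly (shiftHom p) +
      ∑ a ∈ S, ∑ b ∈ S, ((a.exp : ShiftPoly) + (b.exp : ShiftPoly) + 1) *
        (X 0 * X 1 ^ (a.exp + b.exp) * shiftHom (pderiv a (pderiv b p))) := by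
  have hp : p ∈ supported ℚ (S : Set EvenPos) := by
    rw [mem_supported]; exact_mod_cast h
  -- On polynomials in the variables of `S`, `𝔰` is a finite sum of multiplications composed with
  -- partial derivatives, a form to which `coeffMap` can be applied term by term.
  have h1 : ∀ q ∈ supported ℚ (S : Set EvenPos), sPoly q =
      (∑ a ∈ S, ∑ b ∈ S, LinearMap.mulLeft ℚ
        (C ((a.exp : ℚ) + b.exp + 1) * X (EvenPos.merge a b)) ∘ₗ (pderiv a).toLinearMap ∘ₗ
          (pderiv b).toLinearMap + LinearMap.mulLeft ℚ (C (-(1 / 2 : ℚ))) ∘ₗ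
          (pderiv EvenPos.two).toLinearMap) q := by
    intro q hq
    rw [mem_supported] at hq
    rw [sPoly_eq (T := S) (by exact_mod_cast hq), secondOrder]
    simp only [LinearMap.add_apply, LinearMap.sum_apply, LinearMap.comp_apply,
      LinearMap.mulLeft_apply, Derivation.coeFn_coe, Finset.smul_sum, smul_smul]
    rw [sub_eq_add_neg, ← neg_smul, smul_eq_C_mul]
    congr 1
    refine Finset.sum_congr rfl fun a _ => Finset.sum_congr rfl fun b _ => ?_
    rw [smul_eq_C_mul, mul_assoc, (EvenPos.merge a b).coe_eq_exp, EvenPos.exp_merge]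
    congr 2
    push_cast
    ring
  rw [coeffMap_congr fun m => h1 _ (coeff_shiftHom_mem_supported hp m), h1 p hp]
  simp only [coeffMap_add, coeffMap_sum, coeffMap_comp, coeffMap_mulLeft,
    coeffMap_pderiv_shiftHom, LinearMap.add_apply, LinearMap.sum_apply, LinearMap.comp_apply,
    LinearMap.mulLeft_apply, Derivation.coeFn_coe, map_add, map_sum, map_mul, shiftHom_C,
    shiftHom_X, EvenPos.exp_merge]
  rw [add_right_comm, ← Finset.sum_add_distrib]
  congr 1
  refine Finset.sum_congr rfl fun a _ => ?_
  rw [← Finset.sum_add_distrib]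
  refine Finset.sum_congr rfl fun b _ => ?_
  simp only [map_natCast, map_one]
  ring

theorem vars_pderiv_subset {S : Finset EvenPos} {p : MvPolynomial EvenPos ℚ} (h : p.vars ⊆ S)
    (a : EvenPos) : (pderiv a p).vars ⊆ S := by
  classical
  have hp : p ∈ supported ℚ (S : Set EvenPos) := by
    rw [mem_supported]; exact_mod_cast h
  suffices pderiv a p ∈ supported ℚ (S : Set EvenPos) by
    rw [mem_supported] at this; exact_mod_cast this
  clear h
  rw [supported_eq_adjoin_X] at hp ⊢
  induction hp using Algebra.adjoin_induction with
  | mem x hx =>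
    obtain ⟨i, hi, rfl⟩ := hx
    rw [pderiv_X, Pi.single_apply]
    split_ifs
    · exact one_mem _
    · exact zero_mem _
  | algebraMap r => rw [Derivation.map_algebraMap]; exact zero_mem _
  | add x y _ _ hx hy => rw [map_add]; exact add_mem hx hy
  | mul x y h h' hx hy => rw [pderiv_mul]; exact add_mem (mul_mem hx h') (mul_mem h hy)

/-- The identity behind `𝔡⟨p⟩ = ⟨𝔰p⟩`. The left side encodes `𝔰(S_k p)` through the recursion,
without the contribution of `∂S_k/∂S_2`. On the right, `(u ∂_u + 2v ∂_v + 2) ∂_u` is the action of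
`𝔡` on the factors `D ^ a G_{2b+2}`, and the last term is the action on the remaining brackets. -/
theorem euler_pderiv_shiftHom (k : EvenPos) {S : Finset EvenPos} {p : MvPolynomial EvenPos ℚ}
    (h : p.vars ⊆ S) :
    X 1 ^ k.exp * shiftHom (sPoly p) + ∑ j ∈ S, (((k : ℕ) : ShiftPoly) + ((j : ℕ) : ShiftPoly) - 2) *
      (X 1 ^ (k.exp + j.exp) * shiftHom (pderiv j p)) =
    euler (pderiv 0 (X 1 ^ k.exp * shiftHom p)) + 2 * pderiv 0 (X 1 ^ k.exp * shiftHom p) +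
      X 1 ^ k.exp * coeffMap sPoly (shiftHom p) := by
  have hv := vars_pderiv_subset h
  rw [pderiv_mul, pderiv_pow, pderiv_X_of_ne (show (1 : Fin 2) ≠ 0 by decide), mul_zero, zero_mul,
    zero_add, pderiv_shiftHom h, shiftHom_sPoly h, Finset.mul_sum, map_sum]
  simp only [Derivation.leibniz, euler_X_one_pow, smul_eq_mul, euler_shiftHom (hv _)]
  -- The second derivatives are symmetric in `a` and `b`, so `a.exp + b.exp + 1` may be replaced by
  -- `1 + 2 b.exp`, the eigenvalue appearing in `euler_shiftHom`.
  have e : ∑ a ∈ S, ∑ b ∈ S, ((a.exp : ShiftPoly) + (b.exp : ShiftPoly) + 1) *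
        (X 0 * X 1 ^ (a.exp + b.exp) * shiftHom (pderiv a (pderiv b p))) =
      ∑ j ∈ S, X 1 ^ j.exp * ∑ b ∈ S, (1 + 2 * (b.exp : ShiftPoly)) * X 0 * X 1 ^ b.exp *
        shiftHom (pderiv b (pderiv j p)) := by
    have e1 : ∑ a ∈ S, ∑ b ∈ S, (a.exp : ShiftPoly) *
        (X 0 * X 1 ^ (a.exp + b.exp) * shiftHom (pderiv a (pderiv b p))) =
        ∑ a ∈ S, ∑ b ∈ S, (b.exp : ShiftPoly) *
        (X 0 * X 1 ^ (a.exp + b.exp) * shiftHom (pderiv a (pderiv b p))) := by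
      rw [Finset.sum_comm]
      refine Finset.sum_congr rfl fun a _ => Finset.sum_congr rfl fun b _ => ?_
      rw [pderiv_comm, add_comm]
    simp only [add_mul, Finset.sum_add_distrib] at e1 ⊢
    rw [e1]
    simp only [← Finset.sum_add_distrib, Finset.mul_sum]
    refine Finset.sum_congr rfl fun a _ => Finset.sum_congr rfl fun b _ => ?_
    rw [pderiv_comm]
    ring
  rw [e, mul_add, add_comm (X 1 ^ k.exp * coeffMap sPoly (shiftHom p)), add_right_comm]
  congr 1
  rw [Finset.mul_sum, Finset.mul_sum, ← Finset.sum_add_distrib, ← Finset.sum_add_distrib]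
  refine Finset.sum_congr rfl fun j _ => ?_
  -- The first-order terms agree since `k + j - 2 = 2 (k.exp + j.exp) + 2`: the first summand comes
  -- from `2v ∂_v` acting on `v ^ (k.exp + j.exp)`, the second from the added `2 ∂_u`.
  rw [k.coe_eq_exp, j.coe_eq_exp]
  push_cast
  ring

end
end PartitionSl2

/-! ### Induction along the recursion. -/

namespace PartitionSl2
noncomputable section

open MvPolynomial

theorem exists_eq_add_single {n : ℕ} {s : EvenPos →₀ ℕ} (h : s.degree = n + 1) :
    ∃ k s', s = s' + Finsupp.single k 1 ∧ s'.degree = n := by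
  have hs : s ≠ 0 := by rintro rfl; simp at h
  obtain ⟨k, hk⟩ := Finsupp.support_nonempty_iff.2 hs
  have h1 : s - Finsupp.single k 1 + Finsupp.single k 1 = s :=
    tsub_add_cancel_of_le (Finsupp.single_le_iff.2 (Nat.one_le_iff_ne_zero.2 (by simpa using hk)))
  refine ⟨k, s - Finsupp.single k 1, h1.symm, ?_⟩
  rw [← h1, map_add, Finsupp.degree_single] at h
  omega

/-- Each factor `S_k` of a monomial either survives or is traded for `u v ^ k.exp`, which has degree
`0` in the `S_j`. This makes the recursion well founded. -/
theorem totalDegree_coeff_shiftHom_monomial (n : ℕ) (s : EvenPos →₀ ℕ) (hs : s.degree = n) (c : ℚ)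
    (m : Fin 2 →₀ ℕ) : (coeff m (shiftHom (monomial s c))).totalDegree ≤ n := by
  classical
  induction n generalizing s m with
  | zero =>
    rw [Finsupp.degree_eq_zero_iff] at hs
    rw [hs, ← C_apply, shiftHom_C, coeff_C]
    split_ifs <;> simp
  | succ n ih =>
    obtain ⟨k, s, rfl, hs'⟩ := exists_eq_add_single hs
    have h : (X 0 * X 1 ^ k.exp : ShiftPoly) =
        monomial (Finsupp.single 0 1 + Finsupp.single 1 k.exp) 1 := by
      rw [shiftPoly_monomial]; simp
    have h2 : monomial (s + Finsupp.single k 1) c = monomial s c * X k := by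
      rw [X, monomial_mul, mul_one]
    rw [h2, map_mul, shiftHom_X, mul_add, coeff_add, h, coeff_mul_monomial', mul_comm, coeff_C_mul]
    refine (totalDegree_add _ _).trans (max_le ?_ ?_)
    · refine (totalDegree_mul _ _).trans ?_
      rw [totalDegree_X, add_comm]
      exact Nat.add_le_add_right (ih s hs' m) 1
    · split_ifs
      · rw [mul_one]
        exact (ih s hs' _).trans (Nat.le_succ n)
      · simp

/-- Induction along the recursion that expresses `S_k p` by the coefficients of `shiftHom p`. -/
theorem eq_top_of_shiftHom {V : Submodule ℚ (MvPolynomial EvenPos ℚ)} (h1 : 1 ∈ V)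
    (hV : ∀ k p, (∀ m, coeff m (shiftHom p) ∈ V) → X k * p ∈ V) : V = ⊤ := by
  have key : ∀ n p, p.totalDegree < n → p ∈ V := by
    intro n
    induction n with
    | zero => intro p hp; omega
    | succ n ih =>
      intro p hp
      rw [p.as_sum]
      refine V.sum_mem fun s hs => ?_
      have hd : s.degree ≤ p.totalDegree := le_totalDegree hs
      rcases hd' : s.degree with _ | d
      · rw [Finsupp.degree_eq_zero_iff] at hd'
        rw [hd', ← C_apply, C_eq_smul_one]
        exact V.smul_mem _ h1
      · obtain ⟨k, s', hs', hs2⟩ := exists_eq_add_single hd'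
        have h2 : monomial s (coeff s p) = X k * monomial s' (coeff s p) := by
          rw [X, monomial_mul, one_mul, add_comm, ← hs']
        rw [h2]
        -- The monomial `s` has degree `d + 1`, while the coefficients of the translate of `s'` have
        -- degree at most `d`.
        refine hV k _ fun m => ih _ ?_
        have := totalDegree_coeff_shiftHom_monomial d s' hs2 (coeff s p) m
        omega
  exact eq_top_iff.2 fun p _ => key _ p (Nat.lt_succ_self _)

/-- The derivation `2 u ∂/∂u + 2 v ∂/∂v`. -/
def grade : Derivation (MvPolynomial EvenPos ℚ) ShiftPoly ShiftPoly :=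
  mkDerivation _ fun i => 2 * X i

theorem grade_C (r : MvPolynomial EvenPos ℚ) : grade (C r) = 0 := by
  rw [← algebraMap_eq, Derivation.map_algebraMap]

theorem grade_X_pow (i : Fin 2) (b : ℕ) : grade (X i ^ b) = 2 * (b : ShiftPoly) * X i ^ b := by
  rw [Derivation.leibniz_pow, grade, mkDerivation_X]
  cases b
  · simp
  · simp [pow_succ]; ring

/-- If `u` and `v` both have weight `2`, then `u v ^ j.exp` has weight `2 + 2 j.exp = j`, so the
translation preserves weights. These are also the amounts by which `D` and the step from `G_{2b+2}`
to `G_{2b+4}` raise the weight. -/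
theorem shiftHom_weightPoly (p : MvPolynomial EvenPos ℚ) :
    shiftHom (weightPoly p) = coeffMap weightPoly (shiftHom p) + grade (shiftHom p) := by
  have h1 := leibniz_eq_sum shiftHom (shiftHom.toLinearMap ∘ₗ weightPoly)
    (fun p q => by simp [weightPoly_mul]) (subset_refl p.vars)
  have h2 := leibniz_eq_sum shiftHom ((coeffMap weightPoly +
    grade.toLinearMap.restrictScalars ℚ) ∘ₗ shiftHom.toLinearMap)
    (fun p q => by
      simp only [LinearMap.comp_apply, LinearMap.add_apply, AlgHom.toLinearMap_apply, map_mul]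
      have := coeffMap_leibniz (mkDerivation ℚ fun k : EvenPos =>
        ((k : ℕ) : ℚ) • (MvPolynomial.X k : MvPolynomial EvenPos ℚ)) (shiftHom p) (shiftHom q)
      rw [show coeffMap weightPoly (shiftHom p * shiftHom q) = _ from this]
      simp [weightPoly]
      ring) (subset_refl p.vars)
  simp only [LinearMap.comp_apply, LinearMap.add_apply, AlgHom.toLinearMap_apply,
    LinearMap.restrictScalars_apply, Derivation.coeFn_coe] at h1 h2
  rw [h1, h2]
  refine Finset.sum_congr rfl fun j _ => ?_
  have h3 : coeffMap weightPoly (X 0 * X 1 ^ j.exp : ShiftPoly) = 0 := by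
    rw [show (X 0 * X 1 ^ j.exp : ShiftPoly) = C 1 * X 0 ^ 1 * X 1 ^ j.exp by
      rw [C_1]; ring, coeffMap_term, weightPoly_one]
    simp
  have h4 : grade (X 0 * X 1 ^ j.exp) = ((j : ℕ) : ShiftPoly) * (X 0 * X 1 ^ j.exp) := by
    have := grade_X_pow 0 1
    rw [pow_one] at this
    rw [Derivation.leibniz, this, grade_X_pow, j.coe_eq_exp]
    push_cast
    simp only [smul_eq_mul]
    ring
  rw [shiftHom_X, map_add, map_add, coeffMap_C, grade_C, h3, h4, weightPoly_X, map_smul,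
    shiftHom_X]
  congr 1
  simp [Algebra.smul_def]
  ring

/-! ### The recursion in an algebra with derivations `D`, `W`, `d` satisfying the commutation rules.
-/

section Pairing

variable {A : Type*} [CommRing A] [Algebra ℚ A] (D : Derivation ℚ A A) (g : ℕ → A)

/-- The linear map `u ^ a v ^ b p ↦ D ^ a (g_b) Ψ(p)`. -/
def pairing (Ψ : MvPolynomial EvenPos ℚ →ₗ[ℚ] A) : ShiftPoly →ₗ[ℚ] A :=
  ofCoeffs fun a b => LinearMap.mulLeft ℚ (D^[a] (g b)) ∘ₗ Ψ

theorem pairing_term (Ψ : MvPolynomial EvenPos ℚ →ₗ[ℚ] A) (r : MvPolynomial EvenPos ℚ) (a b : ℕ) :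
    pairing D g Ψ (C r * X 0 ^ a * X 1 ^ b) = D^[a] (g b) * Ψ r := by
  rw [pairing, ofCoeffs_term]
  rfl

theorem pairing_eq (Ψ : MvPolynomial EvenPos ℚ →ₗ[ℚ] A) (P : ShiftPoly) :
    pairing D g Ψ P = ∑ m ∈ P.support, D^[m 0] (g (m 1)) * Ψ (coeff m P) := rfl

theorem pairing_sub (Ψ Ψ' : MvPolynomial EvenPos ℚ →ₗ[ℚ] A) (P : ShiftPoly) :
    pairing D g (Ψ - Ψ') P = pairing D g Ψ P - pairing D g Ψ' P := by
  simp only [pairing_eq, LinearMap.sub_apply, mul_sub, Finset.sum_sub_distrib]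

theorem pairing_coeffMap (Ψ : MvPolynomial EvenPos ℚ →ₗ[ℚ] A)
    (f : Module.End ℚ (MvPolynomial EvenPos ℚ)) (P : ShiftPoly) :
    pairing D g Ψ (coeffMap f P) = pairing D g (Ψ ∘ₗ f) P := by
  induction P using ShiftPoly.induction with
  | term r a b => rw [coeffMap_term, pairing_term, pairing_term, LinearMap.comp_apply]
  | add P Q hP hQ => simp only [map_add, hP, hQ]

theorem pairing_X_one_pow_mul (e : ℕ) (Ψ : MvPolynomial EvenPos ℚ →ₗ[ℚ] A) (P : ShiftPoly) :
    pairing D g Ψ (X 1 ^ e * P) = pairing D (fun b => g (e + b)) Ψ P := by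
  induction P using ShiftPoly.induction with
  | term r a b =>
    rw [show (X 1 ^ e * (C r * X 0 ^ a * X 1 ^ b) : ShiftPoly) = C r * X 0 ^ a * X 1 ^ (e + b) by
      ring, pairing_term, pairing_term]
  | add P Q hP hQ => simp only [mul_add, map_add, hP, hQ]

/-- A linear map satisfying the recursion with value `0` at `1` vanishes. -/
theorem eq_zero_of_recursion {Ψ : MvPolynomial EvenPos ℚ →ₗ[ℚ] A} (h1 : Ψ 1 = 0)
    (h : ∀ k p, Ψ (X k * p) = pairing D g Ψ (X 1 ^ k.exp * shiftHom p)) : Ψ = 0 := by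
  refine LinearMap.ker_eq_top.1 (eq_top_of_shiftHom h1 fun k p hp => ?_)
  rw [LinearMap.mem_ker, h, pairing_X_one_pow_mul, pairing_eq]
  exact Finset.sum_eq_zero fun m _ => by rw [LinearMap.mem_ker.1 (hp m), mul_zero]

variable {D g} {d W : Derivation ℚ A A} (hWD : ∀ x, W (D x) = D (W x) + 2 * D x)
  (hWg : ∀ b, W (g b) = (2 * b + 2 : A) * g b)

include hWD hWg in
theorem weight_iterate (a b : ℕ) :
    W (D^[a] (g b)) = (2 * a + 2 * b + 2 : A) * D^[a] (g b) := by
  induction a with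
  | zero => simp [hWg]
  | succ a ih =>
    have h2 : D (2 * (a : A) + 2 * b + 2) = 0 := by
      have := D.map_natCast (2 * a + 2 * b + 2)
      exact_mod_cast this
    rw [Function.iterate_succ_apply', hWD, ih, D.leibniz, h2]
    simp only [smul_eq_mul]
    push_cast
    ring

variable (hdD : ∀ x, d (D x) = D (d x) + W x)
  (hdg : ∀ b, d (g b) = if b = 0 then -algebraMap ℚ A (1 / 2) else 0)

include hWD hWg hdD hdg in
-- The usual `sl₂` computation: moving `d` past each `D` produces the weights `2b + 2, 2b + 4, …, 2b
-- + 2a`, whose sum is `a (a + 2b + 1)`. The constant `d(g_0) = -1/2` is killed by any `D` applied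
-- to it.
theorem lowering_iterate (a b : ℕ) :
    d (D^[a] (g b)) = (a * (a + 2 * b + 1) : A) * D^[a - 1] (g b) -
      if a = 0 ∧ b = 0 then algebraMap ℚ A (1 / 2) else 0 := by
  induction a with
  | zero =>
    simp only [Function.iterate_zero, id_eq, hdg]
    split_ifs <;> simp_all
  | succ a ih =>
    have h0 : D (if a = 0 ∧ b = 0 then algebraMap ℚ A (1 / 2) else 0) = 0 := by
      split_ifs
      · exact D.map_algebraMap _
      · exact map_zero D
    have h2 : D ((a : A) * (a + 2 * b + 1)) = 0 := by
      have := D.map_natCast (a * (a + 2 * b + 1))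
      exact_mod_cast this
    rw [Function.iterate_succ_apply', hdD, ih, weight_iterate hWD hWg, map_sub, h0, D.leibniz, h2]
    simp only [smul_eq_mul, Nat.add_sub_cancel, Nat.succ_ne_zero, false_and, if_false]
    rcases a with _ | a
    · simp; ring
    · simp only [Nat.add_sub_cancel, ← Function.iterate_succ_apply' D]
      push_cast
      ring

include hWD hWg hdD hdg in
-- By the Leibniz rule `d` acts on `D ^ a g_b` and on `Φ`. The first action is that of `(u ∂_u + 2v
-- ∂_v + 2) ∂_u`, which sends `u ^ a v ^ b` to `a (a + 2b + 1) u ^ (a - 1) v ^ b`; the exceptional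
-- value of `d` at `g_0` is seen only by the constant coefficient of `P`.
theorem lowering_pairing (Φ : MvPolynomial EvenPos ℚ →ₗ[ℚ] A) (P : ShiftPoly) :
    d (pairing D g Φ P) = pairing D g Φ (euler (pderiv 0 P) + 2 * pderiv 0 P) +
      pairing D g (d.toLinearMap ∘ₗ Φ) P - (1 / 2 : ℚ) • Φ (constantCoeff P) := by
  induction P using ShiftPoly.induction with
  | add P Q hP hQ => simp only [map_add, hP, hQ, mul_add, smul_add]; abel
  | term r a b =>
    have hp : pderiv 0 (C r * X 0 ^ a * X 1 ^ b : ShiftPoly) =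
        (a : ℚ) • (C r * X 0 ^ (a - 1) * X 1 ^ b) := by
      rw [pderiv_mul, pderiv_C_mul, pderiv_pow, pderiv_pow, pderiv_X_self,
        pderiv_X_of_ne (show (1 : Fin 2) ≠ 0 by decide)]
      simp [Algebra.smul_def]
      ring
    have he : ∀ a : ℕ, euler (C r * X 0 ^ a * X 1 ^ b : ShiftPoly) =
        ((a : ℚ) + 2 * b) • (C r * X 0 ^ a * X 1 ^ b) := by
      intro a
      simp only [Derivation.leibniz, euler_C, euler_X_zero_pow, euler_X_one_pow, smul_eq_mul,
        Algebra.smul_def, map_add, map_mul, map_natCast, map_ofNat]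
      ring
    have hE : euler (pderiv 0 (C r * X 0 ^ a * X 1 ^ b : ShiftPoly)) +
        2 * pderiv 0 (C r * X 0 ^ a * X 1 ^ b : ShiftPoly) =
        ((a : ℚ) * (a + 2 * b + 1)) • (C r * X 0 ^ (a - 1) * X 1 ^ b) := by
      rw [hp, Derivation.map_smul_of_tower, he]
      rcases a with _ | a
      · simp
      · simp only [Nat.add_sub_cancel, Algebra.smul_def, map_add, map_mul, map_natCast,
          map_ofNat, map_one]
        push_cast
        ring
    rw [hE, map_smul, pairing_term, pairing_term, pairing_term, d.leibniz,
      lowering_iterate hWD hWg hdD hdg]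
    have hc : constantCoeff (C r * X 0 ^ a * X 1 ^ b : ShiftPoly) =
        if a = 0 ∧ b = 0 then r else 0 := by
      simp only [map_mul, map_pow, constantCoeff_C, constantCoeff_X, zero_pow_eq]
      split_ifs <;> simp_all
    rw [hc]
    simp only [smul_eq_mul, LinearMap.comp_apply, Derivation.coeFn_coe, Algebra.smul_def, map_mul,
      map_add, map_natCast, map_one, map_ofNat]
    split_ifs
    · ring
    · simp; ring

include hWD hWg in
theorem weight_pairing (Φ : MvPolynomial EvenPos ℚ →ₗ[ℚ] A) (P : ShiftPoly) :
    W (pairing D g Φ P) = pairing D g Φ (grade P + 2 * P) +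
      pairing D g (W.toLinearMap ∘ₗ Φ) P := by
  induction P using ShiftPoly.induction with
  | add P Q hP hQ => simp only [map_add, hP, hQ, mul_add]; abel
  | term r a b =>
    have hE : grade (C r * X 0 ^ a * X 1 ^ b : ShiftPoly) + 2 * (C r * X 0 ^ a * X 1 ^ b) =
        (2 * a + 2 * b + 2 : ℚ) • (C r * X 0 ^ a * X 1 ^ b) := by
      simp only [Derivation.leibniz, grade_C, grade_X_pow, smul_eq_mul,
        Algebra.smul_def, map_add, map_mul, map_natCast, map_ofNat]
      ring
    rw [hE, map_smul, pairing_term, pairing_term, W.leibniz, weight_iterate hWD hWg]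
    simp only [smul_eq_mul, LinearMap.comp_apply, Derivation.coeFn_coe, Algebra.smul_def, map_mul,
      map_add, map_natCast, map_ofNat]
    ring

include hWD hWg in
-- The difference of the two sides satisfies the recursion and vanishes at `1`, since both the
-- recursion and the translation respect weights.
theorem weight_recursion {Φ : MvPolynomial EvenPos ℚ →ₗ[ℚ] A} (h1 : Φ 1 = 1)
    (h : ∀ k p, Φ (X k * p) = pairing D g Φ (X 1 ^ k.exp * shiftHom p))
    (p : MvPolynomial EvenPos ℚ) : W (Φ p) = Φ (weightPoly p) := by
  have h0 : W.toLinearMap ∘ₗ Φ - Φ ∘ₗ weightPoly = 0 := by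
    refine eq_zero_of_recursion D g (by simp [h1, weightPoly_one]) fun k p => ?_
    rw [pairing_sub, ← pairing_coeffMap, LinearMap.sub_apply, LinearMap.comp_apply,
      LinearMap.comp_apply, Derivation.coeFn_coe, h, weight_pairing hWD hWg,
      weightPoly_X_mul, map_add Φ, map_smul, h, h, coeffMap_X_pow_mul]
    have hk : X 1 ^ k.exp * shiftHom (weightPoly p) +
        ((k : ℕ) : ℚ) • (X 1 ^ k.exp * shiftHom p) =
        (grade (X 1 ^ k.exp * shiftHom p) + 2 * (X 1 ^ k.exp * shiftHom p)) +
        X 1 ^ k.exp * coeffMap weightPoly (shiftHom p) := by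
      rw [shiftHom_weightPoly]
      simp only [Derivation.leibniz, grade_X_pow, smul_eq_mul, Algebra.smul_def, k.coe_eq_exp]
      simp only [map_add, map_mul, map_natCast, map_ofNat, Nat.cast_add, Nat.cast_mul,
        Nat.cast_ofNat]
      ring
    have hk' := congrArg (pairing D g Φ) hk
    rw [map_add, map_add _ _ (X 1 ^ k.exp * coeffMap weightPoly (shiftHom p)), map_smul] at hk'
    rw [eq_sub_of_add_eq hk']
    abel
  have := congrArg (fun f => f p) h0
  simpa [sub_eq_zero] using this

include hWD hWg hdD hdg in
-- Again the difference of the two sides satisfies the recursion. The terms of `d Φ(S_k p)` and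
-- `Φ(𝔰(S_k p))` that do not involve this difference cancel by `euler_pderiv_shiftHom`.
theorem lowering_recursion {Φ : MvPolynomial EvenPos ℚ →ₗ[ℚ] A} (h1 : Φ 1 = 1)
    (h : ∀ k p, Φ (X k * p) = pairing D g Φ (X 1 ^ k.exp * shiftHom p))
    (p : MvPolynomial EvenPos ℚ) : d (Φ p) = Φ (sPoly p) := by
  have h0 : d.toLinearMap ∘ₗ Φ - Φ ∘ₗ sPoly = 0 := by
    refine eq_zero_of_recursion D g (by simp [h1, sPoly_one]) fun k p => ?_
    rw [pairing_sub, ← pairing_coeffMap, LinearMap.sub_apply, LinearMap.comp_apply,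
      LinearMap.comp_apply, Derivation.coeFn_coe, h, lowering_pairing hWD hWg hdD hdg,
      sPoly_X_mul k (subset_refl _), map_sub, map_add Φ, h, map_sum, coeffMap_X_pow_mul]
    have hk := congrArg (pairing D g Φ) (euler_pderiv_shiftHom k (subset_refl p.vars))
    rw [map_add, map_add _ _ (X 1 ^ k.exp * coeffMap sPoly (shiftHom p)), map_sum] at hk
    have hj : ∀ j ∈ p.vars, Φ ((((k : ℕ) : ℚ) + (j : ℕ) - 2) •
        (X (EvenPos.merge k j) * pderiv j p)) =
        pairing D g Φ ((((k : ℕ) : ShiftPoly) + ((j : ℕ) : ShiftPoly) - 2) *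
          (X 1 ^ (k.exp + j.exp) * shiftHom (pderiv j p))) := by
      intro j _
      have : ((((k : ℕ) : ShiftPoly) + ((j : ℕ) : ShiftPoly) - 2) *
          (X 1 ^ (k.exp + j.exp) * shiftHom (pderiv j p))) =
          (((k : ℕ) : ℚ) + (j : ℕ) - 2) • (X 1 ^ (k.exp + j.exp) * shiftHom (pderiv j p)) := by
        simp only [Algebra.smul_def, map_add, map_sub, map_natCast, map_ofNat]
      rw [this, map_smul, map_smul, h, EvenPos.exp_merge]
    rw [Finset.sum_congr rfl hj]
    -- The two sources of `-1/2` correspond: `∂S_k/∂S_2` is nonzero exactly when `k = 2`, which is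
    -- when `v ^ k.exp` has nonzero constant term.
    have hc : Φ ((1 / 2 : ℚ) • (pderiv EvenPos.two (X k) * p)) =
        (1 / 2 : ℚ) • Φ (constantCoeff (X 1 ^ k.exp * shiftHom p)) := by
      rw [map_smul, map_mul constantCoeff, constantCoeff_shiftHom, map_pow, constantCoeff_X, zero_pow_eq]
      by_cases hk2 : k = EvenPos.two
      · rw [if_pos (EvenPos.exp_eq_zero.2 hk2), hk2, pderiv_X_self]
      · rw [if_neg (fun h => hk2 (EvenPos.exp_eq_zero.1 h)), pderiv_X_of_ne hk2]
    rw [hc, eq_sub_of_add_eq hk]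
    abel
  have := congrArg (fun f => f p) h0
  simpa [sub_eq_zero] using this

end Pairing

end
end PartitionSl2

/-! ### Removing equal parts from a partition. -/

namespace PartitionSl2
noncomputable section

open MvPolynomial

/-- The multisets of parts of the partitions of `n`. -/
def partsOf (n : ℕ) : Finset (Multiset ℕ) :=
  Finset.univ.image fun p : n.Partition => p.parts

theorem mem_partsOf {n : ℕ} {M : Multiset ℕ} :
    M ∈ partsOf n ↔ (∀ m ∈ M, 0 < m) ∧ M.sum = n := by
  simp only [partsOf, Finset.mem_image, Finset.mem_univ, true_and]
  constructor
  · rintro ⟨p, rfl⟩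
    exact ⟨fun m hm => p.parts_pos hm, p.parts_sum⟩
  · rintro ⟨h1, h2⟩
    exact ⟨⟨M, fun {m} hm => h1 m hm, h2⟩, rfl⟩

/-- Passing to multisets allows parts to be added and removed without changing the type. -/
theorem sum_partition_eq_sum_partsOf (n : ℕ) (f : Multiset ℕ → ℚ) :
    ∑ p : n.Partition, f p.parts = ∑ M ∈ partsOf n, f M := by
  rw [partsOf, Finset.sum_image]
  intro p _ p' _ h
  exact Nat.Partition.ext h

theorem sum_map_eq_sum_count (M : Multiset ℕ) (h : ℕ → ℚ) :
    (M.map h).sum = ∑ m ∈ M.toFinset, ∑ _s ∈ Finset.Icc 1 (M.count m), h m := by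
  rw [Finset.sum_multiset_map_count]
  simp

/-- Removing `s` copies of a part `m`, for all parts `m` of multiplicity at least `s`. -/
theorem sum_partsOf_sum_map_mul (n : ℕ) (h : ℕ → ℚ) (f : Multiset ℕ → ℚ) :
    ∑ M ∈ partsOf n, (M.map h).sum * f M =
      ∑ ij ∈ Finset.HasAntidiagonal.antidiagonal n, ∑ ms ∈ ij.1.divisorsAntidiagonal, ∑ M ∈ partsOf ij.2,
        h ms.1 * f (M + Multiset.replicate ms.2 ms.1) := by
  simp only [sum_map_eq_sum_count, Finset.sum_mul]
  simp only [Finset.sum_sigma']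
  -- The triple `(M, m, s)` corresponds to `m`, `s` and the partition of `n - ms` left after
  -- removing `s` copies of `m`; the inverse puts the copies back.
  refine Finset.sum_nbij'
    (fun x : Σ _ : Multiset ℕ, Σ _ : ℕ, ℕ => (⟨(x.2.1 * x.2.2, n - x.2.1 * x.2.2), ⟨(x.2.1, x.2.2),
      x.1 - Multiset.replicate x.2.2 x.2.1⟩⟩ : Σ _ : ℕ × ℕ, Σ _ : ℕ × ℕ, Multiset ℕ))
    (fun y => ⟨y.2.2 + Multiset.replicate y.2.1.2 y.2.1.1, ⟨y.2.1.1, y.2.1.2⟩⟩) ?_ ?_ ?_ ?_ ?_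
  · rintro ⟨M, m, s⟩ hx
    simp only [Finset.mem_sigma, mem_partsOf, Multiset.mem_toFinset, Finset.mem_Icc] at hx
    obtain ⟨⟨h1, h2⟩, h3, h4, h5⟩ := hx
    have h6 := h1 m h3
    have hle := Multiset.le_count_iff_replicate_le.1 h5
    have h7 : M - Multiset.replicate s m + Multiset.replicate s m = M := tsub_add_cancel_of_le hle
    have h8 := congrArg Multiset.sum h7
    rw [Multiset.sum_add, Multiset.sum_replicate, h2, smul_eq_mul, mul_comm s m] at h8
    simp only [Finset.mem_sigma, Finset.HasAntidiagonal.mem_antidiagonal, Nat.mem_divisorsAntidiagonal,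
      mem_partsOf]
    refine ⟨by omega, ⟨trivial, by positivity⟩, fun m' hm' => h1 m' (Multiset.mem_of_le
      (Multiset.sub_le_self _ _) hm'), by omega⟩
  · rintro ⟨⟨i, j⟩, ⟨m, s⟩, M⟩ hy
    simp only [Finset.mem_sigma, Finset.HasAntidiagonal.mem_antidiagonal, Nat.mem_divisorsAntidiagonal,
      mem_partsOf] at hy
    obtain ⟨h1, ⟨h2, h3⟩, h4, h5⟩ := hy
    have hs : 0 < s := Nat.pos_of_ne_zero (by rintro rfl; simp at h2; omega)
    have hm : 0 < m := Nat.pos_of_ne_zero (by rintro rfl; simp at h2; omega)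
    simp only [Finset.mem_sigma, mem_partsOf, Multiset.mem_toFinset, Finset.mem_Icc,
      Multiset.count_add, Multiset.count_replicate_self, Multiset.mem_add, Multiset.sum_add,
      Multiset.sum_replicate, smul_eq_mul, Multiset.mem_replicate]
    refine ⟨⟨?_, by rw [mul_comm s m]; omega⟩, Or.inr ⟨by omega, trivial⟩, by omega, by omega⟩
    rintro m' (h | ⟨-, rfl⟩)
    exacts [h4 _ h, hm]
  · rintro ⟨M, m, s⟩ hx
    simp only [Finset.mem_sigma, Finset.mem_Icc] at hx
    have hle := Multiset.le_count_iff_replicate_le.1 hx.2.2.2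
    simp only [tsub_add_cancel_of_le hle]
  · rintro ⟨⟨i, j⟩, ⟨m, s⟩, M⟩ hy
    simp only [Finset.mem_sigma, Finset.HasAntidiagonal.mem_antidiagonal, Nat.mem_divisorsAntidiagonal] at hy
    obtain ⟨h1, ⟨h2, h3⟩, h4⟩ := hy
    simp only [Multiset.add_sub_cancel_right, h2]
    congr 2
    omega
  · rintro ⟨M, m, s⟩ hx
    simp only [Finset.mem_sigma, Finset.mem_Icc] at hx
    have hle := Multiset.le_count_iff_replicate_le.1 hx.2.2.2
    simp only [tsub_add_cancel_of_le hle]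

/-- The value of a polynomial in the `S_k` at the partition with a given multiset of parts. -/
def evalParts (M : Multiset ℕ) : MvPolynomial EvenPos ℚ →ₐ[ℚ] ℚ :=
  aeval fun k : EvenPos => -(bernoulli k) / (2 * ((k : ℕ) : ℚ)) +
    (M.map fun m : ℕ => (m : ℚ) ^ ((k : ℕ) - 1)).sum

theorem polyEquiv_apply (p : MvPolynomial EvenPos ℚ) (l : Ptn) :
    (polyEquiv p : Ptn → ℚ) l = evalParts l.2.parts p := by
  have : ((Pi.evalAlgHom ℚ (fun _ : Ptn => ℚ) l).comp algS.val).comp polyEquiv.toAlgHom =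
      evalParts l.2.parts := by
    refine algHom_ext fun k => ?_
    have h1 : polyEquiv.toAlgHom (X k) = genS k := polyEquiv_X k
    rw [AlgHom.comp_apply, h1, evalParts, aeval_X]
    rfl
  exact congrArg (fun f => f p) this

/-- Adding `s` copies of `m` increases `S_k` by `s m ^ (k - 1) = (ms) (m ^ 2) ^ k.exp`, so the new
value is the translate evaluated at `u = ms`, `v = m ^ 2`. -/
theorem evalParts_add_replicate (M : Multiset ℕ) (m s : ℕ) (p : MvPolynomial EvenPos ℚ) :
    evalParts (M + Multiset.replicate s m) p = ∑ w ∈ (shiftHom p).support,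
      evalParts M (coeff w (shiftHom p)) * (((m : ℚ) * s) ^ w 0 * (m : ℚ) ^ (2 * w 1)) := by
  have h : (eval₂Hom (evalParts M : MvPolynomial EvenPos ℚ →+* ℚ)
      ![(m : ℚ) * s, (m : ℚ) ^ 2]).comp (shiftHom : MvPolynomial EvenPos ℚ →+* ShiftPoly) =
      (evalParts (M + Multiset.replicate s m) : MvPolynomial EvenPos ℚ →+* ℚ) := by
    refine ringHom_ext (fun r => ?_) fun k => ?_
    · simp [← algebraMap_eq]
    · have hk : (k : ℕ) - 1 = 2 * k.exp + 1 := by have := k.coe_eq_exp; omega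
      simp [shiftHom_X, evalParts, hk]
      ring
  have h1 := congrArg (fun f => f p) h
  simp only [RingHom.comp_apply, RingHom.coe_coe, coe_eval₂Hom] at h1
  rw [← h1, eval₂_eq']
  simp [pow_mul]

theorem X_zero_dvd_shiftHom_sub (p : MvPolynomial EvenPos ℚ) : X 0 ∣ shiftHom p - C p := by
  induction p using MvPolynomial.induction_on with
  | C a => rw [shiftHom_C, sub_self]; exact dvd_zero _
  | add p q hp hq => rw [map_add, C_add, add_sub_add_comm]; exact dvd_add hp hq
  | mul_X p k hp =>
    rw [map_mul, C_mul, shiftHom_X, show (shiftHom p * (C (X k) + X 0 * X 1 ^ k.exp) -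
      C p * C (X k)) = (shiftHom p - C p) * C (X k) + X 0 * (shiftHom p * X 1 ^ k.exp) by ring]
    exact dvd_add (hp.mul_right _) (dvd_mul_right _ _)

/-- Every added term carries a factor `u`, so the only monomial free of `u` is the constant one.
Hence only one Bernoulli constant enters the recursion. -/
theorem coeff_shiftHom_of_eq_zero {w : Fin 2 →₀ ℕ} (hw : w 0 = 0)
    (p : MvPolynomial EvenPos ℚ) : coeff w (shiftHom p) = if w = 0 then p else 0 := by
  classical
  obtain ⟨Q, hQ⟩ := X_zero_dvd_shiftHom_sub p
  rw [eq_add_of_sub_eq hQ, coeff_add, coeff_X_mul', if_neg (by simp [hw]), zero_add, coeff_C]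
  simp only [eq_comm]

/-! ### The recursion for the `q`-bracket as a formal power series. -/

/-- The generating series `∑ f(λ) q ^ |λ|`. -/
def numer (f : Ptn → ℚ) : PowerSeries ℚ := PowerSeries.mk fun n => ∑ p : n.Partition, f ⟨n, p⟩

theorem qBracket_eq (f : Ptn → ℚ) : qBracket f = numer f * (numer 1)⁻¹ := rfl

theorem constantCoeff_numer_one : PowerSeries.constantCoeff (numer 1) ≠ 0 := by
  rw [← PowerSeries.coeff_zero_eq_constantCoeff_apply, numer, PowerSeries.coeff_mk]
  simp

theorem qBracket_mul_numer_one (f : Ptn → ℚ) : qBracket f * numer 1 = numer f := by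
  rw [qBracket_eq, mul_assoc, PowerSeries.inv_mul_cancel _ constantCoeff_numer_one, mul_one]

theorem eq_of_mul_numer_one {a b : PowerSeries ℚ} (h : a * numer 1 = b * numer 1) : a = b := by
  have := congrArg (· * (numer 1)⁻¹) h
  simpa [mul_assoc, PowerSeries.mul_inv_cancel _ constantCoeff_numer_one] using this

theorem coeff_numer_polyEquiv (n : ℕ) (p : MvPolynomial EvenPos ℚ) :
    PowerSeries.coeff n (numer (polyEquiv p : Ptn → ℚ)) = ∑ M ∈ partsOf n, evalParts M p := by
  rw [numer, PowerSeries.coeff_mk, ← sum_partition_eq_sum_partsOf]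
  exact Finset.sum_congr rfl fun _ _ => polyEquiv_apply _ _

/-- The `q`-bracket as a linear map on polynomials in the `S_k`. -/
def bracketPoly : MvPolynomial EvenPos ℚ →ₗ[ℚ] PowerSeries ℚ where
  toFun p := qBracket (polyEquiv p : Ptn → ℚ)
  map_add' p q := by
    refine eq_of_mul_numer_one ?_
    rw [add_mul]
    simp only [qBracket_mul_numer_one]
    ext n
    simp [numer, Finset.sum_add_distrib]
  map_smul' c p := by
    refine eq_of_mul_numer_one ?_
    rw [smul_mul_assoc]
    simp only [qBracket_mul_numer_one]
    ext n
    simp [numer, Finset.mul_sum]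

theorem bracketPoly_mul_numer_one (p : MvPolynomial EvenPos ℚ) :
    bracketPoly p * numer 1 = numer (polyEquiv p : Ptn → ℚ) := qBracket_mul_numer_one _

theorem bracketPoly_one : bracketPoly 1 = 1 := by
  refine eq_of_mul_numer_one ?_
  rw [bracketPoly_mul_numer_one, one_mul, map_one]
  rfl

/-- The derivation `q d/dq` on power series. -/
def qDeriv : Derivation ℚ (PowerSeries ℚ) (PowerSeries ℚ) :=
  (PowerSeries.X : PowerSeries ℚ) • PowerSeries.derivative ℚ

theorem coeff_qDeriv (n : ℕ) (f : PowerSeries ℚ) :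
    PowerSeries.coeff n (qDeriv f) = n * PowerSeries.coeff n f := by
  rw [qDeriv, Derivation.smul_apply, smul_eq_mul]
  cases n with
  | zero => simp
  | succ n =>
    rw [PowerSeries.coeff_succ_X_mul, PowerSeries.coeff_derivative]
    push_cast
    ring

theorem coeff_qDeriv_iterate (a n : ℕ) (f : PowerSeries ℚ) :
    PowerSeries.coeff n (qDeriv^[a] f) = (n : ℚ) ^ a * PowerSeries.coeff n f := by
  induction a with
  | zero => simp
  | succ a ih => rw [Function.iterate_succ_apply', coeff_qDeriv, ih, pow_succ]; ring

/-- The Eisenstein series `G_{2b+2}` as a formal power series. -/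
def eisFormal (b : ℕ) : PowerSeries ℚ :=
  PowerSeries.C (-(bernoulli (2 * b + 2)) / (2 * ((2 * b + 2 : ℕ) : ℚ))) +
    PowerSeries.mk fun n => (ArithmeticFunction.sigma (2 * b + 1) n : ℚ)

/-- Sorting the removals by `i = ms`, the sum of `m ^ (k - 1) (ms) ^ a m ^ (2b)` over the
factorizations of `i` is `i ^ a σ_{k-1+2b}(i)`, the coefficient of `q ^ i` in `D ^ a G_{k+2b}` for
`i > 0`. -/
theorem coeff_numer_X_mul (k : EvenPos) (p : MvPolynomial EvenPos ℚ) (n : ℕ) :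
    PowerSeries.coeff n (numer (polyEquiv (X k * p) : Ptn → ℚ)) =
      -(bernoulli k) / (2 * ((k : ℕ) : ℚ)) * PowerSeries.coeff n (numer (polyEquiv p : Ptn → ℚ)) +
      ∑ w ∈ (shiftHom p).support, ∑ ij ∈ Finset.HasAntidiagonal.antidiagonal n,
        (ij.1 : ℚ) ^ w 0 * (ArithmeticFunction.sigma (2 * (k.exp + w 1) + 1) ij.1 : ℚ) *
        PowerSeries.coeff ij.2 (numer (polyEquiv (coeff w (shiftHom p)) : Ptn → ℚ)) := by
  simp only [coeff_numer_polyEquiv]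
  simp only [map_mul]
  have h1 : ∀ M, evalParts M (X k) = -(bernoulli k) / (2 * ((k : ℕ) : ℚ)) +
    (M.map fun m : ℕ => (m : ℚ) ^ ((k : ℕ) - 1)).sum := fun M => aeval_X _ k
  simp only [h1, add_mul, Finset.sum_add_distrib, sum_partsOf_sum_map_mul, ← Finset.mul_sum]
  congr 1
  rw [Finset.sum_comm (s := (shiftHom p).support)]
  refine Finset.sum_congr rfl fun ij _ => ?_
  have h2 : ∀ w : Fin 2 →₀ ℕ, (ArithmeticFunction.sigma (2 * (k.exp + w 1) + 1) ij.1 : ℚ) =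
      ∑ ms ∈ ij.1.divisorsAntidiagonal, (ms.1 : ℚ) ^ (2 * (k.exp + w 1) + 1) := by
    intro w
    rw [ArithmeticFunction.sigma_apply, Nat.sum_divisorsAntidiagonal
      (f := fun m _ => (m : ℚ) ^ (2 * (k.exp + w 1) + 1))]
    push_cast
    rfl
  have h3 : ∀ w : Fin 2 →₀ ℕ, (ij.1 : ℚ) ^ w 0 *
      (ArithmeticFunction.sigma (2 * (k.exp + w 1) + 1) ij.1 : ℚ) *
      ∑ M ∈ partsOf ij.2, evalParts M (coeff w (shiftHom p)) =
      ∑ ms ∈ ij.1.divisorsAntidiagonal, ∑ M ∈ partsOf ij.2, (ij.1 : ℚ) ^ w 0 *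
        (ms.1 : ℚ) ^ (2 * (k.exp + w 1) + 1) * evalParts M (coeff w (shiftHom p)) := by
    intro w
    rw [h2, Finset.mul_sum ij.1.divisorsAntidiagonal, Finset.sum_mul]
    exact Finset.sum_congr rfl fun ms _ => Finset.mul_sum _ _ _
  rw [Finset.sum_congr rfl fun w _ => h3 w, Finset.sum_comm]
  refine Finset.sum_congr rfl fun ms hms => ?_
  rw [Finset.sum_comm, Finset.mul_sum]
  refine Finset.sum_congr rfl fun M _ => ?_
  rw [evalParts_add_replicate, Finset.mul_sum]
  refine Finset.sum_congr rfl fun w _ => ?_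
  rw [← (Nat.mem_divisorsAntidiagonal.1 hms).1, k.coe_eq_exp]
  push_cast
  ring

theorem bracketPoly_X_mul (k : EvenPos) (p : MvPolynomial EvenPos ℚ) :
    bracketPoly (X k * p) =
      pairing qDeriv eisFormal bracketPoly (X 1 ^ k.exp * shiftHom p) := by
  refine eq_of_mul_numer_one ?_
  rw [bracketPoly_mul_numer_one, pairing_X_one_pow_mul, pairing_eq, Finset.sum_mul]
  simp only [mul_assoc, bracketPoly_mul_numer_one]
  ext n
  rw [coeff_numer_X_mul, map_sum]
  -- The divisor sum at `0` is `0`, and the factor `i ^ a` lets the Bernoulli constant survive only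
  -- for `a = 0`, where `0 ^ 0 = 1`.
  have h1 : ∀ w : Fin 2 →₀ ℕ, ∀ i, PowerSeries.coeff i (qDeriv^[w 0] (eisFormal (k.exp + w 1))) =
      (i : ℚ) ^ w 0 * (ArithmeticFunction.sigma (2 * (k.exp + w 1) + 1) i : ℚ) +
      if w 0 = 0 ∧ i = 0 then -(bernoulli (2 * (k.exp + w 1) + 2)) /
        (2 * ((2 * (k.exp + w 1) + 2 : ℕ) : ℚ)) else 0 := by
    intro w i
    rw [coeff_qDeriv_iterate, eisFormal, map_add, PowerSeries.coeff_mk, PowerSeries.coeff_C,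
      mul_add, add_comm]
    congr 1
    split_ifs <;> simp_all
  simp only [PowerSeries.coeff_mul, h1, add_mul, Finset.sum_add_distrib]
  rw [add_comm]
  congr 1
  -- Among the exponents with `a = 0` only `w = 0` has a nonzero coefficient, namely `p`; it yields
  -- the Bernoulli constant of `S_k`.
  rw [Finset.sum_eq_single 0]
  · rw [Finset.sum_eq_single (0, n)]
    · rw [coeff_shiftHom_of_eq_zero rfl, if_pos rfl, k.coe_eq_exp]
      simp
    · rintro ⟨i, j⟩ hij hne
      rw [Finset.HasAntidiagonal.mem_antidiagonal] at hij
      rw [if_neg, zero_mul]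
      rintro ⟨-, rfl⟩
      exact hne (by simp at hij ⊢; exact hij)
    · simp
  · intro w hw hw0
    refine Finset.sum_eq_zero fun ij _ => ?_
    split_ifs with h
    · rw [mem_support_iff, coeff_shiftHom_of_eq_zero h.1, if_neg hw0] at hw
      exact absurd rfl hw
    · rw [zero_mul]
  · intro h0
    rw [notMem_support_iff] at h0
    refine Finset.sum_eq_zero fun ij _ => ?_
    rw [h0]
    simp [numer]

/-- Because `S_2(λ) = |λ| - 1/24`, multiplication by `S_2` acts on numerators as `q d/dq - 1/24`.
Dividing by the generating function of partitions adds its logarithmic derivative. -/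
theorem bracketPoly_X_two_mul (p : MvPolynomial EvenPos ℚ) :
    bracketPoly (X EvenPos.two * p) = qDeriv (bracketPoly p) + eisFormal 0 * bracketPoly p := by
  have h1 : ∀ p, numer (polyEquiv (X EvenPos.two * p) : Ptn → ℚ) =
      -(1 / 24 : ℚ) • numer (polyEquiv p : Ptn → ℚ) + qDeriv (numer (polyEquiv p : Ptn → ℚ)) := by
    intro p
    ext n
    rw [map_add, coeff_qDeriv, PowerSeries.coeff_smul, coeff_numer_polyEquiv,
      coeff_numer_polyEquiv, Finset.smul_sum, Finset.mul_sum, ← Finset.sum_add_distrib]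
    refine Finset.sum_congr rfl fun M hM => ?_
    have h2 := (mem_partsOf.1 hM).2
    have h3 : evalParts M (X EvenPos.two) = -(1 / 24) + (n : ℚ) := by
      rw [evalParts, aeval_X, ← h2]
      simp [EvenPos.two, bernoulli_two]
      norm_num
    rw [map_mul, h3]
    simp only [smul_eq_mul]
    ring
  have h2 : bracketPoly (X EvenPos.two) = eisFormal 0 := by
    have := bracketPoly_X_mul EvenPos.two 1
    rw [mul_one, map_one, EvenPos.exp_eq_zero.2 rfl] at this
    rw [this]
    have h3 := pairing_term qDeriv eisFormal bracketPoly 1 0 0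
    simpa [bracketPoly_one] using h3
  refine eq_of_mul_numer_one ?_
  have h3 := bracketPoly_mul_numer_one (X EvenPos.two * 1)
  rw [h1, mul_one, h2] at h3
  have h4 : numer (polyEquiv (1 : MvPolynomial EvenPos ℚ) : Ptn → ℚ) = numer 1 := by
    rw [map_one]; rfl
  rw [h4] at h3
  have h5 := congrArg qDeriv (bracketPoly_mul_numer_one p)
  rw [qDeriv.leibniz, smul_eq_mul, smul_eq_mul] at h5
  rw [bracketPoly_mul_numer_one, h1, ← h5, ← bracketPoly_mul_numer_one p]
  -- The logarithmic derivative of the partition generating function is `G_2 + 1/24`, obtained from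
  -- `⟨S_2⟩ = G_2`.
  have h6 : qDeriv (numer 1) = eisFormal 0 * numer 1 + (1 / 24 : ℚ) • numer 1 := by
    rw [h3]; module
  rw [h6]
  simp only [Algebra.smul_def, map_neg]
  ring

end
end PartitionSl2

/-! ### The algebra of quasimodular forms and its derivations. -/

namespace PartitionSl2
noncomputable section

open Filter Topology Asymptotics UpperHalfPlane Derivative
open scoped Manifold MatrixGroups ModularForm

/-- The coefficient functions of a product. -/
def convCoeff (c c' : ℕ → ℍ → ℂ) (r : ℕ) : ℍ → ℂ :=
  ∑ ij ∈ Finset.HasAntidiagonal.antidiagonal r, c ij.1 * c' ij.2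

/-- The polynomials in `c / (cτ + d)` describing the two transformation laws multiply. -/
theorem HasQuasimodularExpansion.mul {k l : ℤ} {p p' : ℕ} {φ ψ : ℍ → ℂ} {c c' : ℕ → ℍ → ℂ}
    (h : HasQuasimodularExpansion k p φ c) (h' : HasQuasimodularExpansion l p' ψ c') :
    HasQuasimodularExpansion (k + l) (p + p') (φ * ψ) (convCoeff c c') where
  mem r := Subalgebra.sum_mem _ fun ij _ => Hol0.mul_mem (h.mem _) (h'.mem _)
  eq_zero r hr := by
    refine Finset.sum_eq_zero fun ij hij => ?_
    rw [Finset.HasAntidiagonal.mem_antidiagonal] at hij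
    rcases lt_or_ge p ij.1 with h1 | h1
    · rw [h.eq_zero _ h1, zero_mul]
    · rw [h'.eq_zero _ (by omega), mul_zero]
  transform γ τ := by
    have hdeg : ∀ (p : ℕ) (c : ℕ → ℍ → ℂ), (poly p c τ).natDegree ≤ p := by
      intro p c
      refine Polynomial.natDegree_sum_le_of_forall_le _ _ fun r hr => ?_
      exact (Polynomial.natDegree_C_mul_X_pow_le _ _).trans
        (Nat.lt_succ_iff.1 (Finset.mem_range.1 hr))
    rw [neg_add, zpow_add₀ (denom_ne_zero γ τ), Pi.mul_apply, mul_mul_mul_comm, h.transform',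
      h'.transform', ← Polynomial.eval_mul, Polynomial.eval_eq_sum_range' (n := p + p' + 1)]
    · refine Finset.sum_congr rfl fun r _ => ?_
      rw [Polynomial.coeff_mul, convCoeff, Finset.sum_apply]
      simp only [h.coeff_poly, h'.coeff_poly, Pi.mul_apply]
    · refine lt_of_le_of_lt Polynomial.natDegree_mul_le ?_
      have h1 := hdeg p c
      have h2 := hdeg p' c'
      omega

theorem mul_mem_QM {k l : ℤ} {φ ψ : ℍ → ℂ} (h : φ ∈ QM k) (h' : ψ ∈ QM l) :
    φ * ψ ∈ QM (k + l) := by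
  obtain ⟨h0, p, c, hc⟩ := h
  obtain ⟨h0', p', c', hc'⟩ := h'
  exact ⟨Hol0.mul_mem h0 h0', _, _, hc.mul hc'⟩

theorem hasQuasimodularExpansion_const (a : ℂ) :
    HasQuasimodularExpansion 0 0 (fun _ => a) (fun r => if r = 0 then fun _ => a else 0) where
  mem r := by
    split_ifs
    · exact Hol0.algebraMap_mem a
    · exact Hol0.zero_mem
  eq_zero r hr := if_neg (by omega)
  transform γ τ := by simp

theorem const_mem_QM (a : ℂ) : (fun _ => a) ∈ QM 0 :=
  ⟨Hol0.algebraMap_mem a, _, _, hasQuasimodularExpansion_const a⟩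

theorem QMF_induction {motive : QMF → Prop}
    (hom : ∀ (k : ℤ) (φ : ℍ → ℂ) (h : φ ∈ QM k), motive ⟨φ, QM_le_QMF k h⟩)
    (add : ∀ φ ψ, motive φ → motive ψ → motive (φ + ψ)) (φ : QMF) : motive φ := by
  obtain ⟨φ, h⟩ := φ
  induction h using Submodule.iSup_induction' with
  | mem k φ h => exact hom k φ h
  | zero => exact hom 0 0 (QM 0).zero_mem
  | add φ ψ _ _ h1 h2 => exact add _ _ h1 h2

theorem mul_mem_QMF {φ ψ : ℍ → ℂ} (h : φ ∈ QMF) (h' : ψ ∈ QMF) : φ * ψ ∈ QMF := by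
  suffices ∀ φ ψ : QMF, (φ : ℍ → ℂ) * ψ ∈ QMF from this ⟨φ, h⟩ ⟨ψ, h'⟩
  intro φ ψ
  induction φ using QMF_induction with
  | add φ φ' h h' => rw [Submodule.coe_add, add_mul]; exact QMF.add_mem h h'
  | hom k φ h =>
    induction ψ using QMF_induction with
    | add ψ ψ' h h' => rw [Submodule.coe_add, mul_add]; exact QMF.add_mem h h'
    | hom l ψ h' => exact QM_le_QMF _ (mul_mem_QM h h')

/-- The algebra of quasimodular forms. -/
def algQM : Subalgebra ℂ (ℍ → ℂ) where
  carrier := QMF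
  mul_mem' := mul_mem_QMF
  add_mem' := QMF.add_mem
  algebraMap_mem' a := QM_le_QMF 0 (const_mem_QM a)

/-- The algebra of quasimodular forms has the space of quasimodular forms as underlying space. -/
def algQMEquiv : algQM ≃ₗ[ℂ] QMF where
  toFun φ := ⟨φ, φ.2⟩
  invFun φ := ⟨φ, φ.2⟩
  map_add' _ _ := rfl
  map_smul' _ _ := rfl

theorem algQM_induction {motive : algQM → Prop}
    (hom : ∀ (k : ℤ) (φ : ℍ → ℂ) (h : φ ∈ QM k), motive ⟨φ, QM_le_QMF k h⟩)
    (add : ∀ φ ψ, motive φ → motive ψ → motive (φ + ψ)) (φ : algQM) : motive φ :=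
  QMF_induction (motive := fun φ => motive (algQMEquiv.symm φ)) hom
    (fun _ _ => add _ _) (algQMEquiv φ)

/-- An operator on quasimodular forms satisfying the Leibniz rule for homogeneous elements,
as a derivation. -/
def derivationOfHom (T : Module.End ℂ QMF)
    (hT : ∀ (k l : ℤ) (φ ψ : ℍ → ℂ) (h : φ ∈ QM k) (h' : ψ ∈ QM l),
      (T ⟨φ * ψ, QM_le_QMF _ (mul_mem_QM h h')⟩ : ℍ → ℂ) =
        φ * T ⟨ψ, QM_le_QMF l h'⟩ + ψ * T ⟨φ, QM_le_QMF k h⟩) : Derivation ℂ algQM algQM :=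
  Derivation.mk' (algQMEquiv.symm.toLinearMap ∘ₗ T ∘ₗ algQMEquiv.toLinearMap) (by
    intro φ ψ
    induction φ using algQM_induction with
    | add φ φ' h h' => rw [add_mul, map_add, map_add, h, h', add_smul, smul_add]; abel
    | hom k φ h =>
      induction ψ using algQM_induction with
      | add ψ ψ' h h' => rw [mul_add, map_add, map_add, h, h', add_smul, smul_add]; abel
      | hom l ψ h' => exact Subtype.ext (hT k l φ ψ h h'))

/-- The coefficient function of index `1` of a product is `φ_0 ψ_1 + φ_1 ψ_0`, and `φ_0 = φ`, `ψ_0 =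
ψ`. -/
theorem frakD_mul (k l : ℤ) (φ ψ : ℍ → ℂ) (h : φ ∈ QM k) (h' : ψ ∈ QM l) :
    (frakD ⟨φ * ψ, QM_le_QMF _ (mul_mem_QM h h')⟩ : ℍ → ℂ) =
      φ * frakD ⟨ψ, QM_le_QMF l h'⟩ + ψ * frakD ⟨φ, QM_le_QMF k h⟩ := by
  obtain ⟨p, c, hc⟩ := h.2
  obtain ⟨p', c', hc'⟩ := h'.2
  rw [frakD_apply (mul_mem_QM h h') (hc.mul hc'), frakD_apply h hc, frakD_apply h' hc', convCoeff,
    ← hc.coeff_zero, ← hc'.coeff_zero]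
  simp [Finset.Nat.antidiagonal_succ, mul_comm]

theorem opW_mul (k l : ℤ) (φ ψ : ℍ → ℂ) (h : φ ∈ QM k) (h' : ψ ∈ QM l) :
    (opW ⟨φ * ψ, QM_le_QMF _ (mul_mem_QM h h')⟩ : ℍ → ℂ) =
      φ * opW ⟨ψ, QM_le_QMF l h'⟩ + ψ * opW ⟨φ, QM_le_QMF k h⟩ := by
  rw [opW_apply (mul_mem_QM h h'), opW_apply h, opW_apply h']
  ext τ
  simp
  ring

theorem opD_mul (k l : ℤ) (φ ψ : ℍ → ℂ) (h : φ ∈ QM k) (h' : ψ ∈ QM l) :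
    (opD ⟨φ * ψ, QM_le_QMF _ (mul_mem_QM h h')⟩ : ℍ → ℂ) =
      φ * opD ⟨ψ, QM_le_QMF l h'⟩ + ψ * opD ⟨φ, QM_le_QMF k h⟩ := by
  have := normalizedDerivOfComplex_mul φ ψ h.1.1 h'.1.1
  refine this.trans ?_
  rw [add_comm, mul_comm _ ψ]
  rfl

theorem opD_apply {k : ℤ} {φ : ℍ → ℂ} (h : φ ∈ QM k) :
    opD ⟨φ, QM_le_QMF k h⟩ = ⟨normalizedDerivOfComplex φ, QM_le_QMF _ (deriv_mem_QM h)⟩ := rfl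

theorem mulG2_apply {k : ℤ} {φ : ℍ → ℂ} (h : φ ∈ QM k) :
    mulG2 ⟨φ, QM_le_QMF k h⟩ = ⟨eisG 2 * φ, QM_le_QMF _ (eisG_two_mul_mem h)⟩ := rfl

/-- Differentiate the transformation law: `x = c / (cτ + d)` has derivative `-x ^ 2`, so `φ_{r-1} x
^ (r - 1)` contributes `-(r - 1) φ_{r-1}` to the coefficient of `x ^ r`, and the automorphy factor
contributes `k φ_{r-1}`. The explicit coefficient functions are what the commutator of `𝔡` and `D`
requires. -/
theorem hasQuasimodularExpansion_deriv {k : ℤ} {p : ℕ} {φ : ℍ → ℂ} {c : ℕ → ℍ → ℂ} (h0 : φ ∈ Hol0)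
    (hc : HasQuasimodularExpansion k p φ c) :
    HasQuasimodularExpansion (k + 2) (p + 1) (normalizedDerivOfComplex φ)
      (fun r => normalizedDerivOfComplex (c r) +
        ((2 * Real.pi * Complex.I)⁻¹ * (k + 1 - r) : ℂ) • shiftCoeff c r) := by
  refine ⟨fun r => ?_, fun r hr => ?_, fun γ τ => ?_⟩
  · refine Hol0.add_mem (deriv_mem_Hol0 (hc.mem r)) (Hol0.smul_mem ?_ _)
    cases r
    · exact Hol0.zero_mem
    · exact hc.mem _
  · obtain ⟨r, rfl⟩ : ∃ s, r = s + 1 := ⟨r - 1, by omega⟩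
    simp only [shiftCoeff]
    rw [hc.eq_zero _ (by omega), hc.eq_zero _ (by omega), smul_zero, add_zero]
    exact normalizedDerivOfComplex_const 0
  · have hd := denom_ne_zero γ τ
    have hpi : (2 * Real.pi * Complex.I : ℂ) ≠ 0 := Complex.two_pi_I_ne_zero
    set x : ℂ := (γ 1 0 : ℂ) / denom γ τ with hx
    have hder : HasDerivAt (fun z : ℂ => ∑ r ∈ Finset.range (p + 1),
        (c r ∘ ofComplex) z * ((γ 1 0 : ℂ) / denom γ z) ^ r)
        (∑ r ∈ Finset.range (p + 1), (deriv (c r ∘ ofComplex) τ * x ^ r +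
          (c r ∘ ofComplex) τ * (r * x ^ (r - 1) * (-x ^ 2)))) τ := by
      refine HasDerivAt.fun_sum fun r _ => ?_
      have h1 : HasDerivAt (c r ∘ ofComplex) (deriv (c r ∘ ofComplex) τ) τ :=
        (UpperHalfPlane.mdifferentiableAt_iff.1 ((hc.mem r).1 τ)).hasDerivAt
      have h2 : HasDerivAt (fun z : ℂ => (γ 1 0 : ℂ) / denom γ z) (-x ^ 2) τ := by
        have h3 : HasDerivAt (fun z : ℂ => denom γ z) (γ 1 0 : ℂ) (τ : ℂ) := by
          have : (fun z : ℂ => denom γ z) = fun z : ℂ => (γ 1 0 : ℂ) * z + (γ 1 1 : ℂ) := by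
            ext z
            simp [denom]
          rw [this]
          simpa using ((hasDerivAt_id (τ : ℂ)).const_mul (γ 1 0 : ℂ)).add_const (γ 1 1 : ℂ)
        have h4 := (h3.inv hd).const_mul (γ 1 0 : ℂ)
        have h5 : -x ^ 2 = (γ 1 0 : ℂ) * (-(γ 1 0 : ℂ) / denom γ τ ^ 2) := by
          rw [hx]
          field_simp
        rw [h5]
        exact h4
      exact h1.mul (h2.pow r)
    have hslash : normalizedDerivOfComplex (φ ∣[k] γ) τ = (2 * Real.pi * Complex.I)⁻¹ *
        ∑ r ∈ Finset.range (p + 1), (deriv (c r ∘ ofComplex) τ * x ^ r +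
          (c r ∘ ofComplex) τ * (r * x ^ (r - 1) * (-x ^ 2))) := by
      rw [normalizedDerivOfComplex]
      congr 1
      refine (hder.congr_of_eventuallyEq ?_).deriv
      filter_upwards [isOpen_upperHalfPlaneSet.mem_nhds τ.im_pos] with z hz
      have := hc.transform γ (ofComplex z)
      rw [Function.comp_apply, ModularForm.SL_slash_apply, mul_comm, this,
        ofComplex_apply_of_im_pos hz]
      simp only [Function.comp_apply, ofComplex_apply_of_im_pos hz]
    have h5 := congrFun (normalizedDerivOfComplex_SL_slash (k := k) h0.1 (γ := γ)) τ
    rw [Pi.sub_apply, hslash, ModularForm.SL_slash_apply, ModularForm.SL_slash_apply,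
      mul_comm (φ _), hc.transform γ τ, ← hx] at h5
    rw [mul_comm, eq_add_of_sub_eq h5.symm]
    have h6 := sum_shiftCoeff p c (fun r => (2 * Real.pi * Complex.I)⁻¹ * ((k : ℂ) + 1 - r)) τ x
    simp only [Pi.add_apply, Pi.smul_apply, smul_eq_mul, add_mul, Finset.sum_add_distrib]
    rw [h6, Finset.sum_range_succ _ (p + 1), hc.eq_zero (p + 1) (Nat.lt_succ_self p)]
    have h7 : normalizedDerivOfComplex (0 : ℍ → ℂ) = 0 := normalizedDerivOfComplex_const 0
    rw [h7]
    simp only [Pi.zero_apply, zero_mul, add_zero, Finset.mul_sum, ← Finset.sum_add_distrib]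
    refine Finset.sum_congr rfl fun r _ => ?_
    rw [Function.comp_apply, ofComplex_apply, normalizedDerivOfComplex]
    rcases r with _ | r
    · simp; ring
    · push_cast
      ring

theorem opW_opD (φ : QMF) : opW (opD φ) = opD (opW φ) + (2 : ℂ) • opD φ := by
  induction φ using QMF_induction with
  | add φ ψ h h' => simp only [map_add, smul_add, h, h']; abel
  | hom k φ h =>
    rw [opW_apply h, map_smul, opD_apply h, opW_apply (deriv_mem_QM h)]
    push_cast
    module

/-- For `r = 1` the factor `k + 1 - r` in the expansion of the derivative is the weight `k`. -/
theorem frakD_opD (φ : QMF) : frakD (opD φ) = opD (frakD φ) + opW φ := by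
  induction φ using QMF_induction with
  | add φ ψ h h' => simp only [map_add, h, h']; abel
  | hom k φ h =>
    obtain ⟨p, c, hc⟩ := h.2
    rw [opD_apply h, opW_apply h]
    ext1
    rw [frakD_apply (deriv_mem_QM h) (hasQuasimodularExpansion_deriv h.1 hc), Submodule.coe_add]
    have h1 : (opD (frakD ⟨φ, QM_le_QMF k h⟩) : ℍ → ℂ) =
        normalizedDerivOfComplex (frakD ⟨φ, QM_le_QMF k h⟩ : ℍ → ℂ) := rfl
    rw [h1, frakD_apply h hc, normalizedDerivOfComplex_smul _ _ (hc.mem 1).1, smul_add, smul_smul,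
      ← mul_assoc, mul_inv_cancel₀ Complex.two_pi_I_ne_zero, one_mul]
    simp [shiftCoeff, hc.coeff_zero]

theorem opW_frakD (φ : QMF) : opW (frakD φ) = frakD (opW φ) - (2 : ℂ) • frakD φ := by
  induction φ using QMF_induction with
  | add φ ψ h h' => simp only [map_add, smul_add, h, h']; abel
  | hom k φ h =>
    obtain ⟨p, c, hc⟩ := h.2
    have h1 : frakD ⟨φ, QM_le_QMF k h⟩ = (2 * Real.pi * Complex.I : ℂ) •
        (⟨c 1, QM_le_QMF (k - 2) ⟨hc.mem 1, _, _, hc.one⟩⟩ : QMF) :=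
      Subtype.ext (frakD_apply h hc)
    rw [opW_apply h, map_smul, h1, map_smul, opW_apply (k := k - 2) ⟨hc.mem 1, _, _, hc.one⟩]
    push_cast
    module

theorem hasQuasimodularExpansion_eisG_two : HasQuasimodularExpansion 2 1 (eisG 2)
    (fun r => if r = 0 then eisG 2 else if r = 1 then
      fun _ => -(1 / (4 * Real.pi * Complex.I)) else 0) where
  mem r := by
    split_ifs
    · exact eisG_two_mem_Hol0
    · exact Hol0.algebraMap_mem _
    · exact Hol0.zero_mem
  eq_zero r hr := by rw [if_neg (by omega), if_neg (by omega)]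
  transform γ τ := by
    rw [eisG_two_slash]
    simp [Finset.sum_range_succ]

theorem eisG_two_mem_QM : eisG 2 ∈ QM 2 :=
  ⟨eisG_two_mem_Hol0, _, _, hasQuasimodularExpansion_eisG_two⟩

theorem frakD_eisG_two : (frakD ⟨eisG 2, QM_le_QMF 2 eisG_two_mem_QM⟩ : ℍ → ℂ) =
    fun _ => -(1 / 2) := by
  rw [frakD_apply eisG_two_mem_QM hasQuasimodularExpansion_eisG_two]
  ext τ
  have hpi : (Real.pi : ℂ) ≠ 0 := by exact_mod_cast Real.pi_ne_zero
  simp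
  field_simp
  norm_num

theorem frakD_mulG2 (φ : QMF) : frakD (mulG2 φ) = mulG2 (frakD φ) - (1 / 2 : ℂ) • φ := by
  induction φ using QMF_induction with
  | add φ ψ h h' => simp only [map_add, smul_add, h, h']; abel
  | hom k φ h =>
    ext1
    have h1 := frakD_mul 2 k (eisG 2) φ eisG_two_mem_QM h
    rw [frakD_eisG_two] at h1
    refine h1.trans ?_
    rw [Submodule.coe_sub, show (mulG2 (frakD ⟨φ, QM_le_QMF k h⟩) : ℍ → ℂ) =
      eisG 2 * frakD ⟨φ, QM_le_QMF k h⟩ from rfl]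
    ext τ
    simp
    ring

theorem opW_mulG2 (φ : QMF) : opW (mulG2 φ) = mulG2 (opW φ) + (2 : ℂ) • mulG2 φ := by
  induction φ using QMF_induction with
  | add φ ψ h h' => simp only [map_add, smul_add, h, h']; abel
  | hom k φ h =>
    rw [opW_apply h, map_smul, mulG2_apply h, opW_apply (eisG_two_mul_mem h)]
    push_cast
    module

/-- Adding `G_2` to `D` keeps the weight shift `2` and, since `𝔡` is a derivation with `𝔡 G_2 =
-1/2`, changes `[𝔡, D] = W` into `W - 1/2`. -/
theorem sl2_QMF : IsSl2OperatorTriple (opD + mulG2) frakD (opW - (1 / 2 : ℂ) • 1) := by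
  refine ⟨?_, ?_, ?_⟩ <;> refine LinearMap.ext fun φ => ?_ <;>
    simp only [LinearMap.sub_apply, LinearMap.add_apply, Module.End.mul_apply, LinearMap.smul_apply,
      Module.End.one_apply, LinearMap.neg_apply, map_add, map_sub, map_smul]
  · rw [opW_opD, opW_mulG2]
    module
  · rw [opW_frakD]
    module
  · rw [frakD_opD, frakD_mulG2]
    module

/-! ### The Eisenstein series of weight at least `4` and their `q`-expansions. -/

section Eisenstein

variable {k : ℕ} (hk : 3 ≤ k) (hk2 : Even k)

include hk2 in
theorem eisG_eq_smul_E : eisG k = (-(bernoulli k : ℂ) / (2 * (k : ℂ))) • ⇑(ModularForm.E hk) := by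
  ext τ
  -- The normalized series has `B_k` in the denominators of its coefficients. By Euler's formula
  -- `B_k = 0` would force `ζ(k) = 0`, which is impossible for `k > 1`.
  have hB : (bernoulli k : ℂ) ≠ 0 := by
    obtain ⟨m, rfl⟩ := even_iff_exists_two_mul.1 hk2
    intro h0
    have h1 := riemannZeta_two_mul_nat (show m ≠ 0 by omega)
    rw [h0, mul_zero, zero_div] at h1
    refine riemannZeta_ne_zero_of_one_lt_re ?_ h1
    have : (1 : ℝ) < 2 * m := by exact_mod_cast (by omega : 1 < 2 * m)
    simpa using this
  have hk0 : (k : ℂ) ≠ 0 := by exact_mod_cast (by omega : k ≠ 0)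
  have h := tsum_prod_pow_eq_tsum_sigma (k - 1) (norm_exp_two_pi_I_lt_one τ)
  rw [Pi.smul_apply, EisensteinSeries.q_expansion_bernoulli hk hk2, eisG, h]
  simp only [zpow_natCast, smul_eq_mul]
  field_simp
  ring

include hk hk2 in
theorem eisG_mem_Hol0 : eisG k ∈ Hol0 := by
  rw [eisG_eq_smul_E hk hk2]
  obtain ⟨B, hB⟩ := ModularFormClass.exists_bound (k := (k : ℤ)) (by positivity)
    (ModularForm.E hk)
  have hB0 : 0 ≤ B := nonneg_of_mul_nonneg_left ((norm_nonneg _).trans (hB UpperHalfPlane.I))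
    (lt_max_of_lt_left one_pos)
  have hk0 : (0 : ℝ) < k := by exact_mod_cast (by omega : 0 < k)
  refine Hol0.smul_mem ⟨(ModularForm.E hk).holo', fun C hC => ⟨?_, ?_⟩⟩ _
  · refine IsBigO.of_bound B ?_
    have : ∀ᶠ τ : ℍ in comap UpperHalfPlane.im atTop, 1 ≤ τ.im :=
      (eventually_ge_atTop 1).comap _
    filter_upwards [this] with τ hτ
    refine (hB τ).trans ?_
    rw [Real.norm_of_nonneg (Real.exp_nonneg _)]
    refine mul_le_mul_of_nonneg_left (max_le (Real.one_le_exp (by positivity)) ?_) hB0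
    refine le_trans ?_ (Real.one_le_exp (by positivity))
    rw [zpow_natCast]
    exact (div_le_one (by positivity)).2 (one_le_pow₀ hτ)
  · refine IsBigO.of_bound (B * (1 + (C / k)⁻¹ ^ k)) (Eventually.of_forall fun τ => ?_)
    refine (hB τ).trans ?_
    rw [Real.norm_of_nonneg (Real.exp_nonneg _), mul_assoc]
    have hy := τ.im_pos
    refine mul_le_mul_of_nonneg_left ?_ hB0
    have h1 := le_exp_mul (C / k) (1 / τ.im) (by positivity)
    have h2 := pow_le_pow_left₀ (by positivity) h1 k
    rw [mul_pow, ← Real.exp_nat_mul, show (k : ℝ) * (C / k * (1 / τ.im)) = C / τ.im by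
      field_simp] at h2
    have h3 : 1 ≤ Real.exp (C / τ.im) := Real.one_le_exp (by positivity)
    rw [zpow_natCast, ← one_div_pow, add_mul, one_mul]
    have h4 : 0 ≤ (C / k)⁻¹ ^ k * Real.exp (C / τ.im) := by positivity
    refine max_le (by linarith) (by linarith)

include hk hk2 in
theorem hasQuasimodularExpansion_eisG : HasQuasimodularExpansion k 0 (eisG k)
    (fun r => if r = 0 then eisG k else 0) where
  mem r := by
    split_ifs
    · exact eisG_mem_Hol0 hk hk2
    · exact Hol0.zero_mem
  eq_zero r hr := if_neg (by omega)
  transform γ τ := by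
    have h := SlashInvariantForm.slash_action_eqn'' (ModularForm.E hk)
      (γ := (γ : GL (Fin 2) ℝ)) (MonoidHom.mem_range.2 ⟨γ, rfl⟩) τ
    have h1 : ModularForm.E hk (γ • τ) = denom γ τ ^ (k : ℤ) * ModularForm.E hk τ := h
    have hd := zpow_ne_zero k (denom_ne_zero γ τ)
    rw [eisG_eq_smul_E hk hk2, Pi.smul_apply, h1, zpow_neg]
    simp [field]

include hk hk2 in
theorem eisG_mem_QM : eisG k ∈ QM k :=
  ⟨eisG_mem_Hol0 hk hk2, _, _, hasQuasimodularExpansion_eisG hk hk2⟩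

end Eisenstein

theorem hasSum_eisG (b : ℕ) (τ : ℍ) :
    HasSum (fun n : ℕ => ((PowerSeries.coeff n (eisFormal b) : ℚ) : ℂ) *
      Complex.exp (2 * Real.pi * Complex.I * τ) ^ n) (eisG (2 * b + 2) τ) := by
  have hs := EisensteinSeries.summable_sigma_mul_cexp_pow (k := 2 * b + 2) (by omega) τ
  have h := tsum_prod_pow_eq_tsum_sigma (2 * b + 1) (norm_exp_two_pi_I_lt_one τ)
  -- The index `0` may be added because the divisor sum vanishes there.
  have h2 : ∑' n : ℕ+, (ArithmeticFunction.sigma (2 * b + 1) n : ℂ) *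
      Complex.exp (2 * Real.pi * Complex.I * τ) ^ (n : ℕ) =
      ∑' n : ℕ, (ArithmeticFunction.sigma (2 * b + 1) n : ℂ) *
        Complex.exp (2 * Real.pi * Complex.I * τ) ^ n :=
    PNat.coe_injective.tsum_eq (f := fun n : ℕ => (ArithmeticFunction.sigma (2 * b + 1) n : ℂ) *
        Complex.exp (2 * Real.pi * Complex.I * τ) ^ n) (by
      intro n hn
      have : n ≠ 0 := by rintro rfl; simp at hn
      exact ⟨⟨n, Nat.pos_of_ne_zero this⟩, rfl⟩)
  rw [eisG, show 2 * b + 2 - 1 = 2 * b + 1 by omega, h, h2]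
  have h3 := (hasSum_ite_eq (0 : ℕ)
    (-(bernoulli (2 * b + 2) : ℂ) / (2 * ((2 * b + 2 : ℕ) : ℂ)))).add hs.hasSum
  refine h3.congr_fun ?_
  intro n
  rw [eisFormal, map_add, PowerSeries.coeff_C, PowerSeries.coeff_mk]
  split_ifs with hn
  · subst hn; simp
  · simp

end
end PartitionSl2

/-! ### Convergence of the bracket to a quasimodular form. -/

namespace PartitionSl2
noncomputable section

open Filter Topology UpperHalfPlane Derivative

/-- The power series `p`, evaluated at `q = e ^ (2 π i τ)`, converges to `φ(τ)` for all `τ`. -/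
def HasQSeries (p : PowerSeries ℚ) (φ : ℍ → ℂ) : Prop :=
  ∀ τ : ℍ, HasSum (fun n : ℕ => ((PowerSeries.coeff n p : ℚ) : ℂ) *
    Complex.exp (2 * Real.pi * Complex.I * τ) ^ n) (φ τ)

namespace HasQSeries

variable {p p' : PowerSeries ℚ} {φ φ' : ℍ → ℂ}

theorem unique (h : HasQSeries p φ) (h' : HasQSeries p φ') : φ = φ' :=
  funext fun τ => (h τ).unique (h' τ)

theorem add (h : HasQSeries p φ) (h' : HasQSeries p' φ') : HasQSeries (p + p') (φ + φ') :=
  fun τ => by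
    refine ((h τ).add (h' τ)).congr_fun fun n => ?_
    rw [map_add]
    push_cast
    ring

theorem const (c : ℚ) : HasQSeries (PowerSeries.C c) (fun _ => (c : ℂ)) := fun τ => by
  refine (hasSum_ite_eq (0 : ℕ) (c : ℂ)).congr_fun fun n => ?_
  rw [PowerSeries.coeff_C]
  split_ifs with hn
  · subst hn; simp
  · simp

theorem mul (h : HasQSeries p φ) (h' : HasQSeries p' φ') : HasQSeries (p * p') (φ * φ') :=
  fun τ => by
    have h1 := (h τ).summable.norm
    have h2 := (h' τ).summable.norm
    have h3 := (summable_norm_sum_mul_antidiagonal_of_summable_norm h1 h2).of_norm.hasSum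
    rw [← tsum_mul_tsum_eq_tsum_sum_antidiagonal_of_summable_norm h1 h2, (h τ).tsum_eq,
      (h' τ).tsum_eq] at h3
    refine h3.congr_fun fun n => ?_
    rw [PowerSeries.coeff_mul]
    push_cast
    rw [Finset.sum_mul]
    refine Finset.sum_congr rfl fun ij hij => ?_
    rw [← Finset.HasAntidiagonal.mem_antidiagonal.1 hij, pow_add]
    ring

/-- Termwise differentiation. Absolute convergence at one point of imaginary part `y / 2` bounds the
series uniformly on the half plane above it, since the terms decrease in absolute value as the
imaginary part grows. -/
theorem normalizedDeriv (h : HasQSeries p φ) : HasQSeries (qDeriv p) (normalizedDerivOfComplex φ) := by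
  intro τ
  have hy := τ.im_pos
  -- The terms at this point, half as high as `τ`, are the majorant on the open half plane `Im z >
  -- τ.im / 2`, which contains `τ`.
  set τ' : ℍ := ⟨((τ.im / 2 : ℝ) : ℂ) * Complex.I, by simpa using hy⟩ with hτ'
  have hu := (h τ').summable.norm
  have hU : IsOpen {z : ℂ | τ.im / 2 < z.im} := isOpen_lt continuous_const Complex.continuous_im
  have hexp : ∀ z : ℂ, ‖Complex.exp (2 * Real.pi * Complex.I * z)‖ =
      Real.exp (-(2 * Real.pi * z.im)) := by
    intro z
    rw [Complex.norm_exp]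
    congr 1
    simp [mul_assoc]
  have hD : ∀ (n : ℕ) (z : ℂ), HasDerivAt (fun z : ℂ => ((PowerSeries.coeff n p : ℚ) : ℂ) *
      Complex.exp (2 * Real.pi * Complex.I * z) ^ n) (2 * Real.pi * Complex.I *
      (((PowerSeries.coeff n (qDeriv p) : ℚ) : ℂ) *
        Complex.exp (2 * Real.pi * Complex.I * z) ^ n)) z := by
    intro n z
    have h1 : HasDerivAt (fun z : ℂ => 2 * Real.pi * Complex.I * z) (2 * Real.pi * Complex.I) z := by
      simpa using (hasDerivAt_id z).const_mul (2 * Real.pi * Complex.I : ℂ)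
    refine ((h1.cexp.pow n).const_mul ((PowerSeries.coeff n p : ℚ) : ℂ)).congr_deriv ?_
    rw [coeff_qDeriv]
    cases n with
    | zero => simp
    | succ n => push_cast; ring_nf
  have hsum := Complex.hasSum_deriv_of_summable_norm (z := (τ : ℂ)) hu
    (fun n z _ => (hD n z).differentiableAt.differentiableWithinAt) hU (fun n z hz => by
      rw [norm_mul, norm_mul, norm_pow, norm_pow, hexp, hexp]
      refine mul_le_mul_of_nonneg_left (pow_le_pow_left₀ (Real.exp_nonneg _)
        (Real.exp_le_exp.2 ?_) n) (norm_nonneg _)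
      have h1 : (τ' : ℂ).im = τ.im / 2 := by simp [hτ']
      rw [h1]
      have hz' : τ.im / 2 < z.im := hz
      have := Real.pi_pos
      nlinarith) (show τ.im / 2 < (τ : ℂ).im by rw [coe_im]; linarith)
  have heq : deriv (fun z : ℂ => ∑' n : ℕ, ((PowerSeries.coeff n p : ℚ) : ℂ) *
      Complex.exp (2 * Real.pi * Complex.I * z) ^ n) τ = deriv (φ ∘ ofComplex) τ := by
    refine Filter.EventuallyEq.deriv_eq ?_
    filter_upwards [isOpen_upperHalfPlaneSet.mem_nhds τ.im_pos] with z hz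
    rw [Function.comp_apply, ofComplex_apply_of_im_pos hz]
    exact (h ⟨z, hz⟩).tsum_eq
  rw [heq] at hsum
  simp only [(hD _ _).deriv] at hsum
  refine (hsum.mul_left (2 * Real.pi * Complex.I : ℂ)⁻¹).congr_fun fun n => ?_
  rw [← mul_assoc, inv_mul_cancel₀ Complex.two_pi_I_ne_zero, one_mul]

end HasQSeries

/-- The derivation `D` of the algebra of quasimodular forms. -/
def derD : Derivation ℚ algQM algQM := (derivationOfHom opD opD_mul).restrictScalars ℚ

/-- The derivation `𝔡` of the algebra of quasimodular forms. -/
def derFrakD : Derivation ℚ algQM algQM := (derivationOfHom frakD frakD_mul).restrictScalars ℚ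

/-- The weight derivation of the algebra of quasimodular forms. -/
def derW : Derivation ℚ algQM algQM := (derivationOfHom opW opW_mul).restrictScalars ℚ

theorem eisG_mem_QM_even (b : ℕ) : eisG (2 * b + 2) ∈ QM ((2 * b + 2 : ℕ) : ℤ) := by
  rcases b with _ | b
  · exact eisG_two_mem_QM
  · exact eisG_mem_QM (by omega) ⟨b + 1 + 1, by ring⟩

/-- The Eisenstein series `G_{2b+2}` in the algebra of quasimodular forms. -/
def eisQM (b : ℕ) : algQM := ⟨eisG (2 * b + 2), QM_le_QMF _ (eisG_mem_QM_even b)⟩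

theorem derW_derD (φ : algQM) : derW (derD φ) = derD (derW φ) + 2 * derD φ := by
  have := opW_opD (algQMEquiv φ)
  rw [two_smul] at this
  rw [two_mul]
  exact congrArg algQMEquiv.symm this

theorem derFrakD_derD (φ : algQM) : derFrakD (derD φ) = derD (derFrakD φ) + derW φ :=
  congrArg algQMEquiv.symm (frakD_opD (algQMEquiv φ))

theorem derW_eisQM (b : ℕ) : derW (eisQM b) = (2 * b + 2 : algQM) * eisQM b := by
  have := congrArg algQMEquiv.symm (opW_apply (eisG_mem_QM_even b))
  rw [map_smul] at this
  have h2 : (2 * b + 2 : algQM) = algebraMap ℂ algQM ((2 * b + 2 : ℕ) : ℤ) := by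
    have := map_natCast (algebraMap ℂ algQM) (2 * b + 2)
    exact_mod_cast this.symm
  rw [h2, ← Algebra.smul_def]
  exact this

theorem derFrakD_eisQM (b : ℕ) :
    derFrakD (eisQM b) = if b = 0 then -algebraMap ℚ algQM (1 / 2) else 0 := by
  split_ifs with hb
  · subst hb
    refine Subtype.ext (frakD_eisG_two.trans ?_)
    ext τ
    simp
  · refine Subtype.ext ((frakD_apply (eisG_mem_QM_even b)
      (hasQuasimodularExpansion_eisG (by omega) ⟨b + 1, by ring⟩)).trans ?_)
    simp

theorem hasQSeries_iterate {p : PowerSeries ℚ} {φ : algQM} (h : HasQSeries p φ) (a : ℕ) :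
    HasQSeries (qDeriv^[a] p) (derD^[a] φ : algQM) := by
  induction a with
  | zero => exact h
  | succ a ih => rw [Function.iterate_succ_apply', Function.iterate_succ_apply']; exact ih.normalizedDeriv

/-- The algebra of pairs of a power series and the quasimodular form to which it converges. -/
def seriesAlg : Subalgebra ℚ (PowerSeries ℚ × algQM) where
  carrier := {x | HasQSeries x.1 x.2}
  mul_mem' h h' := h.mul h'
  add_mem' h h' := h.add h'
  algebraMap_mem' c := HasQSeries.const c

/-- The power series that converge to quasimodular forms are an algebra containing all `D ^ a
G_{2b+2}`, so the recursion never leaves it. -/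
theorem exists_hasQSeries (p : MvPolynomial EvenPos ℚ) :
    ∃ φ : algQM, HasQSeries (bracketPoly p) φ := by
  set V : Submodule ℚ (MvPolynomial EvenPos ℚ) := (Subalgebra.toSubmodule
    (seriesAlg.map (AlgHom.fst ℚ (PowerSeries ℚ) algQM))).comap bracketPoly with hV
  have hmem : ∀ x, x ∈ seriesAlg.map (AlgHom.fst ℚ (PowerSeries ℚ) algQM) ↔
      ∃ φ : algQM, HasQSeries x φ := fun x =>
    ⟨fun ⟨y, hy, hx⟩ => ⟨y.2, hx ▸ hy⟩, fun ⟨φ, h⟩ => ⟨(x, φ), h, rfl⟩⟩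
  suffices V = ⊤ by
    have h : p ∈ V := this ▸ Submodule.mem_top
    exact (hmem _).1 h
  refine eq_top_of_shiftHom ?_ fun k p hp => ?_
  · change bracketPoly 1 ∈ seriesAlg.map _
    rw [bracketPoly_one]
    exact one_mem _
  · change bracketPoly _ ∈ seriesAlg.map _
    rw [bracketPoly_X_mul, pairing_X_one_pow_mul, pairing_eq]
    refine Subalgebra.sum_mem _ fun w _ => Subalgebra.mul_mem _ ?_ (hp w)
    exact (hmem _).2 ⟨_, hasQSeries_iterate (φ := eisQM _) (hasSum_eisG _) _⟩

/-- The `q`-bracket of a polynomial in the `S_k`, as a quasimodular form. -/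
def bracketQM : MvPolynomial EvenPos ℚ →ₗ[ℚ] algQM where
  toFun p := (exists_hasQSeries p).choose
  map_add' p p' := Subtype.ext ((exists_hasQSeries (p + p')).choose_spec.unique (by
    rw [map_add]
    exact (exists_hasQSeries p).choose_spec.add (exists_hasQSeries p').choose_spec))
  map_smul' c p := Subtype.ext ((exists_hasQSeries (c • p)).choose_spec.unique (by
    rw [map_smul, PowerSeries.smul_eq_C_mul, RingHom.id_apply, Algebra.smul_def]
    exact (HasQSeries.const c).mul (exists_hasQSeries p).choose_spec))

theorem hasQSeries_bracketQM (p : MvPolynomial EvenPos ℚ) :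
    HasQSeries (bracketPoly p) (bracketQM p : algQM) := (exists_hasQSeries p).choose_spec

theorem bracketQM_eq {p : MvPolynomial EvenPos ℚ} {φ : algQM} (h : HasQSeries (bracketPoly p) φ) :
    bracketQM p = φ := Subtype.ext ((hasQSeries_bracketQM p).unique h)

theorem bracketQM_one : bracketQM 1 = 1 := by
  refine bracketQM_eq ?_
  rw [bracketPoly_one]
  exact seriesAlg.one_mem

/-- The formal recursion transfers term by term, since sums and products of pairs (series, limit)
are again such pairs and the limit is unique. -/
theorem bracketQM_X_mul (k : EvenPos) (p : MvPolynomial EvenPos ℚ) :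
    bracketQM (MvPolynomial.X k * p) =
      pairing derD eisQM bracketQM (MvPolynomial.X 1 ^ k.exp * shiftHom p) := by
  refine bracketQM_eq ?_
  rw [bracketPoly_X_mul, pairing_X_one_pow_mul, pairing_X_one_pow_mul, pairing_eq, pairing_eq]
  have : (∑ m ∈ (shiftHom p).support, (qDeriv^[m 0] (eisFormal (k.exp + m 1)) *
      bracketPoly (MvPolynomial.coeff m (shiftHom p)), derD^[m 0] (eisQM (k.exp + m 1)) *
      bracketQM (MvPolynomial.coeff m (shiftHom p)))) ∈ seriesAlg :=
    Subalgebra.sum_mem _ fun m _ => (hasQSeries_iterate (φ := eisQM _) (hasSum_eisG _) _).mul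
      (hasQSeries_bracketQM _)
  have h2 : HasQSeries _ _ := this
  rwa [Prod.fst_sum, Prod.snd_sum] at h2

theorem bracketQM_weight (p : MvPolynomial EvenPos ℚ) :
    derW (bracketQM p) = bracketQM (weightPoly p) :=
  weight_recursion derW_derD derW_eisQM bracketQM_one bracketQM_X_mul p

theorem bracketQM_lowering (p : MvPolynomial EvenPos ℚ) :
    derFrakD (bracketQM p) = bracketQM (sPoly p) :=
  lowering_recursion derW_derD derW_eisQM derFrakD_derD derFrakD_eisQM bracketQM_one
    bracketQM_X_mul p

theorem bracketQM_X_two_mul (p : MvPolynomial EvenPos ℚ) :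
    bracketQM (MvPolynomial.X EvenPos.two * p) = derD (bracketQM p) + eisQM 0 * bracketQM p := by
  refine bracketQM_eq ?_
  rw [bracketPoly_X_two_mul]
  exact (hasQSeries_bracketQM p).normalizedDeriv.add (HasQSeries.mul (hasSum_eisG 0) (hasQSeries_bracketQM p))

end
end PartitionSl2

/-! ### The theorem, transported from polynomials to the algebra of the moment functions. -/

theorem mainTheorem9 :
    IsSl2OperatorTriple mulS2 frakS (weightS - (1 / 2 : ℚ) • 1) ∧
    IsSl2OperatorTriple (opD + mulG2) frakD (opW - (1 / 2 : ℂ) • 1) ∧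
    ∃ br : algS →ₗ[ℚ] QMF,
      (∀ (f : algS) (τ : UpperHalfPlane),
        HasSum (fun n : ℕ => ((PowerSeries.coeff n (qBracket (f : Ptn → ℚ)) : ℚ) : ℂ) *
          Complex.exp (2 * Real.pi * Complex.I * τ) ^ n) ((br f : UpperHalfPlane → ℂ) τ)) ∧
      ∀ f : algS,
        (opD + mulG2) (br f) = br (mulS2 f) ∧
        (opW - (1 / 2 : ℂ) • 1) (br f) = br ((weightS - (1 / 2 : ℚ) • 1) f) ∧
        frakD (br f) = br (frakS f) := by
  refine ⟨sl2_algS, sl2_QMF, ⟨⟨fun f => algQMEquiv (bracketQM (polyEquiv.symm f)), ?_⟩, ?_⟩, ?_, ?_⟩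
  · intro f g
    simp only [map_add]
  · intro c f
    change algQMEquiv (bracketQM (polyEquiv.symm (c • f))) = _
    rw [map_smul, map_smul]
    rfl
  · intro f τ
    have := hasQSeries_bracketQM (polyEquiv.symm f) τ
    have h : bracketPoly (polyEquiv.symm f) = qBracket (f : Ptn → ℚ) := by
      rw [← polyEquiv.apply_symm_apply f]
      simp [bracketPoly]
    rw [h] at this
    exact this
  · intro f
    obtain ⟨p, rfl⟩ := polyEquiv.surjective f
    have hm : mulS2 (polyEquiv p) = polyEquiv (MvPolynomial.X EvenPos.two * p) := by
      simp [mulS2, polyEquiv_X]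
    have hW : weightS (polyEquiv p) = polyEquiv (weightPoly p) := by
      simp [weightS, LinearEquiv.conj_apply]
    have hs : frakS (polyEquiv p) = polyEquiv (sPoly p) := by
      simp [frakS, LinearEquiv.conj_apply]
    simp only [LinearMap.coe_mk, AddHom.coe_mk, LinearMap.sub_apply, LinearMap.smul_apply,
      Module.End.one_apply, hm, hW, hs, ← map_smul, ← map_sub, AlgEquiv.symm_apply_apply]
    refine ⟨?_, ?_, ?_⟩
    · rw [bracketQM_X_two_mul]
      rfl
    · rw [map_sub bracketQM, ← bracketQM_weight, map_smul bracketQM]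
      -- It remains to identify the action of the rational scalar `1/2` with that of the complex
      -- one.
      refine Subtype.ext (congrArg₂ (· - ·) rfl ?_)
      ext τ
      simp [algQMEquiv, Algebra.smul_def]
    · rw [← bracketQM_lowering]
      rfl
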